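/- Let $R$ be a commutative ring with unit, let $r\ge 0$ be an integer and let $2\le n\le\infty$. \textbf{Almost Brown categories.} A category $\mathcal C$ with finite products (in particular a final object) and two classes of maps, weak equivalences $\mathcal W$ and fibrations $\mathcal Fib$ (acyclic fibrations are the maps in $\mathcal W\cap\mathcal Fib$), is an almost Brown category if: (A) $\mathcal W$ has the two-out-of-three property and contains all isomorphisms; (B) $\mathcal Fib$ is closed under composition and contains all isomorphisms; (C) the pullback of an acyclic fibration along any map exists and is an acyclic fibration; (D) every map factors as $u=pi$ with $p$ a fibration and $i$ right inverse to an acyclic fibration; (E) every map to the final object is a fibration. A functor between almost Brown categories is left exact if it preserves finite products, fibrations, acyclic fibrations, and pullbacks of acyclic fibrations. \textbf{Spectral sequences.} A spectral sequence consists, for each $m\ge 0$, of a bigraded $R$-module $A_m$ with a differential $d_m$ of bidegree $(-m,1-m)$, and of isomorphisms $H(A_m)\cong A_{m+1}$; morphisms are families of maps of pages compatible with the differentials and these isomorphisms. Let $(\mathrm{SpSe})_r$ be the category of spectral sequences, where $f$ is a weak equivalence ($E_r$-quasi-isomorphism) if $f_r$ is a quasi-isomorphism and a fibration if $f_k$ is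 bidegreewise surjective for $0\le k\le r$. \textbf{Filtered complexes.} For a cochain complex $(A,d)$ of $R$-modules with an increasing filtration $F_p$, $p\in\mathbb Z$, by subcomplexes, let $E(A)$ be the spectral sequence with $E_m^{p,q}=Z_m^{p,q}/B_m^{p,q}$, where $Z_m^{p,k+p}=F_pA^k\cap d^{-1}(F_{p-m}A^{k+1})$, $B_0^{p,k+p}=Z_0^{p-1,k+p-1}$, $B_m^{p,k+p}=Z_{m-1}^{p-1,k+p-1}+dZ_{m-1}^{p+m-1,k+p+m-2}$ for $m\ge 1$, with differential $[a]\mapsto[da]$ and the canonical isomorphisms $H(E_m)\cong E_{m+1}$. \textbf{Multicomplexes.} An $n$-multicomplex is a bigraded $R$-module $A$ with maps $d_i$ ($i\ge 0$) of bidegree $(-i,1-i)$ such that $\sum_{i+j=l}(-1)^id_id_j=0$ for all $l\ge 0$ and $d_i=0$ for $i\ge n$; morphisms are bidegree $(0,0)$ maps commuting with all $d_i$. Its totalization $\mathrm{Tot}(A)$ is the filtered complex $$\mathrm{Tot}(A)^m=\bigoplus_{p>0}A^{p,m+p}\oplus\prod_{p\le 0}A^{p,m+p},\qquad (da)_p=\sum_{k\ge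 0}(-1)^{km}d_k(a_{p+k})\ \text{ for } a\in \mathrm{Tot}(A)^m,$$ with $F_p\mathrm{Tot}(A)^m=\{a : a_q=0 \text{ for } q>p\}$. Let $E'=E\circ\mathrm{Tot}$. Let $(n\text{-mCpx})_r$ be the category of $n$-multicomplexes where $f$ is a weak equivalence if $E'_r(f)$ is a quasi-isomorphism and a fibration if $E'_i(f)$ is bidegreewise surjective for $0\le i\le r$. \textbf{Proposition.} $(n\text{-mCpx})_r$ and $(\mathrm{SpSe})_r$ are almost Brown categories, and the functor $E':(n\text{-mCpx})_r\to(\mathrm{SpSe})_r$ preserves weak equivalences and is a left exact functor of almost Brown categories; in particular it preserves pullbacks of acyclic fibrations. -/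

import Mathlib

open CategoryTheory Limits

universe v u

namespace SpecSeqHomotopy

/-! ### Almost Brown categories -/

section AlmostBrown

universe v₁ u₁ v₂ u₂

/-- A category `C` with weak equivalences `W` and fibrations `Fib` is an almost Brown category.
An acyclic fibration is a morphism in `W ⊓ Fib`. -/
structure IsAlmostBrown {C : Type u₁} [Category.{v₁} C] (W Fib : MorphismProperty C) : Prop where
  hasFiniteProducts : HasFiniteProducts C
  /-- (A) two-out-of-three -/
  twoOutOfThree : W.HasTwoOutOfThreeProperty
  /-- (A) isomorphisms are weak equivalences -/
  isomorphisms_le_weq : MorphismProperty.isomorphisms C ≤ W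
  /-- (B) fibrations compose -/
  fib_comp : Fib.IsStableUnderComposition
  /-- (B) isomorphisms are fibrations -/
  isomorphisms_le_fib : MorphismProperty.isomorphisms C ≤ Fib
  /-- (C) pullbacks of acyclic fibrations exist -/
  hasPullback : ∀ {X Y Z : C} (g : X ⟶ Z) (p : Y ⟶ Z), (W ⊓ Fib) p → HasPullback g p
  /-- (C) pullbacks of acyclic fibrations are acyclic fibrations -/
  isPullback : ∀ {P X Y Z : C} {fst : P ⟶ X} {snd : P ⟶ Y} {g : X ⟶ Z} {p : Y ⟶ Z},
    IsPullback fst snd g p → (W ⊓ Fib) p → (W ⊓ Fib) fst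
  /-- (D) `u = p ∘ i` with `p` a fibration and `i` right inverse to an acyclic fibration -/
  factorization : ∀ {X Y : C} (u : X ⟶ Y), ∃ (M : C) (i : X ⟶ M) (p : M ⟶ Y) (s : M ⟶ X),
    i ≫ p = u ∧ Fib p ∧ i ≫ s = 𝟙 X ∧ (W ⊓ Fib) s
  /-- (E) every object is fibrant -/
  fibrant : ∀ {X e : C} (_ : IsTerminal e) (f : X ⟶ e), Fib f

/-- Left exactness of a functor between almost Brown categories. -/
structure IsLeftExact {C : Type u₁} [Category.{v₁} C] {D : Type u₂} [Category.{v₂} D]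
    (W Fib : MorphismProperty C) (W' Fib' : MorphismProperty D) (F : C ⥤ D) : Prop where
  preservesFiniteProducts : PreservesFiniteProducts F
  map_fib : ∀ {X Y : C} (f : X ⟶ Y), Fib f → Fib' (F.map f)
  map_acyclicFib : ∀ {X Y : C} (f : X ⟶ Y), (W ⊓ Fib) f → (W' ⊓ Fib') (F.map f)
  /-- pullback squares along an acyclic fibration are sent to pullback squares -/
  map_isPullback : ∀ {P X Y Z : C} {fst : P ⟶ X} {snd : P ⟶ Y} {g : X ⟶ Z} {p : Y ⟶ Z},
    IsPullback fst snd g p → (W ⊓ Fib) p →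
      IsPullback (F.map fst) (F.map snd) (F.map g) (F.map p)

end AlmostBrown

/-! ### Spectral sequences -/

variable (R : Type u) [CommRing R]

/-- Spectral sequences of `R`-modules, starting at page `0`, with differential of bidegree
`(-r, 1 - r)` on page `r`, with Mathlib's morphisms (compatible with the identifications of the
homology of a page with the next page). -/
abbrev SpSe : Type (max u (v + 1)) :=
  SpectralSequence (ModuleCat.{v} R) (fun r : ℤ ↦ ComplexShape.up' ((-r, 1 - r) : ℤ × ℤ)) 0

/-- `E_r`-quasi-isomorphisms of spectral sequences: the map on page `r` is a
quasi-isomorphism of `r`-bigraded complexes. -/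
def SpSe.weq (r : ℕ) : MorphismProperty (SpSe.{v} R) :=
  fun _ _ f ↦ QuasiIso (f.hom (r : ℤ))

/-- `r`-fibrations of spectral sequences: the maps on pages `0, …, r` are bidegreewise
surjective. -/
def SpSe.fib (r : ℕ) : MorphismProperty (SpSe.{v} R) :=
  fun _ _ f ↦ ∀ (k : ℕ), k ≤ r → ∀ pq : ℤ × ℤ, Function.Surjective ((f.hom (k : ℤ)).f pq)

/-! ### Filtered complexes and their spectral sequence -/

/-- Filtered (unbounded) cochain complexes, with increasing filtrations indexed by `ℤ`. -/
structure FilteredComplex where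
  K : CochainComplex (ModuleCat.{v} R) ℤ
  F (p n : ℤ) : Submodule R (K.X n)
  F_mono (p n : ℤ) : F (p - 1) n ≤ F p n
  F_d (p n m : ℤ) : F p n ≤ (F p m).comap (K.d n m).hom

namespace FilteredComplex

variable {R}

/-- Morphisms of filtered complexes: filtration preserving cochain maps. -/
@[ext]
structure Hom (A B : FilteredComplex.{v} R) where
  hom : A.K ⟶ B.K
  hom_F (p n : ℤ) : A.F p n ≤ (B.F p n).comap (hom.f n).hom

instance : Category (FilteredComplex.{v} R) where
  Hom := Hom
  id A := { hom := 𝟙 _, hom_F := fun p n x hx ↦ by simpa using hx }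
  comp f g :=
    { hom := f.hom ≫ g.hom
      hom_F := fun p n x hx ↦ by simpa using g.hom_F p n (f.hom_F p n hx) }

@[simp] lemma id_hom (A : FilteredComplex.{v} R) : Hom.hom (𝟙 A) = 𝟙 A.K := rfl
@[simp] lemma comp_hom {A B C : FilteredComplex.{v} R} (f : A ⟶ B) (g : B ⟶ C) :
    Hom.hom (f ≫ g) = Hom.hom f ≫ Hom.hom g := rfl

variable (A : FilteredComplex.{v} R)

lemma F_le {p p' : ℤ} (h : p ≤ p') (n : ℤ) : A.F p n ≤ A.F p' n := by
  obtain ⟨k, rfl⟩ : ∃ k : ℕ, p' = p + k := ⟨(p' - p).toNat, by lia⟩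
  induction k with
  | zero => simp
  | succ k ih =>
    refine (ih (by lia)).trans ?_
    have := A.F_mono (p + (k + 1 : ℕ)) n
    rwa [show p + ((k + 1 : ℕ) : ℤ) - 1 = p + k by push_cast; ring] at this

/-- `Z r p n` is the module `Z_r^{p, n + p} = F_p A^n ∩ d⁻¹ (F_{p - r} A^{n + 1})`. -/
def Z (r p n : ℤ) : Submodule R (A.K.X n) :=
  A.F p n ⊓ (A.F (p - r) (n + 1)).comap (A.K.d n (n + 1)).hom

/-- `B r p n` is the module `B_r^{p, n + p}`, equal to `Z_0^{p - 1, n + p - 1}` for `r = 0` and to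
`Z_{r - 1}^{p - 1, n + p - 1} + d Z_{r - 1}^{p + r - 1, n + p + r - 2}` for `r ≥ 1`. -/
def B (r p n : ℤ) : Submodule R (A.K.X n) :=
  if r = 0 then A.Z 0 (p - 1) n
  else A.Z (r - 1) (p - 1) n ⊔ (A.Z (r - 1) (p + r - 1) (n - 1)).map (A.K.d (n - 1) n).hom

lemma mem_Z {r p n : ℤ} (m p' : ℤ) (hm : n + 1 = m) (hp : p - r = p') (x : A.K.X n) :
    x ∈ A.Z r p n ↔ x ∈ A.F p n ∧ (A.K.d n m).hom x ∈ A.F p' m := by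
  subst hm hp; rfl

lemma mem_B {r p n : ℤ} (hr : r ≠ 0) (m p' : ℤ) (hm : m + 1 = n) (hp : p + r - 1 = p')
    (x : A.K.X n) :
    x ∈ A.B r p n ↔ ∃ y ∈ A.Z (r - 1) (p - 1) n, ∃ w ∈ A.Z (r - 1) p' m,
      y + (A.K.d m n).hom w = x := by
  obtain rfl : m = n - 1 := by lia
  subst hp
  simp [B, hr, Submodule.mem_sup]

lemma d_map_apply {A A' : FilteredComplex.{v} R} (f : A ⟶ A') (n m : ℤ) (x : A.K.X n) :
    (A'.K.d n m).hom ((f.hom.f n).hom x) = (f.hom.f m).hom ((A.K.d n m).hom x) := by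
  rw [← LinearMap.comp_apply, ← ModuleCat.hom_comp, f.hom.comm]
  rfl

lemma d_d_apply (i j k : ℤ) (x : A.K.X i) : (A.K.d j k).hom ((A.K.d i j).hom x) = 0 := by
  rw [← LinearMap.comp_apply, ← ModuleCat.hom_comp, A.K.d_comp_d]
  rfl

/-- `E_r^{p, q} = Z_r^{p, q} / B_r^{p, q}`, in total degree `q - p`. -/
abbrev E (r : ℤ) (i : ℤ × ℤ) : Type v :=
  A.Z r i.1 (i.2 - i.1) ⧸ (A.B r i.1 (i.2 - i.1)).submoduleOf (A.Z r i.1 (i.2 - i.1))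

/-- The class `[a]_r`. -/
abbrev cls (r : ℤ) (i : ℤ × ℤ) : A.Z r i.1 (i.2 - i.1) →ₗ[R] A.E r i :=
  Submodule.mkQ _

variable {A} in
lemma d_mem_Z {r p n p' n' : ℤ} (hp : p - r = p') (hn : n + 1 = n')
    {x : A.K.X n} (hx : x ∈ A.Z r p n) : (A.K.d n n').hom x ∈ A.Z r p' n' := by
  rw [A.mem_Z n' p' hn hp] at hx
  rw [A.mem_Z (n' + 1) (p' - r) rfl rfl]
  exact ⟨hx.2, by rw [d_d_apply]; exact zero_mem _⟩

variable {A} in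
lemma d_mem_B {r p n p' n' : ℤ} (hp : p - r = p') (hn : n + 1 = n')
    {x : A.K.X n} (hx : x ∈ A.B r p n) : (A.K.d n n').hom x ∈ A.B r p' n' := by
  by_cases hr : r = 0
  · subst hr
    simp only [B, if_true] at hx ⊢
    exact d_mem_Z (by lia) hn hx
  · rw [A.mem_B hr (n - 1) _ (by lia) rfl] at hx
    obtain ⟨y, hy, w, hw, rfl⟩ := hx
    rw [A.mem_B hr n (p - 1) hn (by lia)]
    refine ⟨0, zero_mem _, y, hy, ?_⟩
    simp [d_d_apply]

/-- The differential `δ_r [a]_r = [d a]_r`, as a map `E_r^{p, q} → E_r^{p', q'}`, which is `0` unless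
`(p', q') = (p - r, q + 1 - r)`. -/
noncomputable def δ (r : ℤ) (i j : ℤ × ℤ) : A.E r i →ₗ[R] A.E r j :=
  if h : i + (-r, 1 - r) = j then
    Submodule.mapQ _ _
      ((A.K.d (i.2 - i.1) (j.2 - j.1)).hom.restrict
        (p := A.Z r i.1 (i.2 - i.1)) (q := A.Z r j.1 (j.2 - j.1))
        fun _ hx ↦ d_mem_Z (by subst h; simp; ring) (by subst h; simp; ring) hx)
      (fun x hx ↦ by
        have hx' : (x : A.K.X _) ∈ A.B r i.1 (i.2 - i.1) := hx
        exact d_mem_B (A := A) (by subst h; simp; ring) (by subst h; simp; ring) hx')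
  else 0

lemma δ_cls (r : ℤ) {i j : ℤ × ℤ} (h : i + (-r, 1 - r) = j) (x : A.Z r i.1 (i.2 - i.1)) :
    A.δ r i j (A.cls r i x) = A.cls r j ⟨(A.K.d (i.2 - i.1) (j.2 - j.1)).hom x,
      d_mem_Z (by subst h; simp; ring) (by subst h; simp; ring) x.2⟩ := by
  simp only [δ, dif_pos h]
  rfl

/-- The `r`-page, an `r`-bigraded complex. -/
noncomputable def page (r : ℤ) :
    HomologicalComplex (ModuleCat.{v} R) (ComplexShape.up' ((-r, 1 - r) : ℤ × ℤ)) where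
  X i := ModuleCat.of R (A.E r i)
  d i j := ModuleCat.ofHom (A.δ r i j)
  shape i j h := by
    have h' : ¬ (i + (-r, 1 - r) = j) := h
    simp only [δ, dif_neg h']
    rfl
  d_comp_d' i j k hij hjk := by
    refine ModuleCat.hom_ext (Submodule.linearMap_qext _ (LinearMap.ext fun x ↦ ?_))
    change A.δ r j k (A.δ r i j (A.cls r i x)) = 0
    rw [δ_cls A r hij, δ_cls A r hjk]
    simp only [d_d_apply]
    exact map_zero (A.cls r k)

lemma cls_eq_zero_iff (r : ℤ) (i : ℤ × ℤ) (x : A.Z r i.1 (i.2 - i.1)) :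
    A.cls r i x = 0 ↔ (x : A.K.X _) ∈ A.B r i.1 (i.2 - i.1) :=
  Submodule.Quotient.mk_eq_zero _

lemma Z_succ_le (r p n : ℤ) : A.Z (r + 1) p n ≤ A.Z r p n := by
  intro x hx
  rw [A.mem_Z (n + 1) _ rfl rfl] at hx ⊢
  exact ⟨hx.1, A.F_le (by lia) _ hx.2⟩

lemma Z_pred_le (r p n : ℤ) : A.Z (r - 1) (p - 1) n ≤ A.Z r p n := by
  intro x hx
  rw [A.mem_Z (n + 1) _ rfl rfl] at hx ⊢
  exact ⟨A.F_le (by lia) _ hx.1, A.F_le (by lia) _ hx.2⟩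

lemma mem_B_of_Z_pred {r p n : ℤ} (hr : 0 ≤ r) {x : A.K.X n}
    (hx : x ∈ A.Z (r - 1) (p - 1) n) : x ∈ A.B r p n := by
  by_cases h : r = 0
  · subst h
    simp only [B, if_true]
    rw [A.mem_Z (n + 1) _ rfl rfl] at hx ⊢
    exact ⟨hx.1, by simpa using A.F_d _ _ _ hx.1⟩
  · rw [A.mem_B h (n - 1) _ (by lia) rfl]
    exact ⟨x, hx, 0, zero_mem _, by simp⟩

/-- A class `[x]_r` with `d x ∈ B_r` has a representative in `Z_{r + 1}`. -/
lemma exists_Z_succ {r p n : ℤ} (hr : 0 ≤ r) {x : A.K.X n}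
    (hx : x ∈ A.Z r p n) (hd : (A.K.d n (n + 1)).hom x ∈ A.B r (p - r) (n + 1)) :
    ∃ y ∈ A.Z (r + 1) p n, x - y ∈ A.B r p n := by
  by_cases h : r = 0
  · subst h
    refine ⟨x, ?_, by simp⟩
    simp only [B, if_true] at hd
    rw [A.mem_Z (n + 1) _ rfl rfl] at hx ⊢
    rw [A.mem_Z (n + 1 + 1) _ rfl rfl] at hd
    exact ⟨hx.1, by simpa using hd.1⟩
  · rw [A.mem_B h n (p - 1) rfl (by lia)] at hd
    obtain ⟨y, hy, w, hw, e⟩ := hd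
    refine ⟨x - w, ?_, ?_⟩
    · rw [A.mem_Z (n + 1) (p - r - 1) rfl (by lia)]
      rw [A.mem_Z (n + 1) _ rfl rfl] at hx hw
      refine ⟨sub_mem hx.1 (A.F_le (by lia) _ hw.1), ?_⟩
      rw [map_sub, ← e, add_sub_cancel_right]
      exact hy.1
    · rw [sub_sub_cancel]
      exact A.mem_B_of_Z_pred hr hw

/-- `Z_{r + 1} ∩ (B_r + d Z_r) = B_{r + 1}`. -/
lemma mem_B_succ_iff {r p n m : ℤ} (hr : 0 ≤ r) (hm : m + 1 = n) {x : A.K.X n}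
    (hx : x ∈ A.Z (r + 1) p n) :
    x ∈ A.B (r + 1) p n ↔
      ∃ w ∈ A.Z r (p + r) m, x - (A.K.d m n).hom w ∈ A.B r p n := by
  rw [A.mem_B (by lia : r + 1 ≠ 0) m (p + r) hm (by lia)]
  simp only [add_sub_cancel_right]
  constructor
  · rintro ⟨y, hy, w, hw, rfl⟩
    refine ⟨w, hw, ?_⟩
    rw [add_sub_cancel_right]
    rw [A.mem_Z (n + 1) (p - 1 - r) rfl rfl] at hy
    rw [A.mem_Z (n + 1) (p - r - 1) rfl (by lia), map_add, d_d_apply, add_zero] at hx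
    by_cases h : r = 0
    · subst h
      simp only [B, if_true]
      rw [A.mem_Z (n + 1) _ rfl rfl]
      exact hy
    · refine A.mem_B_of_Z_pred hr ?_
      rw [A.mem_Z (n + 1) _ rfl rfl]
      exact ⟨hy.1, A.F_le (by lia) _ hy.2⟩
  · rintro ⟨w, hw, h⟩
    by_cases hr0 : r = 0
    · subst hr0
      simp only [B, if_true] at h
      exact ⟨_, h, w, hw, by simp⟩
    · rw [A.mem_B hr0 m (p + r - 1) hm rfl] at h
      obtain ⟨y, hy, w', hw', e⟩ := h
      have e' := e.symm
      have hxe : x = y + (A.K.d m n).hom (w + w') := by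
        rw [sub_eq_iff_eq_add] at e'
        rw [map_add, e']
        abel
      refine ⟨y, ?_, w + w', ?_, hxe.symm⟩
      · rw [A.mem_Z (n + 1) (p - 1 - r) rfl rfl]
        rw [A.mem_Z (n + 1) _ rfl rfl] at hy
        refine ⟨hy.1, ?_⟩
        rw [A.mem_Z (n + 1) (p - r - 1) rfl (by lia), hxe] at hx
        have hx2 := hx.2
        rw [map_add, d_d_apply, add_zero] at hx2
        rw [show p - 1 - r = p - r - 1 by ring]
        exact hx2
      · refine add_mem hw ?_
        rw [A.mem_Z n _ hm rfl] at hw' ⊢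
        exact ⟨A.F_le (by lia) _ hw'.1, A.F_le (by lia) _ hw'.2⟩

lemma liftCycles_π_comp_apply (S : ShortComplex (ModuleCat.{v} R)) {T : ModuleCat.{v} R}
    (k : T ⟶ S.X₂) (hk : k ≫ S.g = 0) (x : T) :
    S.moduleCatHomologyIso.hom.hom ((S.liftCycles k hk ≫ S.homologyπ).hom x) =
      Submodule.Quotient.mk ⟨k.hom x, congr(($hk).hom x)⟩ := by
  have h : S.liftCycles k hk ≫ S.moduleCatCyclesIso.hom =
      S.moduleCatLeftHomologyData.liftK k hk := by
    rw [← cancel_mono S.moduleCatLeftHomologyData.i, Category.assoc,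
      ShortComplex.moduleCatCyclesIso_hom_i, ShortComplex.LeftHomologyData.liftK_i,
      ShortComplex.liftCycles_i]
  have h' : (S.liftCycles k hk ≫ S.homologyπ) ≫ S.moduleCatHomologyIso.hom =
      S.moduleCatLeftHomologyData.liftK k hk ≫ S.moduleCatLeftHomologyData.π := by
    rw [Category.assoc, ShortComplex.π_moduleCatCyclesIso_hom, reassoc_of% h]
  exact congr(($h').hom x)

lemma liftCycles_π_eq_zero_iff (S : ShortComplex (ModuleCat.{v} R)) {T : ModuleCat.{v} R}
    (k : T ⟶ S.X₂) (hk : k ≫ S.g = 0) (x : T) :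
    (S.liftCycles k hk ≫ S.homologyπ).hom x = 0 ↔ ∃ w, S.f.hom w = k.hom x := by
  have hinj : Function.Injective S.moduleCatHomologyIso.hom.hom :=
    S.moduleCatHomologyIso.toLinearEquiv.injective
  rw [← hinj.eq_iff, map_zero, liftCycles_π_comp_apply]
  refine (Submodule.Quotient.mk_eq_zero _).trans ?_
  simp only [LinearMap.mem_range]
  exact exists_congr fun w ↦ Subtype.ext_iff

lemma liftCycles_π_surjective (S : ShortComplex (ModuleCat.{v} R)) {T : ModuleCat.{v} R}
    (k : T ⟶ S.X₂) (hk : k ≫ S.g = 0)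
    (h : ∀ y, S.g.hom y = 0 → ∃ t w, k.hom t + S.f.hom w = y) :
    Function.Surjective (S.liftCycles k hk ≫ S.homologyπ).hom := by
  have hinj : Function.Injective S.moduleCatHomologyIso.hom.hom :=
    S.moduleCatHomologyIso.toLinearEquiv.injective
  intro z
  obtain ⟨⟨y, hy⟩, e⟩ := Submodule.Quotient.mk_surjective _ (S.moduleCatHomologyIso.hom.hom z)
  obtain ⟨t, w, rfl⟩ := h y hy
  refine ⟨t, hinj ?_⟩
  rw [liftCycles_π_comp_apply, ← e]
  refine (Submodule.Quotient.eq _).2 ⟨-w, Subtype.ext ?_⟩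
  change S.f.hom (-w) = k.hom t - (k.hom t + S.f.hom w)
  rw [map_neg]
  abel

/-- The class in `E_r` of an element of `Z_{r + 1}`, as a cycle for `δ_r`. -/
noncomputable def succToE (r : ℤ) (i : ℤ × ℤ) :
    ModuleCat.of R (A.Z (r + 1) i.1 (i.2 - i.1)) ⟶ (A.page r).X i :=
  ModuleCat.ofHom (A.cls r i ∘ₗ Submodule.inclusion (A.Z_succ_le r i.1 (i.2 - i.1)))

lemma succToE_d (r : ℤ) (hr : 0 ≤ r) (i j : ℤ × ℤ) : A.succToE r i ≫ (A.page r).d i j = 0 := by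
  by_cases h : i + (-r, 1 - r) = j
  · refine ModuleCat.hom_ext (LinearMap.ext fun x ↦ ?_)
    change A.δ r i j (A.cls r i _) = 0
    rw [δ_cls A r h, cls_eq_zero_iff]
    refine A.mem_B_of_Z_pred hr ?_
    have hj : i.2 - i.1 + 1 = j.2 - j.1 := by subst h; simp; ring
    have hj' : i.1 - (r + 1) = j.1 - 1 := by subst h; simp; ring
    have hx := x.2
    rw [A.mem_Z _ _ hj hj'] at hx
    rw [A.mem_Z _ _ rfl rfl]
    refine ⟨hx.2, ?_⟩
    change (A.K.d _ _).hom ((A.K.d _ _).hom _) ∈ _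
    rw [d_d_apply]
    exact zero_mem _
  · rw [(A.page r).shape i j h, comp_zero]

/-- The map `Z_{r + 1} → H(E_r)` sending `x` to the homology class of `[x]_r`. -/
noncomputable def succToHomology (r : ℤ) (hr : 0 ≤ r) (i : ℤ × ℤ) :
    ModuleCat.of R (A.Z (r + 1) i.1 (i.2 - i.1)) ⟶ (A.page r).homology i :=
  (A.page r).liftCycles (A.succToE r i) _ rfl (A.succToE_d r hr _ _) ≫ (A.page r).homologyπ i

lemma succToHomology_eq_zero_iff (r : ℤ) (hr : 0 ≤ r) (i : ℤ × ℤ)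
    (x : A.Z (r + 1) i.1 (i.2 - i.1)) :
    (A.succToHomology r hr i).hom x = 0 ↔ (x : A.K.X _) ∈ A.B (r + 1) i.1 (i.2 - i.1) := by
  refine (liftCycles_π_eq_zero_iff ((A.page r).sc i) (A.succToE r i)
    (A.succToE_d r hr _ _) x).trans ?_
  have hrel : (ComplexShape.up' ((-r, 1 - r) : ℤ × ℤ)).Rel (i - (-r, 1 - r)) i := by simp
  have hprev := ComplexShape.prev_eq' _ hrel
  change (∃ w : A.E r ((ComplexShape.up' ((-r, 1 - r) : ℤ × ℤ)).prev i),
    A.δ r _ i w = A.cls r i _) ↔ _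
  rw [hprev]
  generalize hj : i - (-r, 1 - r) = j at hrel
  have hp : i.1 + r = j.1 := by subst hj; simp
  have hn : j.2 - j.1 + 1 = i.2 - i.1 := by subst hj; simp; ring
  rw [A.mem_B_succ_iff hr hn x.2, hp]
  constructor
  · rintro ⟨w, hw⟩
    obtain ⟨w, rfl⟩ := Submodule.mkQ_surjective _ w
    rw [δ_cls A r hrel, eq_comm, ← sub_eq_zero, ← map_sub, cls_eq_zero_iff] at hw
    exact ⟨w, w.2, hw⟩
  · rintro ⟨w, hw, h⟩
    refine ⟨A.cls r j ⟨w, hw⟩, ?_⟩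
    rw [δ_cls A r hrel, eq_comm, ← sub_eq_zero, ← map_sub, cls_eq_zero_iff]
    exact h

lemma succToHomology_surjective (r : ℤ) (hr : 0 ≤ r) (i : ℤ × ℤ) :
    Function.Surjective (A.succToHomology r hr i).hom := by
  refine liftCycles_π_surjective ((A.page r).sc i) (A.succToE r i) (A.succToE_d r hr _ _) ?_
  change ∀ y : A.E r i, _
  intro y hy
  have hrel : (ComplexShape.up' ((-r, 1 - r) : ℤ × ℤ)).Rel i (i + (-r, 1 - r)) := by simp
  have hnext := ComplexShape.next_eq' _ hrel
  change A.δ r i ((ComplexShape.up' ((-r, 1 - r) : ℤ × ℤ)).next i) y = 0 at hy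
  rw [hnext] at hy
  generalize hj : i + (-r, 1 - r) = j at hrel hy
  have hp : i.1 - r = j.1 := by subst hj; simp; ring
  have hn : i.2 - i.1 + 1 = j.2 - j.1 := by subst hj; simp; ring
  obtain ⟨y, rfl⟩ := Submodule.mkQ_surjective _ y
  change A.δ r i j (A.cls r i y) = 0 at hy
  rw [δ_cls A r hrel, cls_eq_zero_iff] at hy
  have hy' : (A.K.d (i.2 - i.1) (i.2 - i.1 + 1)).hom y ∈
      A.B r (i.1 - r) (i.2 - i.1 + 1) := by
    rw [hp, hn]
    exact hy
  obtain ⟨z, hz, h⟩ := A.exists_Z_succ hr y.2 hy'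
  refine ⟨⟨z, hz⟩, 0, ?_⟩
  rw [map_zero, add_zero]
  change A.cls r i _ = A.cls r i y
  rw [eq_comm, ← sub_eq_zero, ← map_sub, cls_eq_zero_iff]
  exact h

/-- The canonical isomorphism `E_{r + 1} ≅ H(E_r)`, sending `[x]_{r + 1}` to the homology class of
`[x]_r`. -/
noncomputable def pageSuccIso (r : ℤ) (hr : 0 ≤ r) (i : ℤ × ℤ) :
    (A.page (r + 1)).X i ≅ (A.page r).homology i :=
  LinearEquiv.toModuleIso (X₁ := A.E (r + 1) i) (X₂ := (A.page r).homology i)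
    ((Submodule.quotEquivOfEq _ _ (by
      ext x
      exact (A.succToHomology_eq_zero_iff r hr i x).symm)).trans
      (LinearMap.quotKerEquivOfSurjective (A.succToHomology r hr i).hom
        (A.succToHomology_surjective r hr i)))

/-- The class map `Z_r → E_r` as a morphism. -/
noncomputable abbrev clsHom (r : ℤ) (i : ℤ × ℤ) :
    ModuleCat.of R (A.Z r i.1 (i.2 - i.1)) ⟶ (A.page r).X i :=
  ModuleCat.ofHom (A.cls r i)

lemma clsHom_pageSuccIso (r : ℤ) (hr : 0 ≤ r) (i : ℤ × ℤ) :
    A.clsHom (r + 1) i ≫ (A.pageSuccIso r hr i).hom = A.succToHomology r hr i := rfl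

lemma clsHom_hom_ext {r : ℤ} {i : ℤ × ℤ} {M : ModuleCat.{v} R} {f g : (A.page r).X i ⟶ M}
    (h : A.clsHom r i ≫ f = A.clsHom r i ≫ g) : f = g :=
  ModuleCat.hom_ext (Submodule.linearMap_qext _ congr(($h).hom))

/-- The spectral sequence of a filtered complex. -/
noncomputable def spectralSequence : SpSe.{v} R where
  page r _ := A.page r
  iso r r' i hrr' hr := by
    subst hrr'
    exact (A.pageSuccIso r hr i).symm

variable {A} {A' : FilteredComplex.{v} R} (f : A ⟶ A')

lemma map_mem_Z {r p n : ℤ} {x : A.K.X n} (hx : x ∈ A.Z r p n) :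
    (f.hom.f n).hom x ∈ A'.Z r p n := by
  rw [mem_Z _ (n + 1) _ rfl rfl] at hx ⊢
  refine ⟨f.hom_F _ _ hx.1, ?_⟩
  rw [d_map_apply]
  exact f.hom_F _ _ hx.2

lemma map_mem_B {r p n : ℤ} {x : A.K.X n} (hx : x ∈ A.B r p n) :
    (f.hom.f n).hom x ∈ A'.B r p n := by
  by_cases hr : r = 0
  · subst hr
    simp only [B, if_true] at hx ⊢
    exact map_mem_Z f hx
  · rw [mem_B _ hr (n - 1) _ (by lia) rfl] at hx ⊢
    obtain ⟨y, hy, w, hw, rfl⟩ := hx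
    exact ⟨_, map_mem_Z f hy, _, map_mem_Z f hw, by rw [d_map_apply, map_add]⟩

/-- The map `[a]_r ↦ [f a]_r` induced on `E_r`. -/
noncomputable def mapE (r : ℤ) (i : ℤ × ℤ) : A.E r i →ₗ[R] A'.E r i :=
  Submodule.mapQ _ _
    ((f.hom.f (i.2 - i.1)).hom.restrict
      (p := A.Z r i.1 (i.2 - i.1)) (q := A'.Z r i.1 (i.2 - i.1)) fun _ hx ↦ map_mem_Z f hx)
    (fun x hx ↦ by
      have hx' : (x : A.K.X _) ∈ A.B r i.1 (i.2 - i.1) := hx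
      exact map_mem_B f hx')

lemma mapE_cls (r : ℤ) (i : ℤ × ℤ) (x : A.Z r i.1 (i.2 - i.1)) :
    mapE f r i (A.cls r i x) = A'.cls r i ⟨(f.hom.f (i.2 - i.1)).hom x, map_mem_Z f x.2⟩ := rfl

/-- The map induced on the `r`-page. -/
noncomputable def mapPage (r : ℤ) : A.page r ⟶ A'.page r where
  f i := ModuleCat.ofHom (mapE f r i)
  comm' i j h := by
    refine clsHom_hom_ext _ (ModuleCat.hom_ext (LinearMap.ext fun x ↦ ?_))
    change A'.δ r i j (mapE f r i (A.cls r i x)) = mapE f r j (A.δ r i j (A.cls r i x))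
    rw [mapE_cls, δ_cls A' r h, δ_cls A r h, mapE_cls]
    simp only [d_map_apply]

lemma mapPage_comm (r : ℤ) (hr : 0 ≤ r) (i : ℤ × ℤ) :
    (A.pageSuccIso r hr i).hom ≫ HomologicalComplex.homologyMap (mapPage f r) i =
      (mapPage f (r + 1)).f i ≫ (A'.pageSuccIso r hr i).hom := by
  let g : ModuleCat.of R (A.Z (r + 1) i.1 (i.2 - i.1)) ⟶
      ModuleCat.of R (A'.Z (r + 1) i.1 (i.2 - i.1)) :=
    ModuleCat.ofHom ((f.hom.f (i.2 - i.1)).hom.restrict fun _ hx ↦ map_mem_Z f hx)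
  have h₁ : A.clsHom (r + 1) i ≫ (mapPage f (r + 1)).f i = g ≫ A'.clsHom (r + 1) i := rfl
  have h₂ : A.succToE r i ≫ (mapPage f r).f i = g ≫ A'.succToE r i := rfl
  apply clsHom_hom_ext
  rw [reassoc_of% (A.clsHom_pageSuccIso r hr i), reassoc_of% h₁, clsHom_pageSuccIso,
    succToHomology, succToHomology, Category.assoc, HomologicalComplex.homologyπ_naturality,
    ← Category.assoc, ← Category.assoc]
  congr 1
  rw [← cancel_mono ((A'.page r).iCycles i)]
  simp [h₂]

lemma mapPage_comm_inv (r : ℤ) (hr : 0 ≤ r) (i : ℤ × ℤ) :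
    HomologicalComplex.homologyMap (mapPage f r) i ≫ (A'.pageSuccIso r hr i).inv =
      (A.pageSuccIso r hr i).inv ≫ (mapPage f (r + 1)).f i := by
  rw [Iso.comp_inv_eq, Category.assoc, Iso.eq_inv_comp]
  exact mapPage_comm f r hr i

/-- The morphism of spectral sequences induced by a morphism of filtered complexes. -/
noncomputable def mapSpectralSequence : A.spectralSequence ⟶ A'.spectralSequence where
  hom r _ := mapPage f r
  comm r r' i hrr' hr := by
    subst hrr'
    exact mapPage_comm_inv f r hr i

end FilteredComplex

/-- The spectral sequence functor on filtered complexes. -/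
noncomputable def FilteredComplex.spectralSequenceFunctor :
    FilteredComplex.{v} R ⥤ SpSe.{v} R where
  obj A := A.spectralSequence
  map f := FilteredComplex.mapSpectralSequence f
  map_id A := by
    refine SpectralSequence.hom_ext fun r hr ↦ HomologicalComplex.hom_ext _ _ fun i ↦ ?_
    exact FilteredComplex.clsHom_hom_ext A rfl
  map_comp {A _ _} f g := by
    refine SpectralSequence.hom_ext fun r hr ↦ HomologicalComplex.hom_ext _ _ fun i ↦ ?_
    exact FilteredComplex.clsHom_hom_ext A rfl

/-! ### Multicomplexes and their totalization -/

/-- `n`-multicomplexes of `R`-modules, for `n : ℕ∞`. The component of `d_i` from bidegree `a` to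
bidegree `b` is `d i a b`; it is `0` unless `b = a + (-i, 1 - i)`. -/
structure Multicomplex (n : ℕ∞) where
  X : ℤ × ℤ → ModuleCat.{v} R
  d (i : ℕ) (a b : ℤ × ℤ) : X a ⟶ X b
  shape (i : ℕ) (a b : ℤ × ℤ) : a + (-(i : ℤ), 1 - (i : ℤ)) ≠ b → d i a b = 0
  /-- `∑_{i + j = l} (-1)^i d_i d_j = 0` -/
  sum_d_d (l : ℕ) (a : ℤ × ℤ) :
    ∑ ij ∈ Finset.HasAntidiagonal.antidiagonal l, (-1 : ℤ) ^ ij.1 •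
      (d ij.2 a (a + (-(ij.2 : ℤ), 1 - (ij.2 : ℤ))) ≫
        d ij.1 (a + (-(ij.2 : ℤ), 1 - (ij.2 : ℤ))) (a + (-(l : ℤ), 2 - (l : ℤ)))) = 0
  d_eq_zero (i : ℕ) (a b : ℤ × ℤ) : n ≤ (i : ℕ∞) → d i a b = 0

namespace Multicomplex

variable {R} {n : ℕ∞}

/-- Strict morphisms of `n`-multicomplexes. -/
@[ext]
structure Hom (A B : Multicomplex.{v} R n) where
  f (a : ℤ × ℤ) : A.X a ⟶ B.X a
  comm (i : ℕ) (a b : ℤ × ℤ) : A.d i a b ≫ f b = f a ≫ B.d i a b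

instance : Category (Multicomplex.{v} R n) where
  Hom := Hom
  id A := { f := fun _ ↦ 𝟙 _, comm := by simp }
  comp f g :=
    { f := fun a ↦ f.f a ≫ g.f a
      comm := fun i a b ↦ by
        rw [← Category.assoc, f.comm, Category.assoc, g.comm, Category.assoc] }

variable (A : Multicomplex.{v} R n)

/-- The total module in degree `m`, that is
`⨁_{p > 0} A^{p, m + p} ⊕ ∏_{p ≤ 0} A^{p, m + p}`, as the module of families
`(a_p)` with `a_p = 0` for `p` large. -/
def totX (m : ℤ) : Submodule R (∀ p : ℤ, A.X (p, m + p)) where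
  carrier := {a | ∃ N : ℤ, ∀ p, N < p → a p = 0}
  add_mem' := by
    rintro a b ⟨N, hN⟩ ⟨M, hM⟩
    refine ⟨max N M, fun p hp ↦ ?_⟩
    rw [Pi.add_apply, hN p (by lia), hM p (by lia), add_zero]
  zero_mem' := ⟨0, fun _ _ ↦ rfl⟩
  smul_mem' := by
    rintro c a ⟨N, hN⟩
    exact ⟨N, fun p hp ↦ by rw [Pi.smul_apply, hN p hp, smul_zero]⟩

/-- The `k`-th summand `(-1)^{k m} d_k (a_{p + k})` of the `p`-component of the total differential
of a family `a` of total degree `m`. -/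
noncomputable def totTerm (m m' p : ℤ) (k : ℕ) (a : ∀ p : ℤ, A.X (p, m + p)) : A.X (p, m' + p) :=
  ((k : ℤ) * m).negOnePow • (A.d k (p + k, m + (p + k)) (p, m' + p)).hom (a (p + k))

lemma totTerm_add (m m' p : ℤ) (k : ℕ) (a b : ∀ p : ℤ, A.X (p, m + p)) :
    A.totTerm m m' p k (a + b) = A.totTerm m m' p k a + A.totTerm m m' p k b := by
  simp [totTerm]

lemma totTerm_smul (m m' p : ℤ) (k : ℕ) (c : R) (a : ∀ p : ℤ, A.X (p, m + p)) :
    A.totTerm m m' p k (c • a) = c • A.totTerm m m' p k a := by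
  simp only [totTerm, Pi.smul_apply, map_smul]
  rw [smul_comm]

lemma totTerm_eq_zero {m m' p : ℤ} {k : ℕ} {a : ∀ p : ℤ, A.X (p, m + p)} (h : a (p + k) = 0) :
    A.totTerm m m' p k a = 0 := by
  simp [totTerm, h]

lemma finite_support_totTerm (m m' p : ℤ) (a : A.totX m) :
    (Function.support fun k ↦ A.totTerm m m' p k a).Finite := by
  obtain ⟨a, N, hN⟩ := a
  refine (Set.finite_lt_nat (N - p + 1).toNat).subset fun k hk ↦ ?_
  by_contra h
  replace h : (N - p + 1).toNat ≤ k := not_lt.1 h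
  exact hk (A.totTerm_eq_zero (hN _ (by lia)))

/-- The total differential, `(d a)_p = ∑_k (-1)^{k m} d_k (a_{p + k})` for `a` of total degree `m`;
the sum is finite. The component from degree `m` to degree `m'` is `0` unless `m' = m + 1`. -/
noncomputable def totD (m m' : ℤ) : A.totX m →ₗ[R] A.totX m' where
  toFun a := ⟨fun p ↦ ∑ᶠ k : ℕ, A.totTerm m m' p k a, by
    obtain ⟨a, N, hN⟩ := a
    exact ⟨N, fun p hp ↦ finsum_eq_zero_of_forall_eq_zero fun k ↦
      A.totTerm_eq_zero (hN _ (by lia))⟩⟩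
  map_add' a b := by
    ext p
    change ∑ᶠ k : ℕ, A.totTerm m m' p k (a + b : ∀ p : ℤ, A.X (p, m + p)) =
      ∑ᶠ k : ℕ, A.totTerm m m' p k a + ∑ᶠ k : ℕ, A.totTerm m m' p k b
    simp only [totTerm_add]
    exact finsum_add_distrib (A.finite_support_totTerm m m' p a) (A.finite_support_totTerm m m' p b)
  map_smul' c a := by
    ext p
    change ∑ᶠ k : ℕ, A.totTerm m m' p k (c • (a : ∀ p : ℤ, A.X (p, m + p))) =
      c • ∑ᶠ k : ℕ, A.totTerm m m' p k a
    simp only [totTerm_smul]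
    exact (smul_finsum' c (A.finite_support_totTerm m m' p a)).symm

lemma totD_apply (m m' : ℤ) (a : A.totX m) (p : ℤ) :
    (A.totD m m' a : ∀ p : ℤ, A.X (p, m' + p)) p = ∑ᶠ k : ℕ, A.totTerm m m' p k a := rfl

lemma totD_apply_eq_sum (m m' : ℤ) (a : A.totX m) (p : ℤ) (M : ℕ)
    (hM : ∀ q, p + M ≤ q → (a : ∀ p : ℤ, A.X (p, m + p)) q = 0) :
    (A.totD m m' a : ∀ p : ℤ, A.X (p, m' + p)) p =
      ∑ k ∈ Finset.range M, A.totTerm m m' p k a := by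
  rw [totD_apply]
  refine finsum_eq_sum_of_support_subset _ fun k hk ↦ ?_
  by_contra h
  simp only [Finset.coe_range, Set.mem_Iio, not_lt] at h
  exact hk (A.totTerm_eq_zero (hM _ (by lia)))

lemma totD_eq_zero {m m' : ℤ} (h : m + 1 ≠ m') : A.totD m m' = 0 := by
  ext a p
  rw [totD_apply]
  have : ∀ k : ℕ, A.totTerm m m' p k a = 0 := fun k ↦ by
    rw [totTerm, A.shape, ModuleCat.hom_zero, LinearMap.zero_apply, smul_zero]
    simp only [Prod.mk_add_mk, ne_eq, Prod.mk.injEq, not_and]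
    intro _ h'
    exact h (by lia)
  simp [this]

lemma sum_d_d' (l : ℕ) (a c : ℤ × ℤ) (hc : a + (-(l : ℤ), 2 - (l : ℤ)) = c) (b : ℕ → ℤ × ℤ)
    (hb : ∀ j : ℕ, a + (-(j : ℤ), 1 - (j : ℤ)) = b j) :
    ∑ ij ∈ Finset.HasAntidiagonal.antidiagonal l, (-1 : ℤ) ^ ij.1 •
      (A.d ij.2 a (b ij.2) ≫ A.d ij.1 (b ij.2) c) = 0 := by
  subst hc
  obtain rfl := funext hb
  exact A.sum_d_d l a

lemma d_d_congr {m p q q' s s' : ℤ} (i j : ℕ) (a : ∀ p : ℤ, A.X (p, m + p))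
    (hq : q = q') (hs : s = s') :
    (A.d i (s, m + 1 + s) (p, m + 1 + 1 + p)).hom
        ((A.d j (q, m + q) (s, m + 1 + s)).hom (a q)) =
      (A.d i (s', m + 1 + s') (p, m + 1 + 1 + p)).hom
        ((A.d j (q', m + q') (s', m + 1 + s')).hom (a q')) := by
  subst hq hs
  rfl

lemma sum_d_d_apply (m p : ℤ) (l : ℕ) (a : ∀ p : ℤ, A.X (p, m + p)) :
    ∑ ij ∈ Finset.HasAntidiagonal.antidiagonal l, (-1 : ℤ) ^ ij.1 •
      (A.d ij.1 (p + ij.1, m + 1 + (p + ij.1)) (p, m + 1 + 1 + p)).hom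
        ((A.d ij.2 (p + ij.1 + ij.2, m + (p + ij.1 + ij.2)) (p + ij.1, m + 1 + (p + ij.1))).hom
          (a (p + ij.1 + ij.2))) = 0 := by
  have h := A.sum_d_d' l (p + l, m + (p + l)) (p, m + 1 + 1 + p) (by ext <;> simp; ring)
    (fun j ↦ (p + l - j, m + 1 + (p + l - j))) (fun j ↦ by ext <;> simp <;> ring)
  have h' := congr(($h).hom (a (p + l)))
  rw [ModuleCat.hom_sum, LinearMap.sum_apply] at h'
  refine Eq.trans (Finset.sum_congr rfl fun ij hij ↦ ?_) h'
  have e : (ij.1 : ℤ) + ij.2 = l := by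
    have := Finset.HasAntidiagonal.mem_antidiagonal.1 hij
    exact_mod_cast this
  rw [A.d_d_congr ij.1 ij.2 a (q' := p + l) (s' := p + l - ij.2) (by lia) (by lia)]
  rfl

lemma totD_totD (m : ℤ) (a : A.totX m) : A.totD (m + 1) (m + 1 + 1) (A.totD m (m + 1) a) = 0 := by
  obtain ⟨N, hN⟩ := a.2
  ext p
  obtain ⟨M, hM⟩ : ∃ M : ℕ, N < p + M := ⟨(N - p + 1).toNat, by lia⟩
  have h₁ : ∀ i : ℕ, i < M → (A.totD m (m + 1) a : ∀ p : ℤ, A.X (p, m + 1 + p)) (p + i) =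
      ∑ j ∈ Finset.range (M - i), A.totTerm m (m + 1) (p + i) j a := fun i hi ↦
    A.totD_apply_eq_sum _ _ _ _ _ fun q hq ↦ hN _ (by lia)
  rw [A.totD_apply_eq_sum _ _ _ _ M fun q hq ↦ by
    rw [totD_apply]
    exact finsum_eq_zero_of_forall_eq_zero fun k ↦ A.totTerm_eq_zero (hN _ (by lia))]
  let g : ℕ → ℕ → A.X (p, m + 1 + 1 + p) := fun i j ↦
    ((i + j : ℤ) * m).negOnePow • (-1 : ℤ) ^ i •
      (A.d i (p + i, m + 1 + (p + i)) (p, m + 1 + 1 + p)).hom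
        ((A.d j (p + i + j, m + (p + i + j)) (p + i, m + 1 + (p + i))).hom
          ((a : ∀ p : ℤ, A.X (p, m + p)) (p + i + j)))
  have h₂ : ∀ i ∈ Finset.range M, A.totTerm (m + 1) (m + 1 + 1) p i (A.totD m (m + 1) a) =
      ∑ j ∈ Finset.range (M - i), g i j := by
    intro i hi
    rw [totTerm, h₁ i (Finset.mem_range.1 hi), map_sum, Finset.smul_sum]
    refine Finset.sum_congr rfl fun j _ ↦ ?_
    simp only [totTerm, g]
    rw [Units.smul_def, Units.smul_def, Units.smul_def, map_zsmul, smul_smul, smul_smul]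
    congr 1
    have : ((-1 : ℤ) ^ i) = (((i : ℤ).negOnePow : ℤˣ) : ℤ) := by simp [Int.negOnePow]
    rw [this, ← Units.val_mul, ← Units.val_mul, ← Int.negOnePow_add, ← Int.negOnePow_add]
    congr 2
    ring
  rw [Finset.sum_congr rfl h₂, ← Finset.sum_range_diag_flip]
  refine Finset.sum_eq_zero fun l _ ↦ ?_
  have h := congr(((l : ℤ) * m).negOnePow • $(A.sum_d_d_apply m p l a))
  rw [smul_zero, Finset.smul_sum, Finset.Nat.sum_antidiagonal_eq_sum_range_succ_mk] at h
  refine Eq.trans (Finset.sum_congr rfl fun i hi ↦ ?_) h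
  have hi' : (i : ℤ) + ((l - i : ℕ) : ℤ) = l := by
    have := Finset.mem_range.1 hi
    lia
  simp only [g, hi']

/-- The total complex. -/
noncomputable def totComplex : CochainComplex (ModuleCat.{v} R) ℤ where
  X m := ModuleCat.of R (A.totX m)
  d m m' := ModuleCat.ofHom (A.totD m m')
  shape m m' h := by
    rw [A.totD_eq_zero h]
    rfl
  d_comp_d' m m' m'' h h' := by
    obtain rfl : m + 1 = m' := h
    obtain rfl : m + 1 + 1 = m'' := h'
    exact ModuleCat.hom_ext (LinearMap.ext fun a ↦ A.totD_totD m a)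

/-- The column filtration of the total complex: `F_p` consists of the families `a` with `a_q = 0`
for `q > p`. -/
def totF (p m : ℤ) : Submodule R (A.totX m) where
  carrier := {a | ∀ q, p < q → (a : ∀ p : ℤ, A.X (p, m + p)) q = 0}
  add_mem' {a b} ha hb q hq := by
    change (a : ∀ p : ℤ, A.X (p, m + p)) q + (b : ∀ p : ℤ, A.X (p, m + p)) q = 0
    rw [ha q hq, hb q hq, add_zero]
  zero_mem' _ _ := rfl
  smul_mem' c a ha q hq := by
    change c • (a : ∀ p : ℤ, A.X (p, m + p)) q = 0
    rw [ha q hq, smul_zero]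

/-- The totalization of a multicomplex, a filtered complex. -/
noncomputable def tot : FilteredComplex.{v} R where
  K := A.totComplex
  F := A.totF
  F_mono p m a ha q hq := ha q (by lia)
  F_d p m m' a ha q hq := by
    change ∑ᶠ k : ℕ, A.totTerm m m' q k (a : A.totX m).1 = 0
    exact finsum_eq_zero_of_forall_eq_zero fun k ↦ A.totTerm_eq_zero (ha _ (by lia))

variable {A} {A' : Multicomplex.{v} R n} (f : A ⟶ A')

/-- The map induced on total modules. -/
noncomputable def totMapX (m : ℤ) : A.totX m →ₗ[R] A'.totX m :=
  (LinearMap.piMap fun p ↦ (f.f (p, m + p)).hom).restrict fun a ⟨N, hN⟩ ↦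
    ⟨N, fun p hp ↦ by simp [hN p hp]⟩

lemma totMapX_apply (m : ℤ) (a : A.totX m) (p : ℤ) :
    (totMapX f m a : ∀ p : ℤ, A'.X (p, m + p)) p =
      (f.f (p, m + p)).hom ((a : ∀ p : ℤ, A.X (p, m + p)) p) := rfl

/-- The map induced on totalizations. -/
noncomputable def totMap : A.tot ⟶ A'.tot where
  hom :=
    { f := fun m ↦ ModuleCat.ofHom (totMapX f m)
      comm' := fun m m' _ ↦ by
        refine ModuleCat.hom_ext (LinearMap.ext fun a ↦ Subtype.ext (funext fun p ↦ ?_))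
        change ∑ᶠ k : ℕ, A'.totTerm m m' p k (totMapX f m a).1 =
          (f.f (p, m' + p)).hom (∑ᶠ k : ℕ, A.totTerm m m' p k (a : A.totX m).1)
        rw [map_finsum _ (A.finite_support_totTerm m m' p a)]
        refine finsum_congr fun k ↦ ?_
        simp only [totTerm]
        rw [Units.smul_def, Units.smul_def, map_zsmul]
        congr 1
        have := congr(($(f.comm k (p + k, m + (p + k)) (p, m' + p))).hom
          ((a : A.totX m).1 (p + k)))
        exact this.symm }
  hom_F p m a ha q hq := by
    change (f.f (q, m + q)).hom ((a : A.totX m).1 q) = 0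
    rw [ha q hq, map_zero]

variable (R n)

/-- The totalization functor from `n`-multicomplexes to filtered complexes. -/
noncomputable def totFunctor : Multicomplex.{v} R n ⥤ FilteredComplex.{v} R where
  obj A := A.tot
  map f := totMap f
  map_id _ := rfl
  map_comp _ _ := rfl

/-- The spectral sequence functor `E' = E ∘ Tot` on `n`-multicomplexes. -/
noncomputable def spectralSequenceFunctor : Multicomplex.{v} R n ⥤ SpSe.{v} R :=
  totFunctor R n ⋙ FilteredComplex.spectralSequenceFunctor R

/-- `E_r`-quasi-isomorphisms of `n`-multicomplexes: the map induced on the `r`-page of the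
associated spectral sequences is a quasi-isomorphism. -/
def weq (r : ℕ) : MorphismProperty (Multicomplex.{v} R n) :=
  fun _ _ f ↦ QuasiIso (((spectralSequenceFunctor R n).map f).hom (r : ℤ))

/-- `r`-fibrations of `n`-multicomplexes: the maps induced on the pages `E_i`, `0 ≤ i ≤ r`, of the
associated spectral sequences are bidegreewise surjective. -/
def fib (r : ℕ) : MorphismProperty (Multicomplex.{v} R n) :=
  fun _ _ f ↦ ∀ (i : ℕ), i ≤ r → ∀ pq : ℤ × ℤ,
    Function.Surjective ((((spectralSequenceFunctor R n).map f).hom (i : ℤ)).f pq)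

end Multicomplex

end SpecSeqHomotopy

namespace SpecSeqHomotopy

/-! ### Homology classes of elements -/

section HomologyClass

variable {R : Type u} [CommRing R] {κ : Type*} {c : ComplexShape κ}

/-! Weak equivalences and fibrations of multicomplexes are the inverse images under `E'` of those of
spectral sequences, so both categories are handled by one statement, `isAlmostBrown_inverseImage`,
applied to `E'` and to the identity. It concerns an additive functor F from a preadditive category
with zero object to spectral sequences, and needs two inputs: pullbacks along maps p with F(p)
surjective on every page exist and are preserved by F; and for each Y and each k ≤ r there is a
"disc" P → Y, surjective on page k, with E_{r+1}(P) = 0.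

These inputs suffice. An acyclic fibration is surjective on every page: on pages up to r as a
fibration, beyond r because it is bijective there (`pagewiseSurjective_of_acyclic`). For the
factorization, discs for k = 0, …, r add up to q : P → Y, and u : X → Y factors as X → X ⊕ P → Y
through (u, q); the projection X ⊕ P → X is bijective on page r + 1 since E_{r+1}(P) = 0. Products
are pullbacks over the zero object, and the other axioms are formal.

Pullbacks: if p : Y → Z is pagewise surjective, then 0 → P_k → X_k ⊕ Y_k → Z_k → 0 is exact, and its
last map is still surjective on homology, because that is the map on page k + 1. So the connecting
maps vanish, H(P_k) is the pullback of the homologies, and the pagewise pullback is a spectral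
sequence (`pullbackCls_surjective`, `pullbackCls_eq_zero_iff`). For multicomplexes the pullback is
formed bidegreewise; since E'_0(A) is the underlying bigraded module of A, the comparison with the
pagewise pullback is bijective on page 0, hence an isomorphism.

Discs: over a spectral sequence, every element of page k lifts to successive cycles on all earlier
pages. A disc with M ⊕ M in every bidegree, zero differential before page k and an acyclic one on
page k, maps onto page k once M consists of such lifts of elements and of their differentials. Over
a multicomplex B, the disc is B tensored with the zigzag e_0 → f_1 ← e_1 → … ← e_{r-1} → f_r (or e_0
→ f_0 if r = 0), whose arrows to the left are d_0 and to the right d_1; this is where n ≥ 2 enters.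
Its E_{r+1} vanishes (`disc_mem_B`), and projection to the e_0 coefficient is surjective on pages up
to r (`exists_disc_lift`). -/

/-- The class of a cycle in the homology of a short complex of modules. -/
noncomputable def shortComplexCls (S : ShortComplex (ModuleCat.{v} R)) :
    LinearMap.ker S.g.hom →ₗ[R] S.homology :=
  (S.moduleCatCyclesIso.inv ≫ S.homologyπ).hom

lemma shortComplexCls_eq_zero_iff (S : ShortComplex (ModuleCat.{v} R))
    (x : LinearMap.ker S.g.hom) : shortComplexCls S x = 0 ↔ ∃ w, S.f.hom w = x := by
  have hinj : Function.Injective S.moduleCatHomologyIso.inv.hom :=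
    S.moduleCatHomologyIso.symm.toLinearEquiv.injective
  have h := congr(($(S.moduleCatCyclesIso_inv_π)).hom x)
  refine Eq.congr_left h |>.trans ?_
  refine (map_eq_zero_iff S.moduleCatHomologyIso.inv.hom hinj).trans ?_
  refine (Submodule.Quotient.mk_eq_zero _).trans ?_
  exact exists_congr fun w ↦ Subtype.ext_iff

lemma map_mem_ker_g {S T : ShortComplex (ModuleCat.{v} R)} (f : S ⟶ T) {x : S.X₂}
    (hx : x ∈ LinearMap.ker S.g.hom) : f.τ₂.hom x ∈ LinearMap.ker T.g.hom := by
  refine congr(($(f.comm₂₃)).hom x).trans ?_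
  exact (congrArg f.τ₃.hom hx).trans (map_zero _)

lemma homologyMap_shortComplexCls {S T : ShortComplex (ModuleCat.{v} R)} (f : S ⟶ T)
    (x : LinearMap.ker S.g.hom) :
    (ShortComplex.homologyMap f).hom (shortComplexCls S x) =
      shortComplexCls T ⟨f.τ₂.hom x, map_mem_ker_g f x.2⟩ := by
  let g : S.moduleCatLeftHomologyData.K ⟶ T.moduleCatLeftHomologyData.K :=
    ModuleCat.ofHom (f.τ₂.hom.restrict fun _ hx ↦ map_mem_ker_g f hx)
  have h : S.moduleCatCyclesIso.inv ≫ ShortComplex.cyclesMap f =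
      g ≫ T.moduleCatCyclesIso.inv := by
    rw [← cancel_mono T.iCycles, Category.assoc, Category.assoc,
      ShortComplex.moduleCatCyclesIso_inv_iCycles, ShortComplex.cyclesMap_i,
      ShortComplex.moduleCatCyclesIso_inv_iCycles_assoc]
    rfl
  have h' : (S.moduleCatCyclesIso.inv ≫ S.homologyπ) ≫ ShortComplex.homologyMap f =
      g ≫ T.moduleCatCyclesIso.inv ≫ T.homologyπ := by
    rw [Category.assoc, ShortComplex.homologyπ_naturality, reassoc_of% h]
  exact congr(($h').hom x)

/-- The class of a cycle in the homology of a complex of modules. -/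
noncomputable def homologyCls (K : HomologicalComplex (ModuleCat.{v} R) c) (i : κ) :
    LinearMap.ker (K.d i (c.next i)).hom →ₗ[R] K.homology i :=
  shortComplexCls (K.sc i)

lemma homologyCls_surjective (K : HomologicalComplex (ModuleCat.{v} R) c) (i : κ) :
    Function.Surjective (homologyCls K i) :=
  (ModuleCat.epi_iff_surjective ((K.sc i).moduleCatCyclesIso.inv ≫ (K.sc i).homologyπ)).1
    inferInstance

lemma homologyCls_eq_zero_iff (K : HomologicalComplex (ModuleCat.{v} R) c) (i : κ)
    (x : LinearMap.ker (K.d i (c.next i)).hom) :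
    homologyCls K i x = 0 ↔ ∃ w, (K.d (c.prev i) i).hom w = x :=
  shortComplexCls_eq_zero_iff (K.sc i) x

lemma map_mem_ker {K L : HomologicalComplex (ModuleCat.{v} R) c} (f : K ⟶ L) {i j : κ}
    {x : K.X i} (hx : x ∈ LinearMap.ker (K.d i j).hom) :
    (f.f i).hom x ∈ LinearMap.ker (L.d i j).hom := by
  have h := congr(($(f.comm i j)).hom x)
  rw [ModuleCat.hom_comp, ModuleCat.hom_comp, LinearMap.comp_apply, LinearMap.comp_apply,
    LinearMap.mem_ker.1 hx, map_zero] at h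
  exact h

lemma d_map_apply {K L : HomologicalComplex (ModuleCat.{v} R) c} (f : K ⟶ L) (i j : κ)
    (x : K.X i) : (L.d i j).hom ((f.f i).hom x) = (f.f j).hom ((K.d i j).hom x) :=
  congr(($(f.comm i j)).hom x)

lemma d_d_apply (K : HomologicalComplex (ModuleCat.{v} R) c) (i j k : κ)
    (x : K.X i) : (K.d j k).hom ((K.d i j).hom x) = 0 :=
  congr(($(K.d_comp_d i j k)).hom x)

lemma homologyMap_homologyCls {K L : HomologicalComplex (ModuleCat.{v} R) c} (f : K ⟶ L) (i : κ)
    (x : LinearMap.ker (K.d i (c.next i)).hom) :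
    (HomologicalComplex.homologyMap f i).hom (homologyCls K i x) =
      homologyCls L i ⟨(f.f i).hom x, map_mem_ker f x.2⟩ :=
  homologyMap_shortComplexCls ((HomologicalComplex.shortComplexFunctor _ _ i).map f) x

end HomologyClass

/-! ### Spectral sequences of modules -/

namespace SpectralSequence

variable {R : Type u} [CommRing R] {κ : Type*} {c : ℤ → ComplexShape κ} {r₀ : ℤ}

/-- The element of the page `r' = r + 1` defined by a cycle on the page `r`. -/
noncomputable def cls (E : SpectralSequence (ModuleCat.{v} R) c r₀) (r r' : ℤ) (h : r + 1 = r')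
    (hr : r₀ ≤ r) (i : κ) :
    LinearMap.ker ((E.page r hr).d i ((c r).next i)).hom →ₗ[R] (E.page r' (by lia)).X i :=
  (E.iso r r' i h hr).hom.hom ∘ₗ homologyCls (E.page r hr) i

section

variable (E : SpectralSequence (ModuleCat.{v} R) c r₀) (r r' : ℤ) (h : r + 1 = r')
    (hr : r₀ ≤ r) (i : κ)

lemma cls_surjective : Function.Surjective (cls E r r' h hr i) :=
  (E.iso r r' i h hr).toLinearEquiv.surjective.comp (homologyCls_surjective _ _)

lemma cls_eq_zero_iff (x : LinearMap.ker ((E.page r hr).d i ((c r).next i)).hom) :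
    cls E r r' h hr i x = 0 ↔ ∃ w, ((E.page r hr).d ((c r).prev i) i).hom w = x := by
  rw [← homologyCls_eq_zero_iff]
  exact (E.iso r r' i h hr).toLinearEquiv.map_eq_zero_iff

variable {E} in
lemma map_cls {E' : SpectralSequence (ModuleCat.{v} R) c r₀} (f : E ⟶ E')
    (x : LinearMap.ker ((E.page r hr).d i ((c r).next i)).hom) :
    ((f.hom r' (by lia)).f i).hom (cls E r r' h hr i x) =
      cls E' r r' h hr i ⟨((f.hom r hr).f i).hom x, map_mem_ker _ x.2⟩ := by
  have := congr(($(f.comm r r' i h hr)).hom (homologyCls (E.page r hr) i x))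
  refine this.symm.trans ?_
  refine congrArg (E'.iso r r' i h hr).hom.hom ?_
  exact homologyMap_homologyCls _ _ _

end

/-- Morphisms of spectral sequences from families of morphisms of pages which commute with classes
of cycles. -/
def homMk {E E' : SpectralSequence (ModuleCat.{v} R) c r₀}
    (f : ∀ (r : ℤ) (hr : r₀ ≤ r), E.page r hr ⟶ E'.page r hr)
    (hf : ∀ (r r' : ℤ) (h : r + 1 = r') (hr : r₀ ≤ r) (i : κ)
      (x : LinearMap.ker ((E.page r hr).d i ((c r).next i)).hom),
      ((f r' (by lia)).f i).hom (cls E r r' h hr i x) =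
        cls E' r r' h hr i ⟨((f r hr).f i).hom x, map_mem_ker _ x.2⟩) : E ⟶ E' where
  hom := f
  comm r r' i h hr := by
    refine ModuleCat.hom_ext (LinearMap.ext fun y ↦ ?_)
    obtain ⟨x, rfl⟩ := homologyCls_surjective _ _ y
    refine Eq.trans ?_ (hf r r' h hr i x).symm
    refine congrArg (E'.iso r r' i h hr).hom.hom ?_
    exact homologyMap_homologyCls _ _ _

/-- The spectral sequence with given pages and given classes of cycles. -/
noncomputable def ofCls (K : ∀ r : ℤ, r₀ ≤ r → HomologicalComplex (ModuleCat.{v} R) (c r))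
    (φ : ∀ (r r' : ℤ) (h : r + 1 = r') (hr : r₀ ≤ r) (i : κ),
      LinearMap.ker ((K r hr).d i ((c r).next i)).hom →ₗ[R] (K r' (by lia)).X i)
    (hφ : ∀ (r r' : ℤ) (h : r + 1 = r') (hr : r₀ ≤ r) (i : κ), Function.Surjective (φ r r' h hr i))
    (hφ' : ∀ (r r' : ℤ) (h : r + 1 = r') (hr : r₀ ≤ r) (i : κ) x,
      φ r r' h hr i x = 0 ↔ ∃ w, ((K r hr).d ((c r).prev i) i).hom w = x) :
    SpectralSequence (ModuleCat.{v} R) c r₀ where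
  page := K
  iso r r' i h hr :=
    ((LinearMap.quotKerEquivOfSurjective _ (homologyCls_surjective (K r hr) i)).symm.trans
      ((Submodule.quotEquivOfEq _ _ (by
        ext x
        rw [LinearMap.mem_ker, LinearMap.mem_ker, homologyCls_eq_zero_iff, hφ'])).trans
      (LinearMap.quotKerEquivOfSurjective _ (hφ r r' h hr i)))).toModuleIso

lemma cls_ofCls (K : ∀ r : ℤ, r₀ ≤ r → HomologicalComplex (ModuleCat.{v} R) (c r))
    (φ : ∀ (r r' : ℤ) (h : r + 1 = r') (hr : r₀ ≤ r) (i : κ),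
      LinearMap.ker ((K r hr).d i ((c r).next i)).hom →ₗ[R] (K r' (by lia)).X i)
    (hφ : ∀ (r r' : ℤ) (h : r + 1 = r') (hr : r₀ ≤ r) (i : κ), Function.Surjective (φ r r' h hr i))
    (hφ' : ∀ (r r' : ℤ) (h : r + 1 = r') (hr : r₀ ≤ r) (i : κ) x,
      φ r r' h hr i x = 0 ↔ ∃ w, ((K r hr).d ((c r).prev i) i).hom w = x)
    (r r' : ℤ) (h : r + 1 = r') (hr : r₀ ≤ r) (i : κ)
    (x : LinearMap.ker ((K r hr).d i ((c r).next i)).hom) :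
    cls (ofCls K φ hφ hφ') r r' h hr i x = φ r r' h hr i x := by
  have : (LinearMap.quotKerEquivOfSurjective _ (homologyCls_surjective (K r hr) i)).symm
      (homologyCls (K r hr) i x) = Submodule.Quotient.mk x := by
    rw [LinearEquiv.symm_apply_eq]
    rfl
  change LinearMap.quotKerEquivOfSurjective _ (hφ r r' h hr i) (Submodule.quotEquivOfEq _ _ _
    ((LinearMap.quotKerEquivOfSurjective _ (homologyCls_surjective (K r hr) i)).symm
      (homologyCls (K r hr) i x))) = _
  rw [this]
  rfl

/-! ### Quasi-isomorphisms and isomorphisms tested on pages. -/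

section Iso

variable {E E' : SpectralSequence (ModuleCat.{v} R) c r₀} (f : E ⟶ E')

/-- The structure isomorphisms of the two spectral sequences conjugate the map on the homology of
one page into the map on the next page. -/
lemma quasiIso_iff_bijective (r r' : ℤ) (h : r + 1 = r') (hr : r₀ ≤ r) :
    QuasiIso (f.hom r hr) ↔ ∀ i, Function.Bijective ((f.hom r' (by lia)).f i).hom := by
  rw [quasiIso_iff]
  refine forall_congr' fun i ↦ ?_
  rw [quasiIsoAt_iff_isIso_homologyMap]
  have := f.comm r r' i h hr
  have h' : (f.hom r' (by lia)).f i = (E.iso r r' i h hr).inv ≫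
      HomologicalComplex.homologyMap (f.hom r hr) i ≫ (E'.iso r r' i h hr).hom := by
    rw [this, Iso.inv_hom_id_assoc]
  refine Iff.trans ?_ (ConcreteCategory.isIso_iff_bijective ((f.hom r' (by lia)).f i))
  rw [h', isIso_comp_left_iff, isIso_comp_right_iff]

lemma bijective_succ (r r' : ℤ) (h : r + 1 = r') (hr : r₀ ≤ r)
    (H : ∀ i, Function.Bijective ((f.hom r hr).f i).hom) (i : κ) :
    Function.Bijective ((f.hom r' (by lia)).f i).hom := by
  have : ∀ i, IsIso ((f.hom r hr).f i) := fun i ↦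
    (ConcreteCategory.isIso_iff_bijective _).2 (H i)
  have : IsIso (f.hom r hr) := HomologicalComplex.Hom.isIso_of_components _
  exact (quasiIso_iff_bijective f r r' h hr).1 inferInstance i

lemma bijective_of_le {r : ℤ} (hr : r₀ ≤ r)
    (H : ∀ i, Function.Bijective ((f.hom r hr).f i).hom) (r' : ℤ) (h : r ≤ r') (i : κ) :
    Function.Bijective ((f.hom r' (by lia)).f i).hom := by
  induction r', h using Int.leInduction generalizing i with
  | base => exact H i
  | succ n hn ih => exact bijective_succ f n _ rfl (by lia) (fun i ↦ ih i) i

/-- Bijectivity passes to homology, hence from the first page to all later ones, and the pagewise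
inverses are again compatible with the structure isomorphisms. -/
lemma isIso_of_bijective (H : ∀ i, Function.Bijective ((f.hom r₀ le_rfl).f i).hom) : IsIso f := by
  have : ∀ r hr, IsIso (f.hom r hr) := fun r hr ↦ by
    have : ∀ i, IsIso ((f.hom r hr).f i) := fun i ↦
      (ConcreteCategory.isIso_iff_bijective _).2 (bijective_of_le f _ H r hr i)
    exact HomologicalComplex.Hom.isIso_of_components _
  refine ⟨{ hom := fun r hr ↦ inv (f.hom r hr), comm := fun r r' i h hr ↦ ?_ }, ?_, ?_⟩
  · have := f.comm r r' i h hr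
    rw [← cancel_mono ((f.hom r' (by lia)).f i), Category.assoc, Category.assoc, ← this,
      ← Category.assoc, ← HomologicalComplex.homologyMap_comp, ← HomologicalComplex.comp_f]
    simp
  · ext1; simp
  · ext1; simp

end Iso

/-! ### The additive structure -/

section Preadditive

variable {E E' : SpectralSequence (ModuleCat.{v} R) c r₀}

instance : Zero (E ⟶ E') :=
  ⟨{ hom := fun _ _ ↦ 0, comm := fun r r' i h hr ↦ by simp }⟩

instance : Add (E ⟶ E') where
  add f g :=
    { hom := fun r hr ↦ f.hom r hr + g.hom r hr
      comm := fun r r' i h hr ↦ by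
        rw [HomologicalComplex.homologyMap_add, HomologicalComplex.add_f_apply,
          Preadditive.add_comp, Preadditive.comp_add, f.comm r r' i h hr, g.comm r r' i h hr] }

instance : Neg (E ⟶ E') where
  neg f :=
    { hom := fun r hr ↦ - f.hom r hr
      comm := fun r r' i h hr ↦ by
        rw [HomologicalComplex.homologyMap_neg, HomologicalComplex.neg_f_apply,
          Preadditive.neg_comp, Preadditive.comp_neg, f.comm r r' i h hr] }

instance : Preadditive (SpectralSequence (ModuleCat.{v} R) c r₀) where
  homGroup _ _ :=
    { AddGroup.ofLeftAxioms
        (fun _ _ _ ↦ SpectralSequence.hom_ext fun _ _ ↦ add_assoc _ _ _)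
        (fun _ ↦ SpectralSequence.hom_ext fun _ _ ↦ zero_add _)
        (fun _ ↦ SpectralSequence.hom_ext fun _ _ ↦ neg_add_cancel _) with
      add_comm := fun _ _ ↦ SpectralSequence.hom_ext fun _ _ ↦ add_comm _ _ }
  add_comp _ _ _ _ _ _ := SpectralSequence.hom_ext fun _ _ ↦ Preadditive.add_comp _ _ _ _ _ _
  comp_add _ _ _ _ _ _ := SpectralSequence.hom_ext fun _ _ ↦ Preadditive.comp_add _ _ _ _ _ _

instance : HasZeroObject (SpectralSequence (ModuleCat.{v} R) c r₀) where
  zero := by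
    let Z : SpectralSequence (ModuleCat.{v} R) c r₀ :=
      ofCls (fun r hr ↦
        { X := fun _ ↦ ModuleCat.of R PUnit, d := fun _ _ ↦ 0 })
        (fun r r' h hr i ↦ 0) (fun r r' h hr i x ↦ ⟨0, rfl⟩)
        (fun r r' h hr i x ↦ ⟨fun _ ↦ ⟨0, rfl⟩, fun _ ↦ rfl⟩)
    refine ⟨Z, (IsZero.iff_id_eq_zero Z).2 (SpectralSequence.hom_ext fun r hr ↦ ?_)⟩
    refine HomologicalComplex.hom_ext _ _ fun i ↦ ModuleCat.hom_ext (LinearMap.ext fun x ↦ ?_)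
    exact Subsingleton.elim (α := PUnit) _ _

end Preadditive

end SpectralSequence

end SpecSeqHomotopy

namespace SpecSeqHomotopy

/-! ### Pullbacks of complexes of modules -/

section PullbackComplex

variable {R : Type u} [CommRing R] {κ : Type*} {c : ComplexShape κ}
  {K L M : HomologicalComplex (ModuleCat.{v} R) c} (g : K ⟶ M) (p : L ⟶ M)

/-- The degreewise pullback of complexes of modules. -/
def pullbackX (i : κ) : Submodule R (K.X i × L.X i) :=
  LinearMap.eqLocus ((g.f i).hom ∘ₗ LinearMap.fst R _ _) ((p.f i).hom ∘ₗ LinearMap.snd R _ _)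

lemma mem_pullbackX {i : κ} {z : K.X i × L.X i} :
    z ∈ pullbackX g p i ↔ (g.f i).hom z.1 = (p.f i).hom z.2 := Iff.rfl

/-- The pullback of complexes of modules. -/
def pullbackComplex : HomologicalComplex (ModuleCat.{v} R) c where
  X i := ModuleCat.of R (pullbackX g p i)
  d i j := ModuleCat.ofHom (((K.d i j).hom.prodMap (L.d i j).hom).restrict fun z hz ↦ by
    rw [mem_pullbackX] at hz ⊢
    refine (d_map_apply g i j z.1).symm.trans ?_ |>.trans (d_map_apply p i j z.2)
    rw [hz])
  shape i j h := by
    refine ModuleCat.hom_ext (LinearMap.ext fun z ↦ Subtype.ext (Prod.ext ?_ ?_))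
    · exact congr(($(K.shape i j h)).hom z.1.1)
    · exact congr(($(L.shape i j h)).hom z.1.2)
  d_comp_d' i j k _ _ := by
    refine ModuleCat.hom_ext (LinearMap.ext fun z ↦ Subtype.ext (Prod.ext ?_ ?_))
    · exact d_d_apply K i j k z.1.1
    · exact d_d_apply L i j k z.1.2

/-- The first projection. -/
def pullbackComplexFst : pullbackComplex g p ⟶ K where
  f i := ModuleCat.ofHom (LinearMap.fst R _ _ ∘ₗ (pullbackX g p i).subtype)

/-- The second projection. -/
def pullbackComplexSnd : pullbackComplex g p ⟶ L where
  f i := ModuleCat.ofHom (LinearMap.snd R _ _ ∘ₗ (pullbackX g p i).subtype)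

lemma mem_ker_pullbackComplex {i j : κ} {z : pullbackX g p i} :
    z ∈ LinearMap.ker ((pullbackComplex g p).d i j).hom ↔
      z.1.1 ∈ LinearMap.ker (K.d i j).hom ∧ z.1.2 ∈ LinearMap.ker (L.d i j).hom :=
  Subtype.ext_iff.trans Prod.ext_iff

end PullbackComplex

/-! ### Pullbacks of spectral sequences -/

namespace SpectralSequence

variable {R : Type u} [CommRing R] {κ : Type*} {c : ℤ → ComplexShape κ} {r₀ : ℤ}
  {X Y Z : SpectralSequence (ModuleCat.{v} R) c r₀} (g : X ⟶ Z) (p : Y ⟶ Z)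

/-- The class of a pair of cycles in the pagewise pullback. -/
noncomputable def pullbackCls (r r' : ℤ) (h : r + 1 = r') (hr : r₀ ≤ r) (i : κ) :
    LinearMap.ker ((pullbackComplex (g.hom r hr) (p.hom r hr)).d i ((c r).next i)).hom →ₗ[R]
      pullbackX (g.hom r' (by lia)) (p.hom r' (by lia)) i :=
  LinearMap.codRestrict _
    (LinearMap.prod
      (cls X r r' h hr i ∘ₗ ((pullbackComplexFst (g.hom r hr) (p.hom r hr)).f i).hom.restrict
        fun _ hx ↦ map_mem_ker _ hx)
      (cls Y r r' h hr i ∘ₗ ((pullbackComplexSnd (g.hom r hr) (p.hom r hr)).f i).hom.restrict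
        fun _ hx ↦ map_mem_ker _ hx))
    (fun x ↦ by
      refine (map_cls r r' h hr i g _).trans ?_ |>.trans (map_cls r r' h hr i p _).symm
      congr 1
      exact Subtype.ext x.1.2)

lemma cls_congr (E : SpectralSequence (ModuleCat.{v} R) c r₀) (r r' : ℤ) (h : r + 1 = r')
    (hr : r₀ ≤ r) (i : κ) {x y : (E.page r hr).X i} (hxy : x = y)
    (hx : x ∈ LinearMap.ker ((E.page r hr).d i ((c r).next i)).hom)
    (hy : y ∈ LinearMap.ker ((E.page r hr).d i ((c r).next i)).hom) :
    cls E r r' h hr i ⟨x, hx⟩ = cls E r r' h hr i ⟨y, hy⟩ := by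
  subst hxy
  rfl

variable (hp : ∀ (r : ℤ) (hr : r₀ ≤ r) (i : κ), Function.Surjective ((p.hom r hr).f i).hom)

-- If cycles x and y have equal images in the homology of Z, then g x - p y is a boundary. Lifting
-- its bounding chain through p changes y by a boundary, after which the images agree on the page
-- itself.
include hp in
lemma pullbackCls_surjective (r r' : ℤ) (h : r + 1 = r') (hr : r₀ ≤ r) (i : κ) :
    Function.Surjective (pullbackCls g p r r' h hr i) := by
  rintro ⟨⟨x', y'⟩, e⟩
  obtain ⟨⟨x, hx⟩, rfl⟩ := cls_surjective X r r' h hr i x'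
  obtain ⟨⟨y, hy⟩, rfl⟩ := cls_surjective Y r r' h hr i y'
  rw [mem_pullbackX] at e
  replace e := (map_cls r r' h hr i g ⟨x, hx⟩).symm.trans (e.trans (map_cls r r' h hr i p ⟨y, hy⟩))
  rw [← sub_eq_zero, ← map_sub, cls_eq_zero_iff] at e
  obtain ⟨w, hw⟩ := e
  obtain ⟨w, rfl⟩ := hp r hr _ w
  change _ = ((g.hom r hr).f i).hom x - ((p.hom r hr).f i).hom y at hw
  rw [d_map_apply, eq_sub_iff_add_eq, ← map_add] at hw
  have hdw : ((Y.page r hr).d ((c r).prev i) i).hom w ∈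
      LinearMap.ker ((Y.page r hr).d i ((c r).next i)).hom := d_d_apply _ _ _ _ _
  refine ⟨⟨⟨⟨x, ((Y.page r hr).d ((c r).prev i) i).hom w + y⟩, hw.symm⟩,
    (mem_ker_pullbackComplex _ _).2 ⟨hx, add_mem hdw hy⟩⟩, ?_⟩
  refine Subtype.ext (Prod.ext rfl ?_)
  change cls Y r r' h hr i (⟨_, hdw⟩ + ⟨y, hy⟩) = _
  rw [map_add, (cls_eq_zero_iff Y r r' h hr i _).2 ⟨w, rfl⟩, zero_add]

-- This is the vanishing of the connecting map. Given x = d x₁ and y = d y₁, the element g x₁ - p y₁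
-- is a cycle, possibly nonzero. Surjectivity of p on the next page matches its class with that of a
-- cycle y₂ of Y, and surjectivity on the present page lifts the remaining boundary; adding both to
-- y₁ leaves its differential unchanged.
include hp in
lemma pullbackCls_eq_zero_iff (r r' : ℤ) (h : r + 1 = r') (hr : r₀ ≤ r) (i : κ)
    (x : LinearMap.ker ((pullbackComplex (g.hom r hr) (p.hom r hr)).d i ((c r).next i)).hom) :
    pullbackCls g p r r' h hr i x = 0 ↔
      ∃ w, ((pullbackComplex (g.hom r hr) (p.hom r hr)).d ((c r).prev i) i).hom w = x := by
  obtain ⟨⟨⟨x, y⟩, e⟩, hxy⟩ := x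
  obtain ⟨hx, hy⟩ := (mem_ker_pullbackComplex _ _).1 hxy
  have key : pullbackCls g p r r' h hr i ⟨⟨⟨x, y⟩, e⟩, hxy⟩ = 0 ↔
      cls X r r' h hr i ⟨x, hx⟩ = 0 ∧ cls Y r r' h hr i ⟨y, hy⟩ = 0 :=
    Subtype.ext_iff.trans Prod.ext_iff
  rw [key, cls_eq_zero_iff, cls_eq_zero_iff]
  constructor
  · rintro ⟨⟨x₁, hx₁⟩, ⟨y₁, hy₁⟩⟩
    generalize (c r).prev i = j at x₁ y₁ hx₁ hy₁ ⊢
    -- If no differential enters i, then `prev` is a junk value and both bounding equations say that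
    -- x and y are zero.
    by_cases hji : (c r).Rel j i
    swap
    · rw [(X.page r hr).shape _ _ hji] at hx₁
      rw [(Y.page r hr).shape _ _ hji] at hy₁
      refine ⟨0, (map_zero _).trans (Subtype.ext (Prod.ext hx₁ hy₁))⟩
    have hnext : (c r).next j = i := (c r).next_eq' hji
    have e' : ((g.hom r hr).f i).hom x = ((p.hom r hr).f i).hom y := e
    dsimp only at hx₁ hy₁
    have hz : ((g.hom r hr).f j).hom x₁ - ((p.hom r hr).f j).hom y₁ ∈
        LinearMap.ker ((Z.page r hr).d j ((c r).next j)).hom := by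
      rw [hnext, LinearMap.mem_ker, map_sub, d_map_apply, d_map_apply, hx₁, hy₁, e', sub_self]
    obtain ⟨y₂, hy₂⟩ := hp r' (by lia) j (cls Z r r' h hr j ⟨_, hz⟩)
    obtain ⟨⟨y₂, hy₂'⟩, rfl⟩ := cls_surjective Y r r' h hr j y₂
    rw [map_cls, eq_comm, ← sub_eq_zero, ← map_sub, cls_eq_zero_iff] at hy₂
    obtain ⟨w, hw⟩ := hy₂
    obtain ⟨w, rfl⟩ := hp r hr _ w
    set v : (Y.page r hr).X j := ((Y.page r hr).d ((c r).prev j) j).hom w with hv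
    change _ = ((g.hom r hr).f j).hom x₁ - ((p.hom r hr).f j).hom y₁ -
      ((p.hom r hr).f j).hom y₂ at hw
    rw [d_map_apply, eq_sub_iff_add_eq, eq_sub_iff_add_eq, ← map_add, ← map_add] at hw
    refine ⟨⟨⟨x₁, v + y₂ + y₁⟩, hw.symm⟩, Subtype.ext (Prod.ext hx₁ ?_)⟩
    change ((Y.page r hr).d j i).hom (v + y₂ + y₁) = y
    rw [hnext, LinearMap.mem_ker] at hy₂'
    rw [map_add, map_add, hv, d_d_apply, hy₂', hy₁, zero_add, zero_add]
  · rintro ⟨⟨⟨x₁, y₁⟩, _⟩, hw⟩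
    have hw' := Prod.ext_iff.1 (Subtype.ext_iff.1 hw)
    exact ⟨⟨x₁, hw'.1⟩, ⟨y₁, hw'.2⟩⟩

/-- The pagewise pullback of spectral sequences, along a pagewise surjective morphism. -/
noncomputable def pullbackSeq : SpectralSequence (ModuleCat.{v} R) c r₀ :=
  ofCls (fun r hr ↦ pullbackComplex (g.hom r hr) (p.hom r hr)) (pullbackCls g p)
    (pullbackCls_surjective g p hp) (pullbackCls_eq_zero_iff g p hp)

lemma cls_pullbackSeq (r r' : ℤ) (h : r + 1 = r') (hr : r₀ ≤ r) (i : κ)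
    (x : LinearMap.ker ((pullbackComplex (g.hom r hr) (p.hom r hr)).d i ((c r).next i)).hom) :
    cls (pullbackSeq g p hp) r r' h hr i x = pullbackCls g p r r' h hr i x :=
  cls_ofCls _ _ _ _ _ _ _ _ _ _

/-- The first projection. -/
noncomputable def pullbackFst : pullbackSeq g p hp ⟶ X :=
  homMk (fun r hr ↦ pullbackComplexFst (g.hom r hr) (p.hom r hr))
    (fun r r' h hr i x ↦ congrArg
      (fun z : pullbackX (g.hom r' (by lia)) (p.hom r' (by lia)) i ↦ z.1.1)
      (cls_pullbackSeq g p hp r r' h hr i x))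

/-- The second projection. -/
noncomputable def pullbackSnd : pullbackSeq g p hp ⟶ Y :=
  homMk (fun r hr ↦ pullbackComplexSnd (g.hom r hr) (p.hom r hr))
    (fun r r' h hr i x ↦ congrArg
      (fun z : pullbackX (g.hom r' (by lia)) (p.hom r' (by lia)) i ↦ z.1.2)
      (cls_pullbackSeq g p hp r r' h hr i x))

variable {g p} in
/-- The universal property of the pullback. -/
noncomputable def pullbackLift {T : SpectralSequence (ModuleCat.{v} R) c r₀} (a : T ⟶ X)
    (b : T ⟶ Y) (hab : a ≫ g = b ≫ p) : T ⟶ pullbackSeq g p hp :=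
  homMk (fun r hr ↦
    { f := fun i ↦ ModuleCat.ofHom (LinearMap.codRestrict _
        (LinearMap.prod ((a.hom r hr).f i).hom ((b.hom r hr).f i).hom)
        fun x ↦ congr((($(hab)).hom r hr |>.f i).hom x))
      comm' := fun i j _ ↦ by
        refine ModuleCat.hom_ext (LinearMap.ext fun x ↦ Subtype.ext (Prod.ext ?_ ?_))
        · exact d_map_apply (a.hom r hr) i j x
        · exact d_map_apply (b.hom r hr) i j x })
    (fun r r' h hr i x ↦ by
      refine Eq.trans (Subtype.ext (Prod.ext ?_ ?_)) (cls_pullbackSeq g p hp r r' h hr i _).symm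
      · exact map_cls r r' h hr i a x
      · exact map_cls r r' h hr i b x)

lemma isPullback_pullbackSeq : IsPullback (pullbackFst g p hp) (pullbackSnd g p hp) g p where
  w := SpectralSequence.hom_ext fun _ _ ↦ HomologicalComplex.hom_ext _ _ fun _ ↦
    ModuleCat.hom_ext (LinearMap.ext fun x ↦ x.2)
  isLimit' := ⟨PullbackCone.IsLimit.mk _ (fun s ↦ pullbackLift hp s.fst s.snd s.condition)
    (fun _ ↦ rfl) (fun _ ↦ rfl) (fun _ _ h₁ h₂ ↦
      SpectralSequence.hom_ext fun r hr ↦ HomologicalComplex.hom_ext _ _ fun i ↦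
        ModuleCat.hom_ext (LinearMap.ext fun x ↦ Subtype.ext (Prod.ext
          congr((($(h₁)).hom r hr |>.f i).hom x) congr((($(h₂)).hom r hr |>.f i).hom x))))⟩

/-! ### Base change of surjectivity and injectivity on pages. -/

section IsPullback

variable {g p} {P : SpectralSequence (ModuleCat.{v} R) c r₀} {fst : P ⟶ X} {snd : P ⟶ Y}

include hp in
lemma surjective_of_isPullback (sq : IsPullback fst snd g p) (r : ℤ) (hr : r₀ ≤ r) (i : κ) :
    Function.Surjective ((fst.hom r hr).f i).hom := by
  intro x
  obtain ⟨y, hy⟩ := hp r hr i (((g.hom r hr).f i).hom x)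
  let l := sq.lift _ _ (isPullback_pullbackSeq g p hp).w
  refine ⟨((l.hom r hr).f i).hom ⟨⟨x, y⟩, hy.symm⟩, ?_⟩
  exact congr((($(sq.lift_fst _ _ (isPullback_pullbackSeq g p hp).w)).hom r hr |>.f i).hom
    ⟨⟨x, y⟩, hy.symm⟩)

include hp in
lemma injective_of_isPullback (sq : IsPullback fst snd g p) (r : ℤ) (hr : r₀ ≤ r) (i : κ)
    (H : Function.Injective ((p.hom r hr).f i).hom) :
    Function.Injective ((fst.hom r hr).f i).hom := by
  have hl : (sq.isoIsPullback _ _ (isPullback_pullbackSeq g p hp)).hom ≫ pullbackFst g p hp = fst :=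
    sq.isoIsPullback_hom_fst _ _ _
  rw [← hl]
  let e := (sq.isoIsPullback _ _ (isPullback_pullbackSeq g p hp))
  have he : IsIso ((e.hom.hom r hr).f i) :=
    inferInstanceAs (IsIso (((SpectralSequence.pageFunctor _ c r₀ r hr ⋙
      HomologicalComplex.eval _ _ i).mapIso e).hom))
  refine Function.Injective.comp (g := ((((pullbackFst g p hp).hom r hr).f i).hom)) ?_
    ((ConcreteCategory.isIso_iff_bijective _).1 he).1
  rintro ⟨⟨x, y⟩, h⟩ ⟨⟨x', y'⟩, h'⟩ hx
  obtain rfl : x = x' := hx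
  obtain rfl : y = y' := H (h.symm.trans h')
  rfl

end IsPullback

end SpectralSequence

end SpecSeqHomotopy

namespace SpecSeqHomotopy

/-! ### Discs over a spectral sequence -/

namespace SpectralSequence

variable {R : Type u} [CommRing R] {κ : Type} {c : ℤ → ComplexShape κ} {r₀ : ℤ}
  (E : SpectralSequence (ModuleCat.{v} R) c r₀)

/-- Families of elements of all pages of a spectral sequence. -/
abbrev Families : Type v :=
  ∀ (j : {j : ℤ // r₀ ≤ j}) (i : κ), (E.page j.1 j.2).X i

/-- Families of elements such that, for `j < k`, the component on the page `j` consists of cycles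
which represent the component on the page `j + 1`. -/
noncomputable def coherentFamilies (k : ℤ) : Submodule R (Families E) where
  carrier := {x | ∀ (j : ℤ) (hj : r₀ ≤ j) (_ : j < k) (i : κ),
    ∃ hx : x ⟨j, hj⟩ i ∈ LinearMap.ker ((E.page j hj).d i ((c j).next i)).hom,
      cls E j (j + 1) rfl hj i ⟨_, hx⟩ = x ⟨j + 1, by lia⟩ i}
  add_mem' := by
    intro x y hx hy j hj hjk i
    obtain ⟨hx, hx'⟩ := hx j hj hjk i
    obtain ⟨hy, hy'⟩ := hy j hj hjk i
    have hj' : r₀ ≤ j + 1 := by lia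
    refine ⟨add_mem hx hy, ?_⟩
    change cls E j (j + 1) rfl hj i (⟨_, hx⟩ + ⟨_, hy⟩) = x ⟨j + 1, hj'⟩ i + y ⟨j + 1, hj'⟩ i
    rw [map_add, hx', hy']
  zero_mem' := fun j hj hjk i ↦ ⟨zero_mem _, map_zero (cls E j (j + 1) rfl hj i)⟩
  smul_mem' := by
    intro a x hx j hj hjk i
    obtain ⟨hx, hx'⟩ := hx j hj hjk i
    refine ⟨Submodule.smul_mem _ a hx, ?_⟩
    change cls E j (j + 1) rfl hj i (a • ⟨_, hx⟩) = a • x ⟨j + 1, by lia⟩ i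
    rw [map_smul, hx']

/-- An element of page k is the class of a cycle of page k - 1, which is in turn the class of a
cycle of page k - 2, and so on down to the first page. Entries beyond page k are unconstrained. -/
lemma exists_coherentFamily (k : ℤ) (hk : r₀ ≤ k) (y : ∀ i, (E.page k hk).X i) :
    ∃ x ∈ coherentFamilies E k, ∀ i, x ⟨k, hk⟩ i = y i := by
  classical
  induction k, hk using Int.leInduction with
  | base =>
    refine ⟨Function.update 0 ⟨r₀, le_rfl⟩ y, fun j hj hjk i ↦ absurd hj (by lia), fun i ↦ ?_⟩
    rw [Function.update_self]
  | succ k hk ih =>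
    choose y' hy' using fun i ↦ cls_surjective E k (k + 1) rfl hk i (y i)
    obtain ⟨x, hx, hxy⟩ := ih fun i ↦ (y' i).1
    have h₁ : ∀ (j : ℤ) (hj : r₀ ≤ j), j ≠ k + 1 →
        Function.update x ⟨k + 1, by lia⟩ y ⟨j, hj⟩ = x ⟨j, hj⟩ := fun j hj hne ↦
      Function.update_of_ne (fun h ↦ hne (congrArg Subtype.val h)) _ _
    have h₂ : Function.update x ⟨k + 1, by lia⟩ y ⟨k + 1, by lia⟩ = y := Function.update_self ..
    refine ⟨Function.update x ⟨k + 1, by lia⟩ y, fun j hj hjk i ↦ ?_, fun i ↦ by rw [h₂]⟩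
    have hj' := h₁ j hj (by lia)
    by_cases hjk' : j = k
    · subst hjk'
      rw [h₂]
      refine ⟨by rw [hj', hxy]; exact (y' i).2, ?_⟩
      rw [← hy' i]
      exact cls_congr E _ _ _ _ _ (by rw [hj', hxy]) _ _
    · obtain ⟨hx₁, hx₂⟩ := hx j hj (by lia) i
      refine ⟨by rw [hj']; exact hx₁, ?_⟩
      rw [h₁ (j + 1) (by lia) (by lia), ← hx₂]
      exact cls_congr E _ _ _ _ _ (by rw [hj']) _ _

/-- Pairs of coherent families `(x, w)` such that `w_k` is the differential of `x_k`. -/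
noncomputable def discFamilies (k : ℤ) (hk : r₀ ≤ k) : Submodule R (Families E × Families E) where
  carrier := {z | z.1 ∈ coherentFamilies E k ∧ z.2 ∈ coherentFamilies E k ∧
    ∀ i i', (c k).Rel i i' → z.2 ⟨k, hk⟩ i' = ((E.page k hk).d i i').hom (z.1 ⟨k, hk⟩ i)}
  add_mem' := by
    rintro z z' ⟨h₁, h₂, h₃⟩ ⟨h₁', h₂', h₃'⟩
    refine ⟨add_mem h₁ h₁', add_mem h₂ h₂', fun i i' h ↦ ?_⟩
    change z.2 ⟨k, hk⟩ i' + z'.2 ⟨k, hk⟩ i' =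
      ((E.page k hk).d i i').hom (z.1 ⟨k, hk⟩ i + z'.1 ⟨k, hk⟩ i)
    rw [map_add, h₃ i i' h, h₃' i i' h]
  zero_mem' := ⟨zero_mem _, zero_mem _, fun i i' _ ↦ (map_zero _).symm⟩
  smul_mem' := by
    rintro a z ⟨h₁, h₂, h₃⟩
    refine ⟨Submodule.smul_mem _ a h₁, Submodule.smul_mem _ a h₂, fun i i' h ↦ ?_⟩
    change a • z.2 ⟨k, hk⟩ i' = ((E.page k hk).d i i').hom (a • z.1 ⟨k, hk⟩ i)
    rw [map_smul, h₃ i i' h]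

section

variable (M : Type v) [AddCommGroup M] [Module R M] (k : ℤ)

/-- The modules on the page `j` of a disc of length `k`. -/
def discX (j : ℤ) : Submodule R (M × M) where
  carrier := {z | k < j → z = 0}
  add_mem' hx hy h := by rw [hx h, hy h, add_zero]
  zero_mem' _ := rfl
  smul_mem' a _ hx h := by rw [hx h, smul_zero]

open Classical in
/-- The page `j` of a disc of length `k`: the differential `(a, b) ↦ (0, a)` if `j = k`. -/
noncomputable def discPage (j : ℤ) (c : ComplexShape κ) :
    HomologicalComplex (ModuleCat.{v} R) c where
  X _ := ModuleCat.of R (discX (R := R) M k j)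
  d i i' := ModuleCat.ofHom
    ((if j = k ∧ c.Rel i i' then LinearMap.inr R M M ∘ₗ LinearMap.fst R M M else 0).restrict
      fun z hz h ↦ by rw [hz h, map_zero])
  shape i i' h := by
    simp only [h, and_false, if_false]
    rfl
  d_comp_d' i i' i'' h h' := by
    refine ModuleCat.hom_ext (LinearMap.ext fun z ↦ Subtype.ext ?_)
    change (if _ then LinearMap.inr R M M ∘ₗ LinearMap.fst R M M else 0)
      ((if _ then LinearMap.inr R M M ∘ₗ LinearMap.fst R M M else 0) z.1) = 0
    simp only [h, h', and_true]
    split_ifs <;> simp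

variable {M k}

open Classical in
lemma discPage_d_apply {j : ℤ} {c : ComplexShape κ} (hj : j = k) {i i' : κ} (h : c.Rel i i')
    (z : discX (R := R) M k j) : (((discPage M k j c).d i i').hom z).1 = (0, z.1.1) := by
  change (if _ then LinearMap.inr R M M ∘ₗ LinearMap.fst R M M else 0) z.1 = _
  rw [if_pos ⟨hj, h⟩]
  rfl

open Classical in
lemma discPage_d_eq_zero {j : ℤ} {c : ComplexShape κ} (hj : j ≠ k) {i i' : κ}
    (z : discX (R := R) M k j) : ((discPage M k j c).d i i').hom z = 0 := by
  refine Subtype.ext ?_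
  change (if _ then LinearMap.inr R M M ∘ₗ LinearMap.fst R M M else 0) z.1 = _
  rw [if_neg fun h ↦ hj h.1]
  rfl

variable (M k)

open Classical in
/-- The classes of cycles in a disc of length `k`. -/
noncomputable def discCls (r r' : ℤ) (h : r + 1 = r') (i : κ) :
    LinearMap.ker ((discPage (R := R) M k r (c r)).d i ((c r).next i)).hom →ₗ[R]
      discX (R := R) M k r' :=
  LinearMap.codRestrict _ ((if r < k then LinearMap.id else 0) ∘ₗ (discX (R := R) M k r).subtype ∘ₗ
    Submodule.subtype _) fun z h' ↦ by
      rw [if_neg (by lia)]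
      rfl

variable {M k}

lemma discCls_of_lt {r r' : ℤ} (h : r + 1 = r') {i : κ} (hr : r < k)
    (z : LinearMap.ker ((discPage (R := R) M k r (c r)).d i ((c r).next i)).hom) :
    (discCls (R := R) M k r r' h i z).1 = z.1.1 := by
  change (if r < k then LinearMap.id (R := R) else 0) z.1.1 = _
  rw [if_pos hr]
  rfl

lemma discCls_of_le {r r' : ℤ} (h : r + 1 = r') {i : κ} (hr : k ≤ r)
    (z : LinearMap.ker ((discPage (R := R) M k r (c r)).d i ((c r).next i)).hom) :
    discCls (R := R) M k r r' h i z = 0 := by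
  refine Subtype.ext ?_
  change (if r < k then LinearMap.id (R := R) else 0) z.1.1 = _
  rw [if_neg (by lia)]
  rfl

lemma discX_eq_zero {j : ℤ} (h : k < j) (z : discX (R := R) M k j) : z = 0 :=
  Subtype.ext (z.2 h)

variable (hc : ∀ r i, (c r).Rel i ((c r).next i)) (hc' : ∀ r i, (c r).Rel ((c r).prev i) i)

-- On page k the differential (a, b) ↦ (0, a) has kernel a = 0, provided some differential leaves
-- every bidegree; beyond page k the modules are zero.
include hc in
lemma fst_eq_zero_of_mem_ker {r : ℤ} (hr : k ≤ r) {i : κ}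
    (z : LinearMap.ker ((discPage (R := R) M k r (c r)).d i ((c r).next i)).hom) :
    z.1.1.1 = 0 := by
  rcases hr.eq_or_lt with rfl | hr
  · have h := discPage_d_apply rfl (hc k i) z.1
    exact (Prod.ext_iff.1 (h.symm.trans (congrArg Subtype.val z.2))).2
  · rw [discX_eq_zero hr z.1]
    rfl

lemma discCls_surjective (r r' : ℤ) (h : r + 1 = r') (i : κ) :
    Function.Surjective (discCls (R := R) (c := c) M k r r' h i) := by
  intro z
  by_cases hk : r < k
  · refine ⟨⟨⟨z.1, fun h ↦ by lia⟩, discPage_d_eq_zero (by lia) _⟩, Subtype.ext ?_⟩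
    rw [discCls_of_lt h hk]
  · exact ⟨0, (map_zero _).trans (discX_eq_zero (by lia) z).symm⟩

-- Before page k the differentials vanish and classes are the elements themselves. On page k the
-- complex is exact, because every bidegree is both a source and a target.
include hc hc' in
lemma discCls_eq_zero_iff (r r' : ℤ) (h : r + 1 = r') (i : κ)
    (z : LinearMap.ker ((discPage (R := R) M k r (c r)).d i ((c r).next i)).hom) :
    discCls (R := R) M k r r' h i z = 0 ↔
      ∃ w, ((discPage (R := R) M k r (c r)).d ((c r).prev i) i).hom w = z.1 := by
  by_cases hk : r < k
  · rw [Subtype.ext_iff, discCls_of_lt h hk]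
    constructor
    · intro hz
      exact ⟨0, (map_zero _).trans (Subtype.ext hz).symm⟩
    · rintro ⟨w, hw⟩
      exact congrArg Subtype.val (hw.symm.trans (discPage_d_eq_zero hk.ne w))
  · refine ⟨fun _ ↦ ?_, fun _ ↦ discCls_of_le h (by lia) z⟩
    have h₁ := fst_eq_zero_of_mem_ker hc (by lia) z
    by_cases hk' : r = k
    -- A cycle has the form (0, b), which is the differential of (b, 0).
    · refine ⟨⟨(z.1.1.2, 0), fun h ↦ by lia⟩, Subtype.ext ?_⟩
      refine (discPage_d_apply hk' (hc' r i) _).trans ?_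
      exact Prod.ext h₁.symm rfl
    · exact ⟨0, (map_zero _).trans (discX_eq_zero (by lia) z.1).symm⟩

variable (M k) in
/-- The disc of length `k` with values in the module `M`. -/
noncomputable def disc (r₀ : ℤ) : SpectralSequence (ModuleCat.{v} R) c r₀ :=
  ofCls (fun r _ ↦ discPage M k r (c r)) (fun r r' h _ i ↦ discCls M k r r' h i)
    (fun r r' h _ i ↦ discCls_surjective r r' h i)
    (fun r r' h _ i ↦ discCls_eq_zero_iff hc hc' r r' h i)

lemma cls_disc (r₀ r r' : ℤ) (h : r + 1 = r') (hr : r₀ ≤ r) (i : κ)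
    (z : LinearMap.ker ((discPage (R := R) M k r (c r)).d i ((c r).next i)).hom) :
    cls (disc (R := R) M k hc hc' r₀) r r' h hr i z = discCls M k r r' h i z :=
  cls_ofCls _ _ _ _ _ _ _ _ _ _

end

variable (k : ℤ) (hk : r₀ ≤ k)

/-- The evaluation of a pair of families in `discFamilies` on a page. -/
noncomputable def discFamiliesEval (j : ℤ) (hj : r₀ ≤ j) (i : κ) :
    discFamilies E k hk × discFamilies E k hk →ₗ[R] (E.page j hj).X i where
  toFun z := z.1.1.1 ⟨j, hj⟩ i + z.2.1.2 ⟨j, hj⟩ i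
  map_add' z z' := by
    change z.1.1.1 ⟨j, hj⟩ i + z'.1.1.1 ⟨j, hj⟩ i + (z.2.1.2 ⟨j, hj⟩ i + z'.2.1.2 ⟨j, hj⟩ i) =
      z.1.1.1 ⟨j, hj⟩ i + z.2.1.2 ⟨j, hj⟩ i + (z'.1.1.1 ⟨j, hj⟩ i + z'.2.1.2 ⟨j, hj⟩ i)
    abel
  map_smul' a z := (smul_add a _ _).symm

lemma discFamiliesEval_apply (j : ℤ) (hj : r₀ ≤ j) (i : κ)
    (z : discFamilies E k hk × discFamilies E k hk) :
    discFamiliesEval E k hk j hj i z = z.1.1.1 ⟨j, hj⟩ i + z.2.1.2 ⟨j, hj⟩ i := rfl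

variable (hc : ∀ r i, (c r).Rel i ((c r).next i)) (hc' : ∀ r i, (c r).Rel ((c r).prev i) i)

-- Below page k the components of coherent families are cycles. On page k, the value x_k + w'_k of a
-- pair has differential d x_k, which is the w-component of its first entry, as the disc
-- differential prescribes. Above k everything vanishes.
include hc' in
lemma d_discFamiliesEval (r : ℤ) (hr : r₀ ≤ r) {i i' : κ} (h : (c r).Rel i i')
    (z : discX (R := R) (discFamilies E k hk) k r) :
    ((E.page r hr).d i i').hom (discFamiliesEval E k hk r hr i z.1) =
      discFamiliesEval E k hk r hr i'
        (((discPage (R := R) (discFamilies E k hk) k r (c r)).d i i').hom z).1 := by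
  rcases lt_trichotomy r k with hrk | rfl | hrk
  · obtain rfl := (c r).next_eq' h
    refine Eq.trans ?_ (congrArg (fun z : discX _ _ _ ↦ discFamiliesEval E k hk r hr _ z.1)
      (discPage_d_eq_zero hrk.ne z)).symm
    refine Eq.trans ?_ (map_zero _).symm
    obtain ⟨h₁, -⟩ := z.1.1.2.1 r hr hrk i
    obtain ⟨h₂, -⟩ := z.1.2.2.2.1 r hr hrk i
    exact add_mem h₁ h₂
  · refine Eq.trans ?_ (congrArg (discFamiliesEval E r hk r hr i')
      (discPage_d_apply rfl h z)).symm
    rw [discFamiliesEval_apply, discFamiliesEval_apply, map_add]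
    refine Eq.trans (congrArg _ ?_) ((add_zero _).trans ?_) |>.trans (zero_add _).symm
    -- Since every bidegree has a predecessor, the w-component on page k is itself a boundary, hence
    -- killed by d.
    · rw [z.1.2.2.2.2 _ _ (hc' r i), d_d_apply]
    · exact (z.1.1.2.2.2 _ _ h).symm
  · obtain rfl := discX_eq_zero hrk z
    refine Eq.trans (congrArg _ (map_zero _)) ((map_zero _).trans ?_)
    refine Eq.symm ((congrArg (fun z : discX _ _ _ ↦ discFamiliesEval E k hk r hr i' z.1)
      (map_zero ((discPage _ k r (c r)).d i i').hom)).trans (map_zero _))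

-- Below page k this is coherence. On page k a cycle of the disc has first entry zero, so its value
-- is a w-component, that is a boundary, and its class is zero, as in the disc.
include hc hc' in
lemma discFamiliesEval_discCls (r r' : ℤ) (h : r + 1 = r') (hr : r₀ ≤ r) (i : κ)
    (z : LinearMap.ker
      ((discPage (R := R) (discFamilies E k hk) k r (c r)).d i ((c r).next i)).hom)
    (hz : discFamiliesEval E k hk r hr i z.1.1 ∈
      LinearMap.ker ((E.page r hr).d i ((c r).next i)).hom) :
    discFamiliesEval E k hk r' (by lia) i (discCls _ k r r' h i z).1 =
      cls E r r' h hr i ⟨_, hz⟩ := by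
  subst h
  by_cases hrk : r < k
  · obtain ⟨h₁, h₁'⟩ := z.1.1.1.2.1 r hr hrk i
    obtain ⟨h₂, h₂'⟩ := z.1.1.2.2.2.1 r hr hrk i
    rw [discCls_of_lt rfl hrk z, discFamiliesEval_apply, ← h₁', ← h₂', ← map_add]
    rfl
  · rw [discCls_of_le rfl (not_lt.1 hrk) z]
    refine Eq.trans (map_zero _) ((cls_eq_zero_iff E r _ rfl hr i _).2 ?_).symm
    have h₁ := fst_eq_zero_of_mem_ker hc (not_lt.1 hrk) z
    rcases (not_lt.1 hrk).eq_or_lt with rfl | hrk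
    · refine ⟨z.1.1.2.1.1 ⟨k, hr⟩ _, ?_⟩
      refine (z.1.1.2.2.2.2 _ _ (hc' k i)).symm.trans ?_
      change _ = z.1.1.1.1.1 ⟨k, hr⟩ i + z.1.1.2.1.2 ⟨k, hr⟩ i
      rw [h₁]
      exact (zero_add _).symm
    · refine ⟨0, (map_zero _).trans ?_⟩
      change _ = discFamiliesEval E k hk r hr i z.1.1
      rw [show z.1.1 = 0 from congrArg Subtype.val (discX_eq_zero hrk z.1), map_zero]

/-- The evaluation morphism from a disc to a spectral sequence. -/
noncomputable def discEval : disc (discFamilies E k hk) k hc hc' r₀ ⟶ E :=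
  homMk (fun r hr ↦
    { f := fun i ↦ ModuleCat.ofHom (discFamiliesEval E k hk r hr i ∘ₗ Submodule.subtype _)
      comm' := fun i i' h ↦ ModuleCat.hom_ext (LinearMap.ext
        (d_discFamiliesEval E k hk hc' r hr h)) })
    (fun r r' h hr i z ↦ by
      refine Eq.trans (congrArg (fun z : discX _ _ _ ↦ discFamiliesEval E k hk r' (by lia) i z.1)
        (cls_disc hc hc' r₀ r r' h hr i z)) ?_
      exact discFamiliesEval_discCls E k hk hc hc' r r' h hr i z _)

lemma discEval_surjective (i : κ) :
    Function.Surjective (((discEval E k hk hc hc').hom k hk).f i).hom := by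
  classical
  intro y
  obtain ⟨x, hx, hxy⟩ := exists_coherentFamily E k hk (Pi.single i y)
  -- The second family lifts the differential of x_k in all bidegrees at once; the element (x, w),
  -- placed in the first summand of the disc, is then sent to y.
  obtain ⟨w, hw, hwx⟩ := exists_coherentFamily E k hk
    (fun i' ↦ ((E.page k hk).d ((c k).prev i') i').hom (x ⟨k, hk⟩ ((c k).prev i')))
  refine ⟨⟨(⟨(x, w), hx, hw, fun i i' h ↦ ?_⟩, 0), fun h ↦ by lia⟩, ?_⟩
  · obtain rfl := (c k).prev_eq' h
    exact hwx _
  · change x ⟨k, hk⟩ i + 0 = y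
    rw [add_zero, hxy, Pi.single_eq_same]

lemma disc_page_eq_zero (r : ℤ) (hr : r₀ ≤ r) (hkr : k < r) (i : κ)
    (x : ((disc (R := R) (discFamilies E k hk) k hc hc' r₀).page r hr).X i) : x = 0 :=
  discX_eq_zero hkr x

end SpectralSequence

end SpecSeqHomotopy

namespace SpecSeqHomotopy

/-! ### Almost Brown categories defined by a functor to spectral sequences -/

namespace SpSe

variable {R : Type u} [CommRing R]

/-- Morphisms of spectral sequences which are bidegreewise surjective on all pages. -/
def pagewiseSurjective : MorphismProperty (SpSe.{v} R) :=
  fun _ _ f ↦ ∀ (k : ℤ) (hk : 0 ≤ k) (i : ℤ × ℤ), Function.Surjective ((f.hom k hk).f i).hom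

lemma weq_iff (r : ℕ) {X Y : SpSe.{v} R} (f : X ⟶ Y) :
    weq R r f ↔ ∀ i, Function.Bijective ((f.hom ((r : ℤ) + 1)).f i).hom :=
  SpectralSequence.quasiIso_iff_bijective f r _ rfl (by lia)

/-- Pages up to r are covered by the fibration condition; from page r + 1 on the map is bijective.
-/
lemma pagewiseSurjective_of_acyclic (r : ℕ) {X Y : SpSe.{v} R} (f : X ⟶ Y)
    (hf : (weq R r ⊓ fib R r) f) : pagewiseSurjective f := by
  intro k hk i
  by_cases h : k ≤ r
  · obtain ⟨k, rfl⟩ := Int.eq_ofNat_of_zero_le hk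
    exact hf.2 k (by lia) i
  · exact (SpectralSequence.bijective_of_le f _ ((weq_iff r f).1 hf.1) k (by lia) i).2

lemma fib_of_pagewiseSurjective (r : ℕ) {X Y : SpSe.{v} R} (f : X ⟶ Y)
    (hf : pagewiseSurjective f) : fib R r f :=
  fun k _ i ↦ hf k (by lia) i

instance (r : ℕ) : (weq.{v} R r).HasTwoOutOfThreeProperty where
  comp_mem f g hf hg := by
    have : QuasiIso (f.hom (r : ℤ)) := hf
    have : QuasiIso (g.hom (r : ℤ)) := hg
    exact inferInstanceAs (QuasiIso (f.hom (r : ℤ) ≫ g.hom (r : ℤ)))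
  of_postcomp f g hg hfg := by
    have : QuasiIso (g.hom (r : ℤ)) := hg
    have : QuasiIso (f.hom (r : ℤ) ≫ g.hom (r : ℤ)) := hfg
    have hr : (0 : ℤ) ≤ r := by lia
    exact quasiIso_of_comp_right (f.hom (r : ℤ) hr) (g.hom (r : ℤ) hr)
  of_precomp f g hf hfg := by
    have : QuasiIso (f.hom (r : ℤ)) := hf
    have : QuasiIso (f.hom (r : ℤ) ≫ g.hom (r : ℤ)) := hfg
    have hr : (0 : ℤ) ≤ r := by lia
    exact quasiIso_of_comp_left (f.hom (r : ℤ) hr) (g.hom (r : ℤ) hr)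

lemma bijective_of_isIso {X Y : SpSe.{v} R} (f : X ⟶ Y) [IsIso f] (k : ℤ) (hk : 0 ≤ k)
    (i : ℤ × ℤ) : Function.Bijective ((f.hom k hk).f i).hom :=
  (ConcreteCategory.isIso_iff_bijective ((f.hom k hk).f i)).1
    (inferInstanceAs (IsIso (((SpectralSequence.pageFunctor _ _ 0 k hk ⋙
      HomologicalComplex.eval _ _ i).map f))))

lemma isomorphisms_le_weq (r : ℕ) : MorphismProperty.isomorphisms (SpSe.{v} R) ≤ weq R r :=
  fun _ _ f (_ : IsIso f) ↦ (weq_iff r f).2 fun i ↦ bijective_of_isIso f _ _ i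

lemma isomorphisms_le_fib (r : ℕ) : MorphismProperty.isomorphisms (SpSe.{v} R) ≤ fib R r :=
  fun _ _ f (_ : IsIso f) ↦ fib_of_pagewiseSurjective r f
    fun k hk i ↦ (bijective_of_isIso f k hk i).2

instance (r : ℕ) : (fib.{v} R r).IsStableUnderComposition where
  comp_mem f g hf hg k hk i := Function.Surjective.comp (g := (g.hom (k : ℤ)).f i)
    (f := (f.hom (k : ℤ)).f i) (hg k hk i) (hf k hk i)

lemma acyclic_of_isPullback (r : ℕ) {P X Y Z : SpSe.{v} R} {fst : P ⟶ X} {snd : P ⟶ Y}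
    {g : X ⟶ Z} {p : Y ⟶ Z} (sq : IsPullback fst snd g p) (hp : (weq R r ⊓ fib R r) p) :
    (weq R r ⊓ fib R r) fst := by
  have hs := pagewiseSurjective_of_acyclic r p hp
  have hs' : pagewiseSurjective fst := SpectralSequence.surjective_of_isPullback hs sq
  refine ⟨(weq_iff r fst).2 fun i ↦ ⟨?_, hs' _ _ i⟩, fib_of_pagewiseSurjective r fst hs'⟩
  exact SpectralSequence.injective_of_isPullback hs sq _ _ i ((weq_iff r p).1 hp.1 i).1

lemma eq_zero_of_isZero {X : SpSe.{v} R} (hX : IsZero X) (k : ℤ) (hk : 0 ≤ k) (i : ℤ × ℤ)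
    (x : (X.page k hk).X i) : x = 0 :=
  congr((($(hX.eq_of_src (𝟙 X) 0)).hom k hk |>.f i).hom x)

/-- Differentials are indexed by translations of ℤ × ℤ, so every bidegree has a predecessor and a
successor, as the discs require. -/
lemma exists_disc (Y : SpSe.{v} R) (k : ℕ) :
    ∃ (P : SpSe.{v} R) (q : P ⟶ Y),
      (∀ i, Function.Surjective ((q.hom (k : ℤ)).f i).hom) ∧
      ∀ (r : ℕ), k ≤ r → ∀ i (x : (P.page ((r : ℤ) + 1)).X i), x = 0 := by
  have hc : ∀ (r : ℤ) (i : ℤ × ℤ), (ComplexShape.up' ((-r, 1 - r) : ℤ × ℤ)).Rel i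
      ((ComplexShape.up' ((-r, 1 - r) : ℤ × ℤ)).next i) := fun r i ↦ by
    have : (ComplexShape.up' ((-r, 1 - r) : ℤ × ℤ)).Rel i (i + (-r, 1 - r)) := rfl
    rwa [ComplexShape.next_eq' _ this]
  have hc' : ∀ (r : ℤ) (i : ℤ × ℤ), (ComplexShape.up' ((-r, 1 - r) : ℤ × ℤ)).Rel
      ((ComplexShape.up' ((-r, 1 - r) : ℤ × ℤ)).prev i) i := fun r i ↦ by
    have : (ComplexShape.up' ((-r, 1 - r) : ℤ × ℤ)).Rel (i - (-r, 1 - r)) i :=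
      sub_add_cancel _ _
    rwa [ComplexShape.prev_eq' _ this]
  exact ⟨_, SpectralSequence.discEval Y k (by lia) hc hc',
    SpectralSequence.discEval_surjective Y k (by lia) hc hc',
    fun r hr i x ↦ SpectralSequence.disc_page_eq_zero Y k (by lia) hc hc' _ _ (by lia) i x⟩

end SpSe

/-! ### Transfer of the structure along an additive functor to spectral sequences. -/

section InverseImage

variable {R : Type u} [CommRing R]

universe v₁ u₁

open ZeroObject

variable {C : Type u₁} [Category.{v₁} C] [Preadditive C] (F : C ⥤ SpSe.{v} R)

lemma surjective_desc_left [HasBinaryBiproducts C] {X Y Z : C} (f : X ⟶ Z) (g : Y ⟶ Z) (k : ℤ)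
    (hk : 0 ≤ k) (i : ℤ × ℤ) (hf : Function.Surjective (((F.map f).hom k hk).f i).hom) :
    Function.Surjective (((F.map (biprod.desc f g)).hom k hk).f i).hom := by
  intro z
  obtain ⟨x, rfl⟩ := hf z
  refine ⟨(((F.map biprod.inl).hom k hk).f i).hom x, ?_⟩
  have h : F.map biprod.inl ≫ F.map (biprod.desc f g) = F.map f := by
    rw [← F.map_comp, biprod.inl_desc]
  exact congr((($h).hom k hk |>.f i).hom x)

lemma surjective_desc_right [HasBinaryBiproducts C] {X Y Z : C} (f : X ⟶ Z) (g : Y ⟶ Z) (k : ℤ)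
    (hk : 0 ≤ k) (i : ℤ × ℤ) (hg : Function.Surjective (((F.map g).hom k hk).f i).hom) :
    Function.Surjective (((F.map (biprod.desc f g)).hom k hk).f i).hom := by
  intro z
  obtain ⟨y, rfl⟩ := hg z
  refine ⟨(((F.map biprod.inr).hom k hk).f i).hom y, ?_⟩
  have h : F.map biprod.inr ≫ F.map (biprod.desc f g) = F.map g := by
    rw [← F.map_comp, biprod.inr_desc]
  exact congr((($h).hom k hk |>.f i).hom y)

variable [F.Additive]

lemma map_biprod_total_apply [HasBinaryBiproducts C] (X Y : C) (k : ℤ) (hk : 0 ≤ k) (i : ℤ × ℤ)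
    (z : ((F.obj (X ⊞ Y)).page k hk).X i) :
    z = (((F.map biprod.inl).hom k hk).f i).hom ((((F.map biprod.fst).hom k hk).f i).hom z) +
      (((F.map biprod.inr).hom k hk).f i).hom ((((F.map biprod.snd).hom k hk).f i).hom z) := by
  have h : F.map (biprod.fst : X ⊞ Y ⟶ X) ≫ F.map biprod.inl +
      F.map (biprod.snd : X ⊞ Y ⟶ Y) ≫ F.map biprod.inr = 𝟙 _ := by
    rw [← F.map_comp, ← F.map_comp, ← F.map_add, biprod.total, F.map_id]
  exact congr((($h).hom k hk |>.f i).hom z).symm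

variable (r : ℕ)
  (hpb : ∀ {X Y Z : C} (g : X ⟶ Z) (p : Y ⟶ Z),
    SpSe.pagewiseSurjective (F.map p) → HasPullback g p)
  (hpb' : ∀ {P X Y Z : C} {fst : P ⟶ X} {snd : P ⟶ Y} {g : X ⟶ Z} {p : Y ⟶ Z},
    IsPullback fst snd g p → SpSe.pagewiseSurjective (F.map p) →
      IsPullback (F.map fst) (F.map snd) (F.map g) (F.map p))
  (hdisc : ∀ (Y : C) (k : ℕ), k ≤ r → ∃ (P : C) (q : P ⟶ Y),
    (∀ i, Function.Surjective (((F.map q).hom (k : ℤ)).f i).hom) ∧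
    ∀ i (x : ((F.obj P).page ((r : ℤ) + 1)).X i), x = 0)

-- Both classes upstairs are inverse images, so preservation of fibrations and acyclic fibrations is
-- tautological; finite products are preserved by additivity.
include hpb' in
theorem isLeftExact_of_additive :
    IsLeftExact ((SpSe.weq.{v} R r).inverseImage F) ((SpSe.fib.{v} R r).inverseImage F)
      (SpSe.weq.{v} R r) (SpSe.fib.{v} R r) F where
  preservesFiniteProducts := inferInstance
  map_fib _ hf := hf
  map_acyclicFib _ hf := hf
  map_isPullback sq hp := hpb' sq (SpSe.pagewiseSurjective_of_acyclic r _ hp)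

variable [HasZeroObject C]

-- A product is a pullback over the terminal object, and a map to a zero object is surjective on
-- every page of its image.
include hpb in
lemma hasBinaryProducts_of_pullbacks : HasBinaryProducts C := by
  have : HasTerminal C := HasZeroObject.hasTerminal
  suffices ∀ X Y : C, HasLimit (pair X Y) from hasBinaryProducts_of_hasLimit_pair C
  intro X Y
  have hs : SpSe.pagewiseSurjective (F.map (terminal.from Y)) := fun k hk i x ↦
    ⟨0, (map_zero _).trans (SpSe.eq_zero_of_isZero
      (F.map_isZero ((isZero_zero C).of_iso
        (terminalIsTerminal.uniqueUpToIso HasZeroObject.zeroIsTerminal))) k hk i x).symm⟩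
  have := hpb (terminal.from X) (terminal.from Y) hs
  exact ⟨⟨_, isProductOfIsTerminalIsPullback _ _ _ _ terminalIsTerminal
    (IsPullback.of_hasPullback (terminal.from X) (terminal.from Y)).isLimit⟩⟩

-- The sum of one disc for each page k = 0, …, r. Each summand takes care of its own page, and
-- additivity of F keeps page r + 1 zero.
include hdisc in
lemma exists_path_object [HasBinaryBiproducts C] (Y : C) : ∃ (P : C) (q : P ⟶ Y),
    (∀ k : ℕ, k ≤ r → ∀ i, Function.Surjective (((F.map q).hom (k : ℤ)).f i).hom) ∧
    ∀ i (x : ((F.obj P).page ((r : ℤ) + 1)).X i), x = 0 := by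
  suffices H : ∀ s : ℕ, s ≤ r + 1 → ∃ (P : C) (q : P ⟶ Y),
      (∀ k : ℕ, k < s → ∀ i, Function.Surjective (((F.map q).hom (k : ℤ)).f i).hom) ∧
      ∀ i (x : ((F.obj P).page ((r : ℤ) + 1)).X i), x = 0 by
    obtain ⟨P, q, h, h'⟩ := H (r + 1) le_rfl
    exact ⟨P, q, fun k hk ↦ h k (by lia), h'⟩
  intro s
  induction s with
  | zero =>
    exact fun _ ↦ ⟨0, 0, fun k hk ↦ absurd hk (by lia), fun i x ↦
      SpSe.eq_zero_of_isZero (F.map_isZero (isZero_zero C)) _ _ i x⟩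
  | succ s ih =>
    intro hs
    obtain ⟨P, q, h, h'⟩ := ih (by lia)
    obtain ⟨P', q', h₁, h₁'⟩ := hdisc Y s (by lia)
    refine ⟨P ⊞ P', biprod.desc q q', fun k hk i ↦ ?_, fun i x ↦ ?_⟩
    · by_cases hks : k = s
      · subst hks
        exact surjective_desc_right F q q' _ _ i (h₁ i)
      · exact surjective_desc_left F q q' _ _ i (h k (by lia) i)
    · rw [map_biprod_total_apply F P P' _ _ i x, h' i (ModuleCat.Hom.hom _ _),
        h₁' i (ModuleCat.Hom.hom _ _), map_zero,
        map_zero, add_zero]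

include hpb hpb' hdisc in
/-- A category with a suitable additive functor to spectral sequences is an almost Brown
category. -/
theorem isAlmostBrown_inverseImage :
    IsAlmostBrown ((SpSe.weq.{v} R r).inverseImage F) ((SpSe.fib.{v} R r).inverseImage F) := by
  have := hasBinaryProducts_of_pullbacks F hpb
  have : HasBinaryBiproducts C := HasBinaryBiproducts.of_hasBinaryProducts
  have : HasTerminal C := HasZeroObject.hasTerminal
  exact {
    hasFiniteProducts := hasFiniteProducts_of_has_binary_and_terminal
    twoOutOfThree := inferInstance
    isomorphisms_le_weq := fun _ _ f (_ : IsIso f) ↦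
      SpSe.isomorphisms_le_weq r _ (inferInstanceAs (IsIso (F.map f)))
    fib_comp := inferInstance
    isomorphisms_le_fib := fun _ _ f (_ : IsIso f) ↦
      SpSe.isomorphisms_le_fib r _ (inferInstanceAs (IsIso (F.map f)))
    hasPullback := fun g p hp ↦ hpb g p (SpSe.pagewiseSurjective_of_acyclic r _ hp)
    isPullback := fun sq hp ↦ SpSe.acyclic_of_isPullback r
      (hpb' sq (SpSe.pagewiseSurjective_of_acyclic r _ hp)) hp
    factorization := fun {X Y} u ↦ by
      obtain ⟨P, q, h, h'⟩ := exists_path_object F r hdisc Y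
      have hs : SpSe.pagewiseSurjective (F.map (biprod.fst : X ⊞ P ⟶ X)) := fun k hk i x ↦ by
        refine ⟨(((F.map biprod.inl).hom k hk).f i).hom x, ?_⟩
        have h : F.map biprod.inl ≫ F.map (biprod.fst : X ⊞ P ⟶ X) = 𝟙 _ := by
          rw [← F.map_comp, biprod.inl_fst, F.map_id]
        exact congr((($h).hom k hk |>.f i).hom x)
      -- The summand P makes (u, q) surjective on pages up to r, while the first projection,
      -- retracting the inclusion of X, loses nothing on page r + 1.
      refine ⟨X ⊞ P, biprod.inl, biprod.desc u q, biprod.fst, biprod.inl_desc _ _,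
        fun k hk i ↦ surjective_desc_right F u q _ _ i (h k hk i), biprod.inl_fst,
        (SpSe.weq_iff r _).2 fun i ↦ ⟨?_, hs _ _ i⟩, SpSe.fib_of_pagewiseSurjective r _ hs⟩
      -- The kernel of the projection on page r + 1 is the corresponding page of P, which is zero.
      refine (injective_iff_map_eq_zero _).2 fun z hz ↦ ?_
      rw [map_biprod_total_apply F X P _ _ i z, hz, h' i (ModuleCat.Hom.hom _ _), map_zero,
        map_zero, add_zero]
    fibrant := fun {X e} he f ↦ SpSe.fib_of_pagewiseSurjective r _ fun k hk i x ↦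
      ⟨0, (map_zero _).trans (SpSe.eq_zero_of_isZero
        (F.map_isZero ((isZero_zero C).of_iso (he.uniqueUpToIso HasZeroObject.zeroIsTerminal)))
        k hk i x).symm⟩ }

end InverseImage

theorem SpSe.isAlmostBrown {R : Type u} [CommRing R] (r : ℕ) :
    IsAlmostBrown (SpSe.weq.{v} R r) (SpSe.fib.{v} R r) :=
  isAlmostBrown_inverseImage (𝟭 _) r
    (fun g p hp ↦ (SpectralSequence.isPullback_pullbackSeq g p hp).hasPullback)
    (fun sq _ ↦ sq)
    (fun Y k hk ↦ by
      obtain ⟨P, q, h, h'⟩ := SpSe.exists_disc Y k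
      exact ⟨P, q, h, h' r hk⟩)

end SpecSeqHomotopy

namespace SpecSeqHomotopy

/-! ### The category of multicomplexes -/

namespace Multicomplex

variable {R : Type u} [CommRing R] {n : ℕ∞}

section Preadditive

variable {A B : Multicomplex.{v} R n}

lemma hom_ext {f g : A ⟶ B} (h : ∀ a, f.f a = g.f a) : f = g := Hom.ext (funext h)

instance : Zero (A ⟶ B) where
  zero := { f := fun _ ↦ 0, comm := by simp }

instance : Add (A ⟶ B) where
  add f g :=
    { f := fun a ↦ f.f a + g.f a
      comm := fun i a b ↦ by
        rw [Preadditive.comp_add, Preadditive.add_comp, f.comm, g.comm] }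

instance : Neg (A ⟶ B) where
  neg f :=
    { f := fun a ↦ - f.f a
      comm := fun i a b ↦ by rw [Preadditive.comp_neg, Preadditive.neg_comp, f.comm] }

instance : Preadditive (Multicomplex.{v} R n) where
  homGroup _ _ :=
    { AddGroup.ofLeftAxioms
        (fun _ _ _ ↦ hom_ext fun _ ↦ add_assoc _ _ _)
        (fun _ ↦ hom_ext fun _ ↦ zero_add _)
        (fun _ ↦ hom_ext fun _ ↦ neg_add_cancel _) with
      add_comm := fun _ _ ↦ hom_ext fun _ ↦ add_comm _ _ }
  add_comp _ _ _ _ _ _ := hom_ext fun _ ↦ Preadditive.add_comp _ _ _ _ _ _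
  comp_add _ _ _ _ _ _ := hom_ext fun _ ↦ Preadditive.comp_add _ _ _ _ _ _

instance : HasZeroObject (Multicomplex.{v} R n) where
  zero := by
    let Z : Multicomplex.{v} R n :=
      { X := fun _ ↦ ModuleCat.of R PUnit
        d := fun _ _ _ ↦ 0
        shape := fun _ _ _ _ ↦ rfl
        sum_d_d := fun _ _ ↦ by simp
        d_eq_zero := fun _ _ _ _ ↦ rfl }
    refine ⟨Z, (IsZero.iff_id_eq_zero Z).2 (hom_ext fun a ↦ ModuleCat.hom_ext
      (LinearMap.ext fun x ↦ ?_))⟩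
    exact Subsingleton.elim (α := PUnit) _ _

end Preadditive

/-! ### Pullbacks of multicomplexes -/

section Pullback

variable {A B C : Multicomplex.{v} R n} (g : A ⟶ C) (p : B ⟶ C)

/-- The relation satisfied by the structure maps of a multicomplex is inherited along families of
maps compatible with the structure maps. -/
lemma sum_d_d_comp (A : Multicomplex.{v} R n) {X : ℤ × ℤ → ModuleCat.{v} R}
    (d : ∀ (_ : ℕ) (a b : ℤ × ℤ), X a ⟶ X b) (φ : ∀ a, X a ⟶ A.X a)
    (hφ : ∀ i a b, d i a b ≫ φ b = φ a ≫ A.d i a b) (l : ℕ) (a : ℤ × ℤ) :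
    (∑ ij ∈ Finset.HasAntidiagonal.antidiagonal l, (-1 : ℤ) ^ ij.1 •
      (d ij.2 a (a + (-(ij.2 : ℤ), 1 - (ij.2 : ℤ))) ≫
        d ij.1 (a + (-(ij.2 : ℤ), 1 - (ij.2 : ℤ))) (a + (-(l : ℤ), 2 - (l : ℤ))))) ≫ φ _ = 0 := by
  rw [Preadditive.sum_comp, ← comp_zero (f := φ a), ← A.sum_d_d l a, Preadditive.comp_sum]
  refine Finset.sum_congr rfl fun ij _ ↦ ?_
  rw [Preadditive.zsmul_comp, Preadditive.comp_zsmul, Category.assoc, hφ, ← Category.assoc, hφ,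
    Category.assoc]

/-- The modules of the pullback of multicomplexes. -/
def pullbackX (a : ℤ × ℤ) : Submodule R (A.X a × B.X a) :=
  LinearMap.eqLocus ((g.f a).hom ∘ₗ LinearMap.fst R _ _) ((p.f a).hom ∘ₗ LinearMap.snd R _ _)

lemma mem_pullbackX {a : ℤ × ℤ} {z : A.X a × B.X a} :
    z ∈ pullbackX g p a ↔ (g.f a).hom z.1 = (p.f a).hom z.2 := Iff.rfl

lemma map_d_apply (f : A ⟶ B) (i : ℕ) (a b : ℤ × ℤ) (x : A.X a) :
    (f.f b).hom ((A.d i a b).hom x) = (B.d i a b).hom ((f.f a).hom x) :=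
  congr(($(f.comm i a b)).hom x)

/-- The structure maps of the pullback of multicomplexes. -/
def pullbackD (i : ℕ) (a b : ℤ × ℤ) :
    ModuleCat.of R (pullbackX g p a) ⟶ ModuleCat.of R (pullbackX g p b) :=
  ModuleCat.ofHom (((A.d i a b).hom.prodMap (B.d i a b).hom).restrict fun z hz ↦ by
    rw [mem_pullbackX] at hz ⊢
    refine (map_d_apply g i a b z.1).trans ?_ |>.trans (map_d_apply p i a b z.2).symm
    rw [hz])

/-- The first projection. -/
def pullbackXFst (a : ℤ × ℤ) : ModuleCat.of R (pullbackX g p a) ⟶ A.X a :=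
  ModuleCat.ofHom (LinearMap.fst R _ _ ∘ₗ (pullbackX g p a).subtype)

/-- The second projection. -/
def pullbackXSnd (a : ℤ × ℤ) : ModuleCat.of R (pullbackX g p a) ⟶ B.X a :=
  ModuleCat.ofHom (LinearMap.snd R _ _ ∘ₗ (pullbackX g p a).subtype)

lemma pullbackX_hom_ext {M : ModuleCat.{v} R} {a : ℤ × ℤ}
    {f f' : M ⟶ ModuleCat.of R (pullbackX g p a)}
    (h₁ : f ≫ pullbackXFst g p a =
      f' ≫ pullbackXFst g p a)
    (h₂ : f ≫ pullbackXSnd g p a =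
      f' ≫ pullbackXSnd g p a) : f = f' :=
  ModuleCat.hom_ext (LinearMap.ext fun x ↦ Subtype.ext
    (Prod.ext congr(($h₁).hom x) congr(($h₂).hom x)))

/-- The pullback of multicomplexes. -/
def pullbackMulticomplex : Multicomplex.{v} R n where
  X a := ModuleCat.of R (pullbackX g p a)
  d := pullbackD g p
  shape i a b h := pullbackX_hom_ext g p
    (ModuleCat.hom_ext (LinearMap.ext fun z ↦ congr(($(A.shape i a b h)).hom z.1.1)))
    (ModuleCat.hom_ext (LinearMap.ext fun z ↦ congr(($(B.shape i a b h)).hom z.1.2)))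
  sum_d_d l a := pullbackX_hom_ext g p
    ((A.sum_d_d_comp _ (pullbackXFst g p)
      (fun _ _ _ ↦ rfl) l a).trans zero_comp.symm)
    ((B.sum_d_d_comp _ (pullbackXSnd g p)
      (fun _ _ _ ↦ rfl) l a).trans zero_comp.symm)
  d_eq_zero i a b h := pullbackX_hom_ext g p
    (ModuleCat.hom_ext (LinearMap.ext fun z ↦ congr(($(A.d_eq_zero i a b h)).hom z.1.1)))
    (ModuleCat.hom_ext (LinearMap.ext fun z ↦ congr(($(B.d_eq_zero i a b h)).hom z.1.2)))

/-- The first projection. -/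
def pullbackFst : pullbackMulticomplex g p ⟶ A where
  f a := pullbackXFst g p a
  comm _ _ _ := rfl

/-- The second projection. -/
def pullbackSnd : pullbackMulticomplex g p ⟶ B where
  f a := pullbackXSnd g p a
  comm _ _ _ := rfl

variable {g p} in
/-- The universal property of the pullback. -/
def pullbackLift {T : Multicomplex.{v} R n} (s : T ⟶ A) (t : T ⟶ B) (h : s ≫ g = t ≫ p) :
    T ⟶ pullbackMulticomplex g p where
  f a := ModuleCat.ofHom (LinearMap.codRestrict _ (LinearMap.prod (s.f a).hom (t.f a).hom)
    fun x ↦ congr((Hom.f $h a).hom x))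
  comm i a b := pullbackX_hom_ext g p (s.comm i a b) (t.comm i a b)

lemma isPullback_pullbackMulticomplex : IsPullback (pullbackFst g p) (pullbackSnd g p) g p where
  w := hom_ext fun _ ↦ ModuleCat.hom_ext (LinearMap.ext fun x ↦ x.2)
  isLimit' := ⟨PullbackCone.IsLimit.mk _ (fun s ↦ pullbackLift s.fst s.snd s.condition)
    (fun _ ↦ rfl) (fun _ ↦ rfl) (fun _ _ h₁ h₂ ↦ hom_ext fun a ↦
      pullbackX_hom_ext g p congr(Hom.f $h₁ a) congr(Hom.f $h₂ a))⟩

end Pullback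

/-! ### The page `0` of the spectral sequence of a multicomplex -/

section PageZero

variable (A : Multicomplex.{v} R n)

/-- The component in column `p` of an element of `Z_0^{p, q}`. -/
def zeroComponent (i : ℤ × ℤ) :
    A.tot.Z 0 i.1 (i.2 - i.1) →ₗ[R] A.X (i.1, i.2 - i.1 + i.1) where
  toFun a := a.1.1 i.1
  map_add' _ _ := rfl
  map_smul' _ _ := rfl

/-- The map from the page `0` of the spectral sequence of a multicomplex to the multicomplex. -/
noncomputable def pageZeroMap (i : ℤ × ℤ) :
    A.tot.E 0 i →ₗ[R] A.X (i.1, i.2 - i.1 + i.1) :=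
  Submodule.liftQ _ (A.zeroComponent i) fun a ha ↦ by
    have ha' : a.1 ∈ A.tot.B 0 i.1 (i.2 - i.1) := ha
    rw [FilteredComplex.B, if_pos rfl] at ha'
    exact ha'.1 i.1 (by lia)

/-- An element of F_p with zero component in column p lies in F_{p-1}; the condition on its
differential in `B` is automatic, as d preserves the filtration. -/
lemma pageZeroMap_injective (i : ℤ × ℤ) : Function.Injective (A.pageZeroMap i) := by
  refine (injective_iff_map_eq_zero _).2 fun z hz ↦ ?_
  obtain ⟨a, rfl⟩ := Submodule.mkQ_surjective _ z
  have hF : a.1 ∈ A.tot.F (i.1 - 1) (i.2 - i.1) := fun q hq ↦ by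
    rcases (show i.1 ≤ q by lia).eq_or_lt with rfl | h
    · exact hz
    · exact a.2.1 q h
  refine (A.tot.cls_eq_zero_iff 0 i a).2 ?_
  rw [FilteredComplex.B, if_pos rfl]
  exact ⟨hF, A.tot.F_le (by lia) _ (A.tot.F_d _ _ _ hF)⟩

lemma pageZeroMap_surjective (i : ℤ × ℤ) : Function.Surjective (A.pageZeroMap i) := by
  classical
  intro x
  let a : A.totX (i.2 - i.1) := ⟨Pi.single i.1 x, i.1, fun p hp ↦ Pi.single_eq_of_ne hp.ne' _⟩
  have ha : a ∈ A.tot.F i.1 (i.2 - i.1) := fun q hq ↦ Pi.single_eq_of_ne hq.ne' _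
  exact ⟨A.tot.cls 0 i ⟨a, ha, A.tot.F_le (by lia) _ (A.tot.F_d _ _ _ ha)⟩,
    Pi.single_eq_same (M := fun p ↦ A.X (p, i.2 - i.1 + p)) i.1 x⟩

variable {A} in
lemma pageZeroMap_naturality {B : Multicomplex.{v} R n} (f : A ⟶ B) (i : ℤ × ℤ)
    (z : A.tot.E 0 i) :
    B.pageZeroMap i (FilteredComplex.mapE (totMap f) 0 i z) =
      (f.f (i.1, i.2 - i.1 + i.1)).hom (A.pageZeroMap i z) := by
  obtain ⟨a, rfl⟩ := Submodule.mkQ_surjective _ z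
  rfl

end PageZero

/-! ### Exactness properties of the spectral sequence functor -/

instance : (spectralSequenceFunctor.{v} R n).Additive where
  map_add {A _ _ _} := SpectralSequence.hom_ext fun _ _ ↦ HomologicalComplex.hom_ext _ _ fun _ ↦
    FilteredComplex.clsHom_hom_ext A.tot rfl

section

variable {A B C : Multicomplex.{v} R n}

/-- Surjectivity makes the pagewise pullback a spectral sequence. The comparison map to it only has
to be bijective on page 0, where both sides are the bidegreewise pullback of modules via
`pageZeroMap`. -/
lemma map_isPullback_pullbackMulticomplex (g : A ⟶ C) (p : B ⟶ C)
    (hp : SpSe.pagewiseSurjective ((spectralSequenceFunctor R n).map p)) :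
    IsPullback ((spectralSequenceFunctor R n).map (pullbackFst g p))
      ((spectralSequenceFunctor R n).map (pullbackSnd g p))
      ((spectralSequenceFunctor R n).map g) ((spectralSequenceFunctor R n).map p) := by
  let F := spectralSequenceFunctor.{v} R n
  have hw : F.map (pullbackFst g p) ≫ F.map g = F.map (pullbackSnd g p) ≫ F.map p := by
    rw [← F.map_comp, ← F.map_comp, (isPullback_pullbackMulticomplex g p).w]
  let l := SpectralSequence.pullbackLift hp _ _ hw
  have hl : IsIso l := by
    refine SpectralSequence.isIso_of_bijective l fun i ↦ ⟨?_, ?_⟩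
    · refine (injective_iff_map_eq_zero _).2 fun z hz ↦ ?_
      change (pullbackMulticomplex g p).tot.E 0 i at z
      have h₁ : FilteredComplex.mapE (totMap (pullbackFst g p)) 0 i z = 0 :=
        congrArg (fun w : SpecSeqHomotopy.pullbackX _ _ _ ↦ w.1.1) hz
      have h₂ : FilteredComplex.mapE (totMap (pullbackSnd g p)) 0 i z = 0 :=
        congrArg (fun w : SpecSeqHomotopy.pullbackX _ _ _ ↦ w.1.2) hz
      refine pageZeroMap_injective _ i (Eq.trans (b := 0) ?_ (map_zero _).symm)
      refine (Subtype.ext (Prod.ext ?_ ?_))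
      · refine (pageZeroMap_naturality (pullbackFst g p) i z).symm.trans ?_
        rw [h₁, map_zero]
        rfl
      · refine (pageZeroMap_naturality (pullbackSnd g p) i z).symm.trans ?_
        rw [h₂, map_zero]
        rfl
    · rintro ⟨⟨x, y⟩, hxy⟩
      change A.tot.E 0 i at x
      change B.tot.E 0 i at y
      have h : (A.pageZeroMap i x, B.pageZeroMap i y) ∈ pullbackX g p _ := by
        rw [mem_pullbackX, ← pageZeroMap_naturality, ← pageZeroMap_naturality]
        exact congrArg _ hxy
      obtain ⟨z, hz⟩ := pageZeroMap_surjective (pullbackMulticomplex g p) i ⟨_, h⟩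
      refine ⟨z, Subtype.ext (Prod.ext ?_ ?_)⟩
      · refine A.pageZeroMap_injective i ?_
        refine (pageZeroMap_naturality (pullbackFst g p) i z).trans ?_
        rw [hz]
        rfl
      · refine B.pageZeroMap_injective i ?_
        refine (pageZeroMap_naturality (pullbackSnd g p) i z).trans ?_
        rw [hz]
        rfl
  exact IsPullback.of_iso (SpectralSequence.isPullback_pullbackSeq _ _ hp) (asIso l).symm
    (Iso.refl _) (Iso.refl _) (Iso.refl _) (by
      rw [Iso.symm_hom, asIso_inv, Iso.refl_hom, Category.comp_id, IsIso.eq_inv_comp]; rfl) (by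
      rw [Iso.symm_hom, asIso_inv, Iso.refl_hom, Category.comp_id, IsIso.eq_inv_comp]; rfl)
    (by simp [F]) (by simp)

lemma map_isPullback {P : Multicomplex.{v} R n} {fst : P ⟶ A} {snd : P ⟶ B} {g : A ⟶ C}
    {p : B ⟶ C}
    (sq : IsPullback fst snd g p)
    (hp : SpSe.pagewiseSurjective ((spectralSequenceFunctor R n).map p)) :
    IsPullback ((spectralSequenceFunctor R n).map fst) ((spectralSequenceFunctor R n).map snd)
      ((spectralSequenceFunctor R n).map g) ((spectralSequenceFunctor R n).map p) := by
  let F := spectralSequenceFunctor.{v} R n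
  refine IsPullback.of_iso (map_isPullback_pullbackMulticomplex g p hp)
    (F.mapIso (sq.isoIsPullback _ _ (isPullback_pullbackMulticomplex g p))).symm
    (Iso.refl _) (Iso.refl _) (Iso.refl _) ?_ ?_ (by simp) (by simp)
  · simp only [Iso.symm_hom, Functor.mapIso_inv, Iso.refl_hom, Category.comp_id]
    rw [← F.map_comp, IsPullback.isoIsPullback_inv_fst]
  · simp only [Iso.symm_hom, Functor.mapIso_inv, Iso.refl_hom, Category.comp_id]
    rw [← F.map_comp, IsPullback.isoIsPullback_inv_snd]

end

end Multicomplex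

end SpecSeqHomotopy

namespace SpecSeqHomotopy

/-! ### Staircases with values in a multicomplex -/

namespace Multicomplex

variable {R : Type u} [CommRing R] {n : ℕ∞} (B : Multicomplex.{v} R n)

/-- The identification of two components of a multicomplex with the same bidegree (and zero if the
bidegrees are distinct). -/
noncomputable def castX (c c' : ℤ × ℤ) : B.X c →ₗ[R] B.X c' :=
  if h : c = c' then (eqToHom (congrArg B.X h)).hom else 0

lemma castX_self (c : ℤ × ℤ) (x : B.X c) : B.castX c c x = x := by
  simp [castX]

lemma castX_castX {c c' : ℤ × ℤ} (h : c = c') (c'' : ℤ × ℤ) (x : B.X c) :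
    B.castX c' c'' (B.castX c c' x) = B.castX c c'' x := by
  subst h
  rw [castX_self]

lemma castX_eq_zero_of_ne {c c' : ℤ × ℤ} (h : c ≠ c') (x : B.X c) : B.castX c c' x = 0 := by
  simp [castX, h]

lemma eq_zero_of_castX_eq_zero {c c' : ℤ × ℤ} (h : c = c') {x : B.X c}
    (hx : B.castX c c' x = 0) : x = 0 := by
  subst h
  rwa [castX_self] at hx

lemma d_castX {c c' : ℤ × ℤ} (h : c = c') (j : ℕ) (b : ℤ × ℤ) (x : B.X c) :
    (B.d j c' b).hom (B.castX c c' x) = (B.d j c b).hom x := by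
  subst h
  rw [castX_self]

lemma castX_d (j : ℕ) (c : ℤ × ℤ) {b b' : ℤ × ℤ} (h : b = b') (x : B.X c) :
    B.castX b b' ((B.d j c b).hom x) = (B.d j c b').hom x := by
  subst h
  rw [castX_self]

/-- The map `x ↦ x_i` for `j = 0`, and `x ↦ x_{i - 1}` for `j = 1`. -/
noncomputable def stairMap (a b : ℤ × ℤ) : ∀ (_j i : ℕ),
    (∀ i : ℕ, B.X (a + ((i : ℤ), (i : ℤ)))) →ₗ[R] B.X (b + ((i : ℤ), (i : ℤ) - 1))
  | 0, i => B.castX _ _ ∘ₗ LinearMap.proj i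
  | 1, i + 1 => B.castX _ _ ∘ₗ LinearMap.proj i
  | _, _ => 0

section

variable (a b : ℤ × ℤ) (x : ∀ i : ℕ, B.X (a + ((i : ℤ), (i : ℤ))))

lemma stairMap_zero (i : ℕ) : B.stairMap a b 0 i x = B.castX _ _ (x i) := rfl

lemma stairMap_one_zero : B.stairMap a b 1 0 x = 0 := rfl

lemma stairMap_one_succ (i : ℕ) : B.stairMap a b 1 (i + 1) x = B.castX _ _ (x i) := rfl

lemma stairMap_add_two (j i : ℕ) : B.stairMap a b (j + 2) i x = 0 := rfl

/-- This is the reason for `castX` to be zero between distinct bidegrees: it gives the shape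
condition for the structure maps of the staircase. -/
lemma stairMap_eq_zero_of_ne (j i : ℕ) (h : a + (-(j : ℤ), 1 - (j : ℤ)) ≠ b) :
    B.stairMap a b j i x = 0 := by
  match j, i with
  | 0, i =>
    refine B.castX_eq_zero_of_ne (fun h' ↦ h ?_) _
    simp only [Prod.ext_iff, Prod.fst_add, Prod.snd_add] at h' ⊢
    lia
  | 1, 0 => rfl
  | 1, i + 1 =>
    refine B.castX_eq_zero_of_ne (fun h' ↦ h ?_) _
    simp only [Prod.ext_iff, Prod.fst_add, Prod.snd_add] at h' ⊢
    lia
  | j + 2, i => rfl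

end

variable (S T : ℕ → Prop)

/-- The modules of the staircase multicomplex. -/
def stairX (a : ℤ × ℤ) : Submodule R ((∀ i : ℕ, B.X (a + ((i : ℤ), (i : ℤ)))) ×
    (∀ i : ℕ, B.X (a + ((i : ℤ), (i : ℤ) - 1)))) where
  carrier := {z | (∀ i, ¬ S i → z.1 i = 0) ∧ ∀ i, ¬ T i → z.2 i = 0}
  add_mem' {z z'} hz hz' := ⟨fun i hi ↦ by simp [hz.1 i hi, hz'.1 i hi],
    fun i hi ↦ by simp [hz.2 i hi, hz'.2 i hi]⟩
  zero_mem' := ⟨fun _ _ ↦ rfl, fun _ _ ↦ rfl⟩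
  smul_mem' c z hz := ⟨fun i hi ↦ by simp [hz.1 i hi], fun i hi ↦ by simp [hz.2 i hi]⟩

open Classical in
/-- The structure maps of the staircase multicomplex. -/
noncomputable def stairD (j : ℕ) (a b : ℤ × ℤ) :
    ModuleCat.of R (B.stairX S T a) ⟶ ModuleCat.of R (B.stairX S T b) :=
  ModuleCat.ofHom ((LinearMap.prod
    -- The signs (-1)^i on e_i and (-1)^(i+1+j) on f_i make the cross terms from e to f cancel. No
    -- map enters an e_i and none leaves an f_i towards another generator, so any e_i or f_i may be
    -- omitted.
    (LinearMap.pi fun i ↦ ((-1 : ℤ) ^ i • (B.d j _ _).hom) ∘ₗ LinearMap.proj i ∘ₗ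
      LinearMap.fst R _ _)
    (LinearMap.pi fun i ↦ ((-1 : ℤ) ^ (i + 1 + j) • (B.d j _ _).hom) ∘ₗ LinearMap.proj i ∘ₗ
      LinearMap.snd R _ _ + if T i then B.stairMap a b j i ∘ₗ LinearMap.fst R _ _ else 0)).restrict
    fun z hz ↦ ⟨fun i hi ↦ by simp [hz.1 i hi], fun i hi ↦ by simp [hz.2 i hi, hi]⟩)

variable {S T}

lemma stairD_fst (j : ℕ) (a b : ℤ × ℤ) (z : B.stairX S T a) (i : ℕ) :
    ((B.stairD S T j a b).hom z).1.1 i = (-1 : ℤ) ^ i • (B.d j _ _).hom (z.1.1 i) := rfl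

open Classical in
lemma stairD_snd (j : ℕ) (a b : ℤ × ℤ) (z : B.stairX S T a) {i : ℕ} (hi : T i) :
    ((B.stairD S T j a b).hom z).1.2 i =
      (-1 : ℤ) ^ (i + 1 + j) • (B.d j _ _).hom (z.1.2 i) + B.stairMap a b j i z.1.1 := by
  change (-1 : ℤ) ^ (i + 1 + j) • (B.d j _ _).hom (z.1.2 i) +
    (ite (T i) (B.stairMap a b j i ∘ₗ LinearMap.fst R _ _) 0) z.1 = _
  rw [if_pos hi]
  rfl

lemma stairX_ext {a : ℤ × ℤ} {z z' : B.stairX S T a} (h₁ : ∀ i, z.1.1 i = z'.1.1 i)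
    (h₂ : ∀ i, T i → z.1.2 i = z'.1.2 i) : z = z' := by
  refine Subtype.ext (Prod.ext (funext h₁) (funext fun i ↦ ?_))
  by_cases hi : T i
  · exact h₂ i hi
  · rw [z.2.2 i hi, z'.2.2 i hi]

/-- The zigzag has only d_0 and d_1, so at most two terms of each convolution survive. -/
lemma sum_antidiagonal_of_fst {M : Type*} [AddCommMonoid M] (f : ℕ → ℕ → M)
    (hf : ∀ i j, f (i + 2) j = 0) (l : ℕ) :
    ∑ ij ∈ Finset.HasAntidiagonal.antidiagonal (l + 1), f ij.1 ij.2 = f 0 (l + 1) + f 1 l := by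
  rw [Finset.Nat.sum_antidiagonal_succ (f := fun ij ↦ f ij.1 ij.2)]
  congr 1
  cases l with
  | zero => simp
  | succ l =>
    rw [Finset.Nat.sum_antidiagonal_succ (f := fun ij ↦ f (ij.1 + 1) ij.2)]
    simp [hf]

lemma sum_antidiagonal_of_snd {M : Type*} [AddCommMonoid M] (f : ℕ → ℕ → M)
    (hf : ∀ i j, f i (j + 2) = 0) (l : ℕ) :
    ∑ ij ∈ Finset.HasAntidiagonal.antidiagonal (l + 1), f ij.1 ij.2 = f (l + 1) 0 + f l 1 := by
  rw [Finset.Nat.sum_antidiagonal_succ' (f := fun ij ↦ f ij.1 ij.2)]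
  congr 1
  cases l with
  | zero => simp
  | succ l =>
    rw [Finset.Nat.sum_antidiagonal_succ' (f := fun ij ↦ f ij.1 (ij.2 + 1))]
    simp [hf]

lemma d_stairMap_zero {a b : ℤ × ℤ} (h : a + (0, 1) = b) (l k : ℕ) (c : ℤ × ℤ)
    (x : ∀ i : ℕ, B.X (a + ((i : ℤ), (i : ℤ)))) :
    (B.d l _ c).hom (B.stairMap a b 0 k x) = (B.d l _ c).hom (x k) := by
  subst h
  exact B.d_castX (by ext <;> simp) _ _ _

lemma d_stairMap_one {a b : ℤ × ℤ} (h : a + (-1, 0) = b) (l k : ℕ) (c : ℤ × ℤ)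
    (x : ∀ i : ℕ, B.X (a + ((i : ℤ), (i : ℤ)))) :
    (B.d l _ c).hom (B.stairMap a b 1 (k + 1) x) = (B.d l _ c).hom (x k) := by
  subst h
  exact B.d_castX (by ext <;> simp; lia) _ _ _

lemma stairMap_zero_d {b c : ℤ × ℤ} (h : b + (0, 1) = c) (l k : ℕ) (a : ℤ × ℤ)
    (x : ∀ i : ℕ, B.X (a + ((i : ℤ), (i : ℤ)))) :
    B.stairMap b c 0 k (fun i ↦ (-1 : ℤ) ^ i • (B.d l _ _).hom (x i)) =
      (-1 : ℤ) ^ k • (B.d l _ _).hom (x k) := by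
  subst h
  refine (map_zsmul (B.castX _ _) _ _).trans (congrArg _ ?_)
  exact B.castX_d _ _ (by ext <;> simp) _

lemma stairMap_one_d {b c : ℤ × ℤ} (h : b + (-1, 0) = c) (l k : ℕ) (a : ℤ × ℤ)
    (x : ∀ i : ℕ, B.X (a + ((i : ℤ), (i : ℤ)))) :
    B.stairMap b c 1 (k + 1) (fun i ↦ (-1 : ℤ) ^ i • (B.d l _ _).hom (x i)) =
      (-1 : ℤ) ^ k • (B.d l _ _).hom (x k) := by
  subst h
  refine (map_zsmul (B.castX _ _) _ _).trans (congrArg _ ?_)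
  exact B.castX_d _ _ (by ext <;> simp; lia) _

/-- The f_k component receives x_k through d_0 and x_{k-1} through d_1, each once before and once
after a structure map of B. The two occurrences of d_l x_k have opposite signs, and so have those of
d_{l-1} x_{k-1}. -/
lemma sum_stairMap (l k : ℕ) (a c : ℤ × ℤ) (hc : a + (-(l : ℤ), 2 - (l : ℤ)) = c)
    (x : ∀ i : ℕ, B.X (a + ((i : ℤ), (i : ℤ)))) :
    ∑ ij ∈ Finset.HasAntidiagonal.antidiagonal l, (-1 : ℤ) ^ ij.1 •
      ((-1 : ℤ) ^ (k + 1 + ij.1) • (B.d ij.1 _ (c + ((k : ℤ), (k : ℤ) - 1))).hom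
          (B.stairMap a (a + (-(ij.2 : ℤ), 1 - (ij.2 : ℤ))) ij.2 k x) +
        B.stairMap (a + (-(ij.2 : ℤ), 1 - (ij.2 : ℤ))) c ij.1 k
          (fun i ↦ (-1 : ℤ) ^ i • (B.d ij.2 _ _).hom (x i))) = 0 := by
  subst hc
  simp only [smul_add, Finset.sum_add_distrib, smul_smul]
  cases l with
  | zero =>
    simp only [Finset.Nat.antidiagonal_zero, Finset.sum_singleton]
    rw [d_stairMap_zero B (by ext <;> simp), stairMap_zero_d B (by ext <;> simp; lia),
      smul_smul, ← add_smul, show (-1 : ℤ) ^ 0 * (-1) ^ (k + 1 + 0) + (-1) ^ 0 * (-1) ^ k = 0 by ring,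
      zero_smul]
  | succ l =>
    rw [sum_antidiagonal_of_snd (fun i j ↦ ((-1 : ℤ) ^ i * (-1 : ℤ) ^ (k + 1 + i)) •
        (B.d i _ (_ + ((k : ℤ), (k : ℤ) - 1))).hom
          (B.stairMap a (a + (-(j : ℤ), 1 - (j : ℤ))) j k x))
        (fun i j ↦ by rw [stairMap_add_two, map_zero, smul_zero]),
      sum_antidiagonal_of_fst (fun i j ↦ (-1 : ℤ) ^ i •
        B.stairMap (a + (-(j : ℤ), 1 - (j : ℤ))) _ i k
          (fun i ↦ (-1 : ℤ) ^ i • (B.d j _ _).hom (x i)))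
        (fun i j ↦ by rw [stairMap_add_two, smul_zero]),
      d_stairMap_zero B (by ext <;> simp), stairMap_zero_d B (by ext <;> simp; lia)]
    cases k with
    | zero =>
      rw [stairMap_one_zero, stairMap_one_zero, map_zero, smul_zero, smul_zero, add_zero, add_zero,
        smul_smul, ← add_smul, show (-1 : ℤ) ^ (l + 1) * (-1) ^ (0 + 1 + (l + 1)) +
          (-1) ^ 0 * (-1) ^ 0 = 0 by ring_nf; simp, zero_smul]
    | succ k =>
      rw [d_stairMap_one B (by ext <;> simp), stairMap_one_d B (by ext <;> simp <;> lia),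
        smul_smul, smul_smul, add_add_add_comm, ← add_smul, ← add_smul,
        show (-1 : ℤ) ^ (l + 1) * (-1) ^ (k + 1 + 1 + (l + 1)) + (-1) ^ 0 * (-1) ^ (k + 1) = 0 by
          ring_nf; simp,
        show (-1 : ℤ) ^ l * (-1) ^ (k + 1 + 1 + l) + (-1) ^ 1 * (-1) ^ k = 0 by
          ring_nf; simp, zero_smul, zero_smul, add_zero]

end Multicomplex

end SpecSeqHomotopy

/-! ### The staircase multicomplex and its totalization. -/

namespace SpecSeqHomotopy
namespace Multicomplex

variable {R : Type u} [CommRing R] {n : ℕ∞} (B : Multicomplex.{v} R n)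

lemma sum_d_d_elem (l : ℕ) (a c : ℤ × ℤ) (hc : a + (-(l : ℤ), 2 - (l : ℤ)) = c) (b : ℕ → ℤ × ℤ)
    (hb : ∀ j : ℕ, a + (-(j : ℤ), 1 - (j : ℤ)) = b j) (x : B.X a) :
    ∑ ij ∈ Finset.HasAntidiagonal.antidiagonal l, (-1 : ℤ) ^ ij.1 •
      (B.d ij.1 (b ij.2) c).hom ((B.d ij.2 a (b ij.2)).hom x) = 0 := by
  have h := congr(($(B.sum_d_d' l a c hc b hb)).hom x)
  rw [ModuleCat.hom_sum, LinearMap.sum_apply] at h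
  exact h

variable (S T : ℕ → Prop)

/-- The tensor product of a multicomplex with the bicomplex with generators `e_i` for `i ∈ S` and
`f_i` for `i ∈ T`, in bidegrees `(-i, -i)` and `(-i, 1 - i)`, and with
`d_0 e_i = f_i` and `d_1 e_i = f_{i + 1}`. -/
noncomputable def staircase (hn : 2 ≤ n) : Multicomplex.{v} R n where
  X a := ModuleCat.of R (B.stairX S T a)
  d := B.stairD S T
  shape j a b h := by
    refine ModuleCat.hom_ext (LinearMap.ext fun z ↦ B.stairX_ext (fun i ↦ ?_) (fun i hi ↦ ?_))
    · rw [stairD_fst, B.shape _ _ _ fun h' ↦ h ?_]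
      · exact smul_zero _
      · simp only [Prod.ext_iff, Prod.fst_add, Prod.snd_add] at h' ⊢
        lia
    · rw [stairD_snd _ _ _ _ _ hi, B.shape _ _ _ fun h' ↦ h ?_,
        B.stairMap_eq_zero_of_ne _ _ _ _ _ h, add_zero]
      · exact smul_zero _
      · simp only [Prod.ext_iff, Prod.fst_add, Prod.snd_add] at h' ⊢
        lia
  sum_d_d l a := by
    refine ModuleCat.hom_ext (LinearMap.ext fun z ↦ ?_)
    rw [ModuleCat.hom_sum, LinearMap.sum_apply]
    refine B.stairX_ext (fun k ↦ ?_) (fun k hk ↦ ?_)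
    · let π : B.stairX S T (a + (-(l : ℤ), 2 - (l : ℤ))) →ₗ[R] B.X _ :=
        LinearMap.proj k ∘ₗ LinearMap.fst R _ _ ∘ₗ Submodule.subtype _
      refine (map_sum π _ _).trans ?_
      refine Eq.trans (Finset.sum_congr rfl fun ij _ ↦ ?_) (B.sum_d_d_elem l
        (a + ((k : ℤ), (k : ℤ)))
        (a + (-(l : ℤ), 2 - (l : ℤ)) + ((k : ℤ), (k : ℤ))) (by ext <;> simp <;> lia)
        (fun j ↦ a + (-(j : ℤ), 1 - (j : ℤ)) + ((k : ℤ), (k : ℤ)))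
        (fun j ↦ by ext <;> simp <;> lia) (z.1.1 k))
      refine (map_zsmul π _ _).trans (congrArg _ ?_)
      change (-1 : ℤ) ^ k • (B.d ij.1 _ _).hom ((-1 : ℤ) ^ k • (B.d ij.2 _ _).hom (z.1.1 k)) = _
      rw [map_zsmul, smul_smul, ← mul_pow, neg_one_mul, neg_neg, one_pow, one_smul]
    · let π : B.stairX S T (a + (-(l : ℤ), 2 - (l : ℤ))) →ₗ[R] B.X _ :=
        LinearMap.proj k ∘ₗ LinearMap.snd R _ _ ∘ₗ Submodule.subtype _
      refine (map_sum π _ _).trans ?_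
      have h₁ := B.sum_d_d_elem l (a + ((k : ℤ), (k : ℤ) - 1))
        (a + (-(l : ℤ), 2 - (l : ℤ)) + ((k : ℤ), (k : ℤ) - 1)) (by ext <;> simp <;> lia)
        (fun j ↦ a + (-(j : ℤ), 1 - (j : ℤ)) + ((k : ℤ), (k : ℤ) - 1))
        (fun j ↦ by ext <;> simp <;> lia) (z.1.2 k)
      -- The f_k component is the relation of B on the f_k coefficient, up to (-1)^l since
      -- (-1)^(k+1+i) (-1)^(k+1+j) = (-1)^l, plus the cross terms of `sum_stairMap`.
      have h₂ := B.sum_stairMap l k a _ rfl z.1.1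
      have h := congr((-1 : ℤ) ^ l • $h₁ + $h₂)
      rw [smul_zero, add_zero, Finset.smul_sum, ← Finset.sum_add_distrib] at h
      refine Eq.trans (Finset.sum_congr rfl fun ij hij ↦ ?_) h
      refine (map_zsmul π _ _).trans ?_
      rw [smul_comm, ← smul_add]
      refine congrArg _ ?_
      refine (B.stairD_snd _ _ _ _ hk).trans ?_
      have h₃ := congrArg (fun y ↦ (-1 : ℤ) ^ (k + 1 + ij.1) •
        (B.d ij.1 (a + (-(ij.2 : ℤ), 1 - (ij.2 : ℤ)) + ((k : ℤ), (k : ℤ) - 1))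
          (a + (-(l : ℤ), 2 - (l : ℤ)) + ((k : ℤ), (k : ℤ) - 1))).hom y)
        (B.stairD_snd ij.2 a (a + (-(ij.2 : ℤ), 1 - (ij.2 : ℤ))) z hk)
      refine (congrArg (· + _) h₃).trans ?_
      simp only []
      rw [map_add, map_zsmul, smul_add, smul_smul]
      refine (add_assoc _ _ _).trans ?_
      refine congrArg₂ (· + ·) (congrArg (· • _) ?_) rfl
      rw [← Finset.HasAntidiagonal.mem_antidiagonal.1 hij]
      ring_nf
      simp
  d_eq_zero j a b h := by
    -- The zigzag contributes to d_0 and d_1 only, and n ≥ 2 leaves room for both.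
    obtain ⟨j, rfl⟩ : ∃ j', j = j' + 2 := ⟨j - 2, by
      have : (2 : ℕ∞) ≤ j := hn.trans h
      have : 2 ≤ j := by exact_mod_cast this
      lia⟩
    refine ModuleCat.hom_ext (LinearMap.ext fun z ↦ B.stairX_ext (fun i ↦ ?_) (fun i hi ↦ ?_))
    · rw [stairD_fst, B.d_eq_zero _ _ _ h]
      exact smul_zero _
    · rw [stairD_snd _ _ _ _ _ hi, B.d_eq_zero _ _ _ h, stairMap_add_two, add_zero]
      exact smul_zero _

variable (hn : 2 ≤ n)

/-- The projection of a staircase on the component of `e_0`. -/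
noncomputable def staircaseπ : B.staircase S T hn ⟶ B where
  f a := ModuleCat.ofHom (B.castX (a + (((0 : ℕ) : ℤ), ((0 : ℕ) : ℤ))) a ∘ₗ LinearMap.proj 0 ∘ₗ
    LinearMap.fst R _ _ ∘ₗ (B.stairX S T a).subtype)
  comm j a b := by
    refine ModuleCat.hom_ext (LinearMap.ext fun z ↦ ?_)
    change B.castX _ b (((B.stairD S T j a b).hom z).1.1 0) =
      (B.d j a b).hom (B.castX _ a (z.1.1 0))
    change B.castX _ b ((-1 : ℤ) ^ 0 • (B.d j _ _).hom (z.1.1 0)) = _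
    rw [pow_zero, one_smul, B.castX_d _ _ (by simp), B.d_castX (by simp)]


section

variable {S T hn}

/-- The component of `e_i` in column `p` of an element of the total complex of a staircase. -/
def stairFst {m : ℤ} (z : (B.staircase S T hn).totX m) (p : ℤ) (i : ℕ) :
    B.X ((p, m + p) + ((i : ℤ), (i : ℤ))) :=
  (z.1 p : B.stairX S T (p, m + p)).1.1 i

/-- The component of `f_i` in column `p` of an element of the total complex of a staircase. -/
def stairSnd {m : ℤ} (z : (B.staircase S T hn).totX m) (p : ℤ) (i : ℕ) :
    B.X ((p, m + p) + ((i : ℤ), (i : ℤ) - 1)) :=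
  (z.1 p : B.stairX S T (p, m + p)).1.2 i

variable {B}

lemma stairFst_of_eq_zero {m : ℤ} {z : (B.staircase S T hn).totX m} {p : ℤ} (h : z.1 p = 0)
    (i : ℕ) : B.stairFst z p i = 0 :=
  congrArg (fun w : B.stairX S T (p, m + p) ↦ w.1.1 i) h

lemma stairSnd_of_eq_zero {m : ℤ} {z : (B.staircase S T hn).totX m} {p : ℤ} (h : z.1 p = 0)
    (i : ℕ) : B.stairSnd z p i = 0 :=
  congrArg (fun w : B.stairX S T (p, m + p) ↦ w.1.2 i) h

lemma d_stairFst_congr {m p p' : ℤ} (h : p = p') (z : (B.staircase S T hn).totX m) (i k : ℕ)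
    (b : ℤ × ℤ) : (B.d k _ b).hom (B.stairFst z p i) = (B.d k _ b).hom (B.stairFst z p' i) := by
  subst h
  rfl

lemma castX_stairFst_congr {m p p' : ℤ} (h : p = p') (z : (B.staircase S T hn).totX m) (i : ℕ)
    (b : ℤ × ℤ) : B.castX _ b (B.stairFst z p i) = B.castX _ b (B.stairFst z p' i) := by
  subst h
  rfl

/-- The coefficient of `e_i`, as an element of the total complex of the given multicomplex. -/
noncomputable def totFst (m : ℤ) (i : ℕ) : (B.staircase S T hn).totX m →ₗ[R] B.totX m where
  toFun z := ⟨fun q ↦ B.castX _ _ (B.stairFst z (q - i) i), by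
    obtain ⟨N, hN⟩ := z.2
    exact ⟨N + i, fun q hq ↦
      (congrArg _ (stairFst_of_eq_zero (hN _ (by lia)) _)).trans (map_zero _)⟩⟩
  map_add' z z' := Subtype.ext (funext fun q ↦ map_add (B.castX _ _) _ _)
  map_smul' c z := Subtype.ext (funext fun q ↦ map_smul (B.castX _ _) _ _)

/-- The coefficient of `f_i`, as an element of the total complex of the given multicomplex. -/
noncomputable def totSnd (m m' : ℤ) (i : ℕ) :
    (B.staircase S T hn).totX m' →ₗ[R] B.totX m where
  toFun z := ⟨fun q ↦ B.castX _ _ (B.stairSnd z (q - i) i), by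
    obtain ⟨N, hN⟩ := z.2
    exact ⟨N + i, fun q hq ↦
      (congrArg _ (stairSnd_of_eq_zero (hN _ (by lia)) _)).trans (map_zero _)⟩⟩
  map_add' z z' := Subtype.ext (funext fun q ↦ map_add (B.castX _ _) _ _)
  map_smul' c z := Subtype.ext (funext fun q ↦ map_smul (B.castX _ _) _ _)

lemma totFst_apply {m : ℤ} (i : ℕ) (z : (B.staircase S T hn).totX m) (q : ℤ) :
    (totFst m i z).1 q = B.castX _ _ (B.stairFst z (q - i) i) := rfl

lemma totSnd_apply {m m' : ℤ} (i : ℕ) (z : (B.staircase S T hn).totX m') (q : ℤ) :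
    (totSnd m m' i z).1 q = B.castX _ _ (B.stairSnd z (q - i) i) := rfl

lemma totFst_eq_zero {m : ℤ} {i : ℕ} (hi : ¬ S i) (z : (B.staircase S T hn).totX m) :
    totFst m i z = 0 :=
  Subtype.ext (funext fun q ↦ (congrArg (B.castX _ _)
    ((z.1 (q - i) : B.stairX S T (q - i, m + (q - i))).2.1 i hi)).trans (map_zero _))

lemma totSnd_eq_zero {m m' : ℤ} {i : ℕ} (hi : ¬ T i) (z : (B.staircase S T hn).totX m') :
    totSnd m m' i z = 0 :=
  Subtype.ext (funext fun q ↦ (congrArg (B.castX _ _)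
    ((z.1 (q - i) : B.stairX S T (q - i, m' + (q - i))).2.2 i hi)).trans (map_zero _))

lemma stairFst_eq_zero_of_totFst {m p : ℤ} {i : ℕ} {z : (B.staircase S T hn).totX m}
    (h : (totFst m i z).1 (p + i) = 0) : B.stairFst z p i = 0 := by
  rw [totFst_apply, castX_stairFst_congr (p' := p) (by lia)] at h
  exact B.eq_zero_of_castX_eq_zero (by ext <;> simp; ring) h

lemma stairSnd_eq_zero_of_totSnd {m m' : ℤ} (hm : m + 1 = m') {p : ℤ} {i : ℕ}
    {z : (B.staircase S T hn).totX m'} (h : (totSnd m m' i z).1 (p + i) = 0) :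
    B.stairSnd z p i = 0 := by
  have h' : ∀ p' : ℤ, p' = p → B.castX _ (p + i, m + (p + i)) (B.stairSnd z p' i) = 0 →
      B.stairSnd z p i = 0 := by
    rintro _ rfl h
    exact B.eq_zero_of_castX_eq_zero (by ext <;> simp; lia) h
  exact h' (p + i - i) (by lia) h

/-- The generators e_i and f_i sit in column -i, so column p of the staircase carries column p + i
of B. As f_i has total degree 1, its coefficient has degree one less than z. -/
lemma mem_staircase_totF {m m' p : ℤ} (hm : m + 1 = m') (z : (B.staircase S T hn).totX m') :
    z ∈ (B.staircase S T hn).totF p m' ↔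
      (∀ i : ℕ, totFst m' i z ∈ B.totF (p + i) m') ∧
        ∀ i : ℕ, T i → totSnd m m' i z ∈ B.totF (p + i) m := by
  refine ⟨fun h ↦ ⟨fun i q hq ↦ ?_, fun i _ q hq ↦ ?_⟩, fun h q hq ↦ ?_⟩
  · rw [totFst_apply, stairFst_of_eq_zero (h _ (by lia)), map_zero]
  · rw [totSnd_apply, stairSnd_of_eq_zero (h _ (by lia)), map_zero]
  · exact B.stairX_ext (z' := 0)
      (fun i ↦ stairFst_eq_zero_of_totFst (h.1 i _ (by lia)))
      (fun i hi ↦ stairSnd_eq_zero_of_totSnd hm (h.2 i hi _ (by lia)))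

/-- No generator is mapped to e_i, so its coefficient only feels the differential of B. -/
lemma totFst_totD (m m' : ℤ) (i : ℕ) (z : (B.staircase S T hn).totX m) :
    totFst m' i ((B.staircase S T hn).totD m m' z) =
      B.totD m m' ((-1 : ℤ) ^ i • totFst m i z) := by
  refine Subtype.ext (funext fun q ↦ ?_)
  let π : B.stairX S T (q - i, m' + (q - i)) →ₗ[R] B.X (q, m' + q) :=
    B.castX _ _ ∘ₗ LinearMap.proj i ∘ₗ LinearMap.fst R _ _ ∘ₗ Submodule.subtype _
  refine (map_finsum π ((B.staircase S T hn).finite_support_totTerm m m' (q - i) z)).trans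
    (finsum_congr fun k ↦ ?_)
  rw [totTerm, totTerm, Units.smul_def, Units.smul_def]
  refine (map_zsmul π _ _).trans (congrArg _ ?_)
  refine (map_zsmul (B.castX _ _) _ _).trans ?_
  refine Eq.trans (congrArg _ ?_) (map_zsmul (B.d k _ _).hom _ _).symm
  refine (B.castX_d _ _ (by ext <;> simp; ring) _).trans ?_
  refine Eq.trans ?_ (B.d_castX (by ext <;> simp; ring) _ _ _).symm
  exact d_stairFst_congr (by lia) z i k _

/-- Without f-coefficients only the d_0 and d_1 of the zigzag contribute, and the totalization sign
(-1)^(km) is 1 for k = 0 and (-1)^m for k = 1. -/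
lemma stairSnd_totD {m m' : ℤ} {z : (B.staircase S T hn).totX m}
    (hz : ∀ p i, T i → B.stairSnd z p i = 0) (p : ℤ) {i : ℕ} (hi : T i) :
    B.stairSnd ((B.staircase S T hn).totD m m' z) p i =
      B.stairMap (p + (0 : ℕ), m + (p + (0 : ℕ))) (p, m' + p) 0 i (B.stairFst z (p + (0 : ℕ))) +
      m.negOnePow • B.stairMap (p + (1 : ℕ), m + (p + (1 : ℕ))) (p, m' + p) 1 i
        (B.stairFst z (p + (1 : ℕ))) := by
  let π : B.stairX S T (p, m' + p) →ₗ[R] B.X _ :=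
    LinearMap.proj i ∘ₗ LinearMap.snd R _ _ ∘ₗ Submodule.subtype _
  refine (map_finsum π ((B.staircase S T hn).finite_support_totTerm m m' p z)).trans ?_
  have h : ∀ k : ℕ, π ((B.staircase S T hn).totTerm m m' p k z) = ((k : ℤ) * m).negOnePow •
      B.stairMap (p + k, m + (p + k)) (p, m' + p) k i (B.stairFst z (p + k)) := fun k ↦ by
    rw [totTerm, Units.smul_def, Units.smul_def]
    refine (map_zsmul π _ _).trans (congrArg _ ?_)
    refine (B.stairD_snd _ _ _ _ hi).trans ?_
    rw [show ((z.1 (p + k) : B.stairX S T (p + k, m + (p + k))).1.2 i) = 0 from hz _ _ hi, map_zero,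
      smul_zero, zero_add]
    rfl
  refine (finsum_congr h).trans ?_
  rw [finsum_eq_sum_of_support_subset (s := Finset.range 2)]
  · rw [Finset.sum_range_succ, Finset.sum_range_one]
    simp
  · intro k hk
    by_contra h'
    obtain ⟨k, rfl⟩ : ∃ k', k = k' + 2 := ⟨k - 2, by
      simp only [Finset.coe_range, Set.mem_Iio, not_lt] at h'
      lia⟩
    exact hk (smul_zero _)

lemma totSnd_totD_zero {m m' : ℤ} (hm : m + 1 = m') {z : (B.staircase S T hn).totX m}
    (hz : ∀ p i, T i → B.stairSnd z p i = 0) (h : T 0) :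
    totSnd m m' 0 ((B.staircase S T hn).totD m m' z) = totFst m 0 z := by
  subst hm
  refine Subtype.ext (funext fun q ↦ ?_)
  rw [totSnd_apply, stairSnd_totD hz _ h, stairMap_zero, stairMap_one_zero, smul_zero, add_zero,
    B.castX_castX (by ext <;> simp; lia), totFst_apply]
  exact castX_stairFst_congr (by simp) z _ _

lemma totSnd_totD_succ {m m' : ℤ} (hm : m + 1 = m') {z : (B.staircase S T hn).totX m}
    (hz : ∀ p i, T i → B.stairSnd z p i = 0) {i : ℕ} (h : T (i + 1)) :
    totSnd m m' (i + 1) ((B.staircase S T hn).totD m m' z) =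
      totFst m (i + 1) z + m.negOnePow • totFst m i z := by
  subst hm
  refine Subtype.ext (funext fun q ↦ ?_)
  rw [totSnd_apply, stairSnd_totD hz _ h, stairMap_zero, stairMap_one_succ, map_add,
    B.castX_castX (by ext <;> simp; lia), Units.smul_def, Units.smul_def, map_zsmul,
    B.castX_castX (by ext <;> simp <;> lia)]
  exact congrArg₂ (· + ·) (castX_stairFst_congr (by simp) z _ _)
    (congrArg _ (castX_stairFst_congr (by simp; lia) z _ _))

lemma castX_totX {m p p' : ℤ} (h : p = p') (x : B.totX m) :
    B.castX (p, m + p) (p', m + p') (x.1 p) = x.1 p' := by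
  subst h
  exact B.castX_self _ _

/-- The element of the total complex of a staircase with given coefficients of the `e_i`, and with
vanishing coefficients of the `f_i`. -/
noncomputable def stairOf {m : ℤ} (x : ℕ → B.totX m) (hx : ∀ i, ¬ S i → x i = 0) (N : ℤ)
    (hN : ∀ i, x i ∈ B.totF N m) : (B.staircase S T hn).totX m :=
  ⟨fun p ↦ (⟨(fun i ↦ B.castX (p + i, m + (p + i)) _ ((x i).1 (p + i)), 0),
    fun i hi ↦ (congrArg (fun y : B.totX m ↦ B.castX _ _ (y.1 (p + i))) (hx i hi)).trans
      (map_zero _), fun _ _ ↦ rfl⟩ : B.stairX S T (p, m + p)),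
    ⟨N, fun p hp ↦ B.stairX_ext (z' := 0)
      (fun i ↦ (congrArg (B.castX _ _) (hN i _ (by lia))).trans (map_zero _)) fun _ _ ↦ rfl⟩⟩

section

variable {m : ℤ} (x : ℕ → B.totX m) (hx : ∀ i, ¬ S i → x i = 0) (N : ℤ)
  (hN : ∀ i, x i ∈ B.totF N m)

lemma totFst_stairOf (i : ℕ) :
    totFst m i (stairOf x hx N hN : (B.staircase S T hn).totX m) = x i := by
  refine Subtype.ext (funext fun q ↦ ?_)
  refine (B.castX_castX (by ext <;> simp; ring) _ _).trans ?_
  exact castX_totX (by ring) _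

lemma totSnd_stairOf (m₀ : ℤ) (i : ℕ) :
    totSnd m₀ m i (stairOf x hx N hN : (B.staircase S T hn).totX m) = 0 :=
  Subtype.ext (funext fun _ ↦ map_zero (B.castX _ _))

lemma totMapX_stairOf :
    totMapX (B.staircaseπ S T hn) m (stairOf x hx N hN) = x 0 := by
  refine Subtype.ext (funext fun q ↦ ?_)
  refine (B.castX_castX (by ext <;> simp) _ _).trans ?_
  exact castX_totX (by simp) _

end

end

end Multicomplex
end SpecSeqHomotopy

/-! ### Discs of multicomplexes: the staircase of length r. -/

namespace SpecSeqHomotopy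
namespace Multicomplex

/-- The indices of the generators `e_i` of the staircase of length `r`. -/
def stairS (r i : ℕ) : Prop := i = 0 ∨ i < r

/-- The indices of the generators `f_i` of the staircase of length `r`. -/
def stairT (r i : ℕ) : Prop := (r = 0 ∧ i = 0) ∨ (1 ≤ i ∧ i ≤ r)

section

variable {M : Type*} [AddCommGroup M]

/-- For r ≥ 1 there are as many unknowns x_0, …, x_{r-1} as equations, solved by back substitution
from x_r = 0. For r = 0 the system is x_0 = y_0. -/
lemma exists_stair_solution {τ : ℤ} (hτ : τ * τ = 1) (r : ℕ) (y : ℕ → M)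
    (hy : ∀ i, ¬ stairT r i → y i = 0)
    (Q : AddSubgroup M) (hQ : ∀ i, y i ∈ Q) :
    ∃ x : ℕ → M, (∀ i, ¬ stairS r i → x i = 0) ∧ (∀ i, x i ∈ Q) ∧ (stairT r 0 → x 0 = y 0) ∧
      ∀ i, stairT r (i + 1) → x (i + 1) + τ • x i = y (i + 1) := by
  obtain rfl | hr := Nat.eq_zero_or_pos r
  · exact ⟨y, fun i hi ↦ hy i (by simp [stairS, stairT] at hi ⊢; lia), hQ, fun _ ↦ rfl,
      fun i hi ↦ by simp [stairT] at hi⟩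
  · have hy' : ∀ i, r < i → y i = 0 := fun i hi ↦ hy i (by simp [stairT]; lia)
    -- Closed form of the back substitution, x_i = τ g_i with g_i = -τ g_{i+1} + y_{i+1}; r + 1
    -- terms are enough since y vanishes beyond r.
    let g : ℕ → M := fun i ↦ ∑ s ∈ Finset.range (r + 1), (-τ) ^ s • y (i + s + 1)
    refine ⟨fun i ↦ τ • g i, fun i hi ↦ ?_, fun i ↦ ?_, fun h ↦ ?_, fun i _ ↦ ?_⟩
    · have hi' : r ≤ i := by simp [stairS] at hi; lia
      have : g i = 0 := Finset.sum_eq_zero fun s _ ↦ by rw [hy' _ (by lia), smul_zero]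
      simp [this]
    · exact zsmul_mem (sum_mem fun s _ ↦ zsmul_mem (hQ _) _) _
    · simp [stairT] at h
      lia
    · have h₁ : g (i + 1) = ∑ s ∈ Finset.range r, (-τ) ^ s • y (i + 1 + s + 1) := by
        refine (Finset.sum_range_succ _ _).trans ?_
        rw [hy' _ (by lia), smul_zero, add_zero]
      have h₂ : g i = -τ • g (i + 1) + y (i + 1) := by
        refine (Finset.sum_range_succ' _ _).trans ?_
        rw [h₁, Finset.smul_sum, pow_zero, one_smul]
        refine congrArg (· + _) (Finset.sum_congr rfl fun s _ ↦ ?_)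
        rw [smul_smul, pow_succ', show i + (s + 1) + 1 = i + 1 + s + 1 by ring]
      change τ • g (i + 1) + τ • τ • g i = _
      rw [smul_smul, hτ, one_smul, h₂, ← add_assoc, ← add_smul, add_neg_cancel, zero_smul, zero_add]

/-- The same back substitution modulo Q: for r ≥ 1, start from x_r = 0 and descend, τ being
invertible. -/
lemma mem_of_stair_solution {τ : ℤ} (hτ : τ * τ = 1) (r : ℕ) (x : ℕ → M)
    (hx : ∀ i, ¬ stairS r i → x i = 0)
    (Q : AddSubgroup M) (h₀ : stairT r 0 → x 0 ∈ Q)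
    (h : ∀ i, stairT r (i + 1) → x (i + 1) + τ • x i ∈ Q) (i : ℕ) : x i ∈ Q := by
  obtain rfl | hr := Nat.eq_zero_or_pos r
  · obtain rfl | hi := Nat.eq_zero_or_pos i
    · exact h₀ (.inl ⟨rfl, rfl⟩)
    · rw [hx i (by simp [stairS]; lia)]
      exact zero_mem _
  · have hx' : ∀ i, r ≤ i → x i ∈ Q := fun i hi ↦ by
      rw [hx i (by simp [stairS]; lia)]
      exact zero_mem _
    by_cases hi : r ≤ i
    · exact hx' i hi
    · refine Nat.decreasingInduction (motive := fun j _ ↦ x j ∈ Q) (fun j hj hxj ↦ ?_)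
        (hx' r le_rfl) (not_le.1 hi).le
      have := zsmul_mem (sub_mem (h j (.inr (by lia))) hxj) τ
      rwa [add_sub_cancel_left, smul_smul, hτ, one_smul] at this

end

lemma negOnePow_mul_self (m : ℤ) : ((m.negOnePow : ℤˣ) : ℤ) * m.negOnePow = 1 := by
  rw [← Units.val_mul, Int.units_mul_self, Units.val_one]

variable {R : Type u} [CommRing R] {n : ℕ∞} (B : Multicomplex.{v} R n) (hn : 2 ≤ n) (r : ℕ)

lemma totF_le {p p' : ℤ} (h : p ≤ p') (m : ℤ) : B.totF p m ≤ B.totF p' m :=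
  B.tot.F_le h m

variable {B} in
lemma mem_tot_Z {k p m : ℤ} {x : B.totX m} (p' m' : ℤ) (hp : p - k = p') (hm : m + 1 = m') :
    x ∈ B.tot.Z k p m ↔ x ∈ B.totF p m ∧ B.totD m m' x ∈ B.totF p' m' :=
  B.tot.mem_Z m' p' hm hp x

/-- The staircase of length `r`. -/
noncomputable abbrev disc : Multicomplex.{v} R n := B.staircase (stairS r) (stairT r) hn

/-- The projection of the staircase of length `r`. -/
noncomputable abbrev discπ : B.disc hn r ⟶ B := B.staircaseπ (stairS r) (stairT r) hn

/-- The lift has e_i coefficient (-ε)^i a, with ε = (-1)^m. For r ≥ 1 the contributions to f_1, …,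
f_{r-1} cancel in pairs; what remains sits on f_r, in filtration p - r ≤ p - k. -/
lemma exists_disc_lift (k : ℕ) (hk : k ≤ r) (p m : ℤ) (a : B.totX m) (ha : a ∈ B.tot.Z k p m) :
    ∃ z ∈ (B.disc hn r).tot.Z k p m, totMapX (B.discπ hn r) m z = a := by
  classical
  rw [mem_tot_Z _ _ rfl rfl] at ha
  let ε : ℤ := m.negOnePow
  let x : ℕ → B.totX m := fun i ↦ if stairS r i then (-ε) ^ i • a else 0
  have hx : ∀ i, ¬ stairS r i → x i = 0 := fun i hi ↦ if_neg hi
  have hxF : ∀ i, x i ∈ B.totF p m := fun i ↦ by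
    by_cases h : stairS r i
    · simpa only [x, if_pos h] using zsmul_mem ha.1 _
    · simp only [x, if_neg h]
      exact zero_mem _
  let z : (B.disc hn r).totX m := stairOf x hx p hxF
  refine ⟨z, ?_, ?_⟩
  · refine (mem_tot_Z _ _ rfl rfl).2 ?_
    rw [mem_staircase_totF (sub_add_cancel m 1), mem_staircase_totF rfl]
    refine ⟨⟨fun i ↦ ?_, fun i _ ↦ ?_⟩, fun i ↦ ?_, fun i hi ↦ ?_⟩
    · rw [totFst_stairOf]
      exact B.totF_le (by lia) _ (hxF i)
    · rw [totSnd_stairOf]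
      exact zero_mem _
    · rw [totFst_totD, totFst_stairOf, map_zsmul]
      refine zsmul_mem (B.totF_le (p := p - k) (by lia) _ ?_) _
      by_cases h : stairS r i
      · simp only [x, if_pos h]
        rw [map_zsmul]
        exact zsmul_mem ha.2 _
      · simp only [x, if_neg h, map_zero]
        exact zero_mem _
    · cases i with
      | zero =>
        rw [totSnd_totD_zero rfl (fun _ _ _ ↦ rfl) hi, totFst_stairOf]
        refine B.totF_le ?_ _ (hxF _)
        simp [stairT] at hi
        lia
      | succ i =>
        rw [totSnd_totD_succ rfl (fun _ _ _ ↦ rfl) hi, totFst_stairOf, totFst_stairOf,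
          Units.smul_def]
        simp only [stairT] at hi
        by_cases h : i + 1 < r
        · have h₀ : x (i + 1) + ε • x i = 0 := by
            simp only [x, if_pos (show stairS r (i + 1) from .inr h),
              if_pos (show stairS r i from .inr (by lia))]
            rw [smul_smul, ← add_smul, pow_succ', ← add_mul, neg_add_cancel, zero_mul, zero_smul]
          exact (congrArg (· ∈ B.totF _ m) h₀).mpr (zero_mem _)
        -- Here i + 1 = r: the coefficient of f_r need only lie in F_{p-k+r}, which contains F_p
        -- because k ≤ r.
        · exact B.totF_le (p := p) (by lia) _ (add_mem (hxF _) (zsmul_mem (hxF _) _))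
  · rw [totMapX_stairOf]
    simp [x, stairS]

/-- Subtracting a suitable d w removes all f-coefficients of z. The rest v is carried by the e_i,
and its coefficients are determined triangularly by the f-part of d v = d z; the bound on d z then
pushes v into F_{p-1}. -/
lemma disc_mem_B (p m : ℤ) (z : (B.disc hn r).totX m) (hz : z ∈ (B.disc hn r).tot.Z (r + 1) p m) :
    z ∈ (B.disc hn r).tot.B (r + 1) p m := by
  obtain ⟨m₀, rfl⟩ : ∃ m₀, m = m₀ + 1 := ⟨m - 1, by ring⟩
  rw [mem_tot_Z (p - r - 1) _ (by ring) rfl] at hz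
  have hz₁ := (mem_staircase_totF rfl _).1 hz.1
  -- The f_i coefficients of z lie in F_{p+i} with i ≤ r, so the solution can be taken in F_{p+r},
  -- as needed for w in Z_r^{p+r}.
  obtain ⟨x, hx, hxF, hx₀, hxs⟩ := exists_stair_solution (negOnePow_mul_self m₀) r
    (fun i ↦ totSnd m₀ (m₀ + 1) i z) (fun i hi ↦ totSnd_eq_zero hi z)
    (B.totF (p + r) m₀).toAddSubgroup (fun i ↦ by
      by_cases hi : stairT r i
      · refine B.totF_le ?_ _ (hz₁.2 i hi)
        simp only [stairT] at hi
        lia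
      · rw [totSnd_eq_zero hi]
        exact zero_mem _)
  let w : (B.disc hn r).totX m₀ := stairOf x hx (p + r) hxF
  let v : (B.disc hn r).totX (m₀ + 1) := z - (B.disc hn r).totD m₀ (m₀ + 1) w
  have hv : ∀ i, stairT r i → totSnd m₀ (m₀ + 1) i v = 0 := fun i hi ↦ by
    rw [map_sub, sub_eq_zero]
    cases i with
    | zero => rw [totSnd_totD_zero rfl (fun _ _ _ ↦ rfl) hi, totFst_stairOf, hx₀ hi]
    | succ i =>
      rw [totSnd_totD_succ rfl (fun _ _ _ ↦ rfl) hi, totFst_stairOf, totFst_stairOf,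
        Units.smul_def, hxs i hi]
  have hv' : ∀ p i, stairT r i → B.stairSnd v p i = 0 := fun p i hi ↦
    stairSnd_eq_zero_of_totSnd rfl (congrArg (fun y ↦ y.1 (p + i)) (hv i hi))
  have hdv : (B.disc hn r).totD (m₀ + 1) (m₀ + 1 + 1) v ∈
      (B.disc hn r).totF (p - r - 1) (m₀ + 1 + 1) := by
    rw [map_sub, totD_totD, sub_zero]
    exact hz.2
  have hdv' := ((mem_staircase_totF rfl _).1 hdv).2
  -- The f_i coefficient of d v lies in F_{p-r-1+i}, inside F_{p-1} since i ≤ r;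
  -- `mem_of_stair_solution` carries this bound to all e_i coefficients of v.
  have hvF : v ∈ (B.disc hn r).totF (p - 1) (m₀ + 1) := by
    rw [mem_staircase_totF rfl]
    refine ⟨fun i ↦ B.totF_le (p := p - 1) (by lia) _ ?_, fun i hi ↦ ?_⟩
    · refine mem_of_stair_solution (negOnePow_mul_self (m₀ + 1)) r
        (fun i ↦ totFst (m₀ + 1) i v) (fun i hi ↦ totFst_eq_zero hi v)
        (B.totF (p - 1) (m₀ + 1)).toAddSubgroup (fun h ↦ ?_) (fun i hi ↦ ?_) i
      · have := hdv' 0 h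
        rw [totSnd_totD_zero rfl hv' h] at this
        exact B.totF_le (by lia) _ this
      · have := hdv' (i + 1) hi
        rw [totSnd_totD_succ rfl hv' hi, Units.smul_def] at this
        simp only [stairT] at hi
        exact B.totF_le (by lia) _ this
    · rw [hv i hi]
      exact zero_mem _
  refine ((B.disc hn r).tot.mem_B (by lia) m₀ (p + r) rfl (by lia) z).2
    ⟨v, ?_, w, ?_, sub_add_cancel z _⟩
  · rw [add_sub_cancel_right]
    exact (mem_tot_Z (p - r - 1) _ (by ring) rfl).2 ⟨hvF, hdv⟩
  · rw [add_sub_cancel_right]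
    refine (mem_tot_Z p _ (by ring) rfl).2 ⟨?_, ?_⟩
    · rw [mem_staircase_totF (sub_add_cancel m₀ 1)]
      refine ⟨fun i ↦ ?_, fun i _ ↦ ?_⟩
      · rw [totFst_stairOf]
        exact B.totF_le (by lia) _ (hxF i)
      · rw [totSnd_stairOf]
        exact zero_mem _
    -- The differential of w is z - v, a difference of two elements of F_p.
    · rw [← sub_sub_cancel z ((B.disc hn r).totD m₀ (m₀ + 1) w)]
      exact sub_mem hz.1 ((B.disc hn r).totF_le (by lia) _ hvF)

lemma map_discπ_surjective (k : ℕ) (hk : k ≤ r) (i : ℤ × ℤ) :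
    Function.Surjective
      ((((spectralSequenceFunctor R n).map (B.discπ hn r)).hom (k : ℤ)).f i).hom := by
  change Function.Surjective (FilteredComplex.mapE (totMap (B.discπ hn r)) k i)
  intro y
  obtain ⟨⟨a, ha⟩, rfl⟩ := Submodule.mkQ_surjective _ y
  obtain ⟨z, hz, rfl⟩ := B.exists_disc_lift hn r k hk _ _ a ha
  exact ⟨(B.disc hn r).tot.cls k i ⟨z, hz⟩, rfl⟩

lemma disc_page_eq_zero (i : ℤ × ℤ)
    (x : (((spectralSequenceFunctor R n).obj (B.disc hn r)).page ((r : ℤ) + 1)).X i) : x = 0 := by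
  change (B.disc hn r).tot.E (r + 1) i at x
  obtain ⟨⟨a, ha⟩, rfl⟩ := Submodule.mkQ_surjective _ x
  exact ((B.disc hn r).tot.cls_eq_zero_iff _ _ _).2 (B.disc_mem_B hn r _ _ a ha)

end Multicomplex

end SpecSeqHomotopy

/-! ### The main theorem. -/

open SpecSeqHomotopy in
theorem mainTheorem7 {R : Type u} [CommRing R] (n : ℕ∞) (hn : 2 ≤ n) (r : ℕ) :
    -- the two sides are almost Brown categories
    IsAlmostBrown (Multicomplex.weq.{v} R n r) (Multicomplex.fib.{v} R n r) ∧
    IsAlmostBrown (SpSe.weq.{v} R r) (SpSe.fib.{v} R r) ∧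
    -- `E'` preserves weak equivalences
    (∀ {A B : Multicomplex.{v} R n} (f : A ⟶ B), Multicomplex.weq R n r f →
      SpSe.weq R r ((Multicomplex.spectralSequenceFunctor R n).map f)) ∧
    -- `E'` is left exact
    IsLeftExact (Multicomplex.weq.{v} R n r) (Multicomplex.fib.{v} R n r)
      (SpSe.weq.{v} R r) (SpSe.fib.{v} R r) (Multicomplex.spectralSequenceFunctor.{v} R n) := by
  -- The classes on multicomplexes unfold to inverse images along `E'`, so preservation of weak
  -- equivalences is the identity. The staircase of length r serves as the disc for every k ≤ r.
  refine ⟨isAlmostBrown_inverseImage (Multicomplex.spectralSequenceFunctor R n) r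
    (fun g p hp ↦ (Multicomplex.isPullback_pullbackMulticomplex g p).hasPullback)
    (fun sq hp ↦ Multicomplex.map_isPullback sq hp)
    (fun B k hk ↦ ⟨B.disc hn r, B.discπ hn r, B.map_discπ_surjective hn r k hk,
      B.disc_page_eq_zero hn r⟩), SpSe.isAlmostBrown r, fun f hf ↦ hf,
    isLeftExact_of_additive (Multicomplex.spectralSequenceFunctor R n) r
      (fun sq hp ↦ Multicomplex.map_isPullback sq hp)⟩
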